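/- Let $\mathbb D=\{z\in\mathbb C:|z|<1\}$ and fix $r_0\in(0,1)$. For a meromorphic function $f$ on $\mathbb D$, a point $a\in\overline{\mathbb C}=\mathbb C\cup\{\infty\}$ and $r_0<r<1$ put $$T_f(r)=\int_{r_0}^r\frac{dt}{t}\int_{|z|<t}f^*\omega_{FS},\qquad f^*\omega_{FS}=\frac1\pi\,\frac{|f'(z)|^2}{(1+|f(z)|^2)^2}\,dx\,dy,\qquad \overline N_f(r,a)=\int_{r_0}^r\frac{\overline n_f(t,a)}{t}\,dt,$$ where $\omega_{FS}$ is the Fubini–Study form on $\overline{\mathbb C}$ of total mass $1$ and $\overline n_f(t,a)$ is the number of distinct points $z$ with $|z|<t$ and $f(z)=a$ (poles of $f$ if $a=\infty$). Let $f$ be a nonconstant meromorphic function on $\mathbb D$ and let $a_1,\dots,a_q$ be distinct points of $\overline{\mathbb C}$. Then for any $\delta>0$ there are a constant $C>0$ (which may depend on $f,a_1,\dots,a_q,r_0,\delta$, but not on $r$) and a measurable set $E_\delta\subset(0,1)$ with $$\int_{E_\delta}\frac{dr}{1-r}<\infty$$ such that every $r\in(0,1)\setminus E_\delta$ satisfies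 $r>r_0$, $T_f(r)>0$ and $$(q-2)\,T_f(r)\le\sum_{j=1}^q\overline N_f(r,a_j)+C\Big(\log T_f(r)+\log\frac1{1-r}\Big).$$ -/

import Mathlib

/-!
Nevanlinna functions on the unit disc. A meromorphic function on the disc is represented by a
function `f : ℂ → ℂ` with `MeromorphicOn f (Metric.ball 0 1)`; its values on a discrete subset of
the disc (poles, removable singularities) and outside the disc are irrelevant.
The Riemann sphere is `OnePoint ℂ`.
-/

namespace DiscNevanlinna

/-- `f` takes the value `a` at the point `z`, for a meromorphic function `f` and a point `a` of the
Riemann sphere: `f - a` has a zero at `z` if `a` is finite, and `f` has a pole at `z` if `a = ∞`. -/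
def TakesValue (f : ℂ → ℂ) : OnePoint ℂ → ℂ → Prop
  | none, z => meromorphicOrderAt f z < 0
  | some a, z => 0 < meromorphicOrderAt (fun w => f w - a) z

/-- The number of distinct points of the open disc of radius `t` at which `f` takes
the value `a`. -/
noncomputable def nbar (f : ℂ → ℂ) (a : OnePoint ℂ) (t : ℝ) : ℕ :=
  Set.ncard {z : ℂ | z ∈ Metric.ball (0 : ℂ) t ∧ TakesValue f a z}

/-- The simple (truncated) counting function `∫_{r₀}^r n̄(t, a) dt / t`. -/
noncomputable def Nbar (r₀ : ℝ) (f : ℂ → ℂ) (a : OnePoint ℂ) (r : ℝ) : ℝ :=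
  ∫ t in r₀..r, (nbar f a t : ℝ) / t

/-- The density of `f^* ω_FS` with respect to Lebesgue measure on `ℂ`, where
`ω_FS = (i / 2π) ∂∂̄ log (1 + |w|²)` is the Fubini-Study form of total mass one. -/
noncomputable def fubiniStudyDensity (f : ℂ → ℂ) (z : ℂ) : ℝ :=
  (1 / Real.pi) * (‖deriv f z‖ ^ 2 / (1 + ‖f z‖ ^ 2) ^ 2)

/-- The Ahlfors characteristic function `∫_{r₀}^r (dt / t) ∫_{|z| < t} f^* ω_FS`. -/
noncomputable def T (r₀ : ℝ) (f : ℂ → ℂ) (r : ℝ) : ℝ :=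
  ∫ t in r₀..r, (∫ z in Metric.ball (0 : ℂ) t, fubiniStudyDensity f z) / t

/-- `f` is nonconstant as a meromorphic function on the unit disc: it does not agree with any
constant off a discrete closed subset of the disc. -/
def Nonconstant (f : ℂ → ℂ) : Prop :=
  ∀ c : ℂ, ¬ ∀ᶠ z in Filter.codiscreteWithin (Metric.ball (0 : ℂ) 1), f z = c

end DiscNevanlinna

open Set Filter Topology MeasureTheory Metric Real

open scoped ENNReal

/-! ### Green's formula on discs centred at the origin -/

namespace DiscNevanlinna

/-! On a disc of radius R < 1 write f = G/H with G, H holomorphic without common zeros, and let W =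
G'H - GH'. The pulled back Fubini–Study density is |W|² / (π(|G|² + |H|²)²). To each a_j belongs a
unit linear form F_j in (G, H) that vanishes exactly where f takes the value a_j, and x_j = |F_j|² /
(|G|² + |H|²) is the squared chordal distance from f to a_j. Green's formula for log(|G|² + |H|²)
and Jensen's formula for F_j and W show that, from radius r₀ to r, the circle average of log x_j
increases by 2N_j - 2T and that of the log of the density by 2N_W - 4T, where N_j and N_W count
zeros with multiplicity. Subtracting, (q-2)T equals ΣN_j - N_W plus half the increment of the
average of log(density / ∏ x_j). A zero of F_j of order m is a zero of W of order at least m-1, and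
no two of the F_j vanish at the same point, so ΣN_j - N_W ≤ ΣN̄_j (`sum_order_form_le`,
`sub_two_mul_T_le`).

It remains to bound the average of log(density / ∏ x_j) on |z| = r. The points a_j are separated, so
at each z only the smallest x_j matters. The weight 1/x_j is too singular, but 1/(s²x_j) with s = 3
- log x_j is not: the Legendre operator, which is the spherical Laplacian on functions of x, sends
-log s to at least 1/(s²x) - 2. Green's formula then bounds the iterated integral of density/(s²x_j)
by T plus a constant (`radialIntegral_gauge_density_le`; x is first replaced by x + η, and η → 0 by
Fatou). Borel's growth lemma, applied twice, bounds the circle integral by powers of T and 1/(1-r)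
off an exceptional set (`exists_exceptional_set_gauge`). A tangent-line form of the concavity of log
turns this into log T + log 1/(1-r). The factor s² costs twice the average of log s, which the first
main theorem controls.

The pair (G, H) depends on R, but every bound is stated in terms of f alone, so the constants do not
depend on r. -/

/-- Differentiation under the integral sign over `[a, b]` with a continuous derivative. -/
theorem hasDerivAt_intervalIntegral_of_continuousOn {F F' : ℝ → ℝ → ℝ} {a b R : ℝ}
    (hF : ContinuousOn (Function.uncurry F) (Ioo (-R) R ×ˢ univ))
    (hF' : ContinuousOn (Function.uncurry F') (Ioo (-R) R ×ˢ univ))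
    (hd : ∀ r ∈ Ioo (-R) R, ∀ θ, HasDerivAt (fun r => F r θ) (F' r θ) r)
    {r : ℝ} (hr : r ∈ Ioo (-R) R) :
    HasDerivAt (fun r => ∫ θ in a..b, F r θ) (∫ θ in a..b, F' r θ) r := by
  have slice : ∀ {G : ℝ → ℝ → ℝ}, ContinuousOn (Function.uncurry G) (Ioo (-R) R ×ˢ univ) →
      ∀ s ∈ Ioo (-R) R, Continuous (G s) := fun {G} hG s hs => by
    have : ContinuousOn (fun θ => Function.uncurry G (s, θ)) univ :=
      hG.comp (by fun_prop) (fun θ _ => ⟨hs, mem_univ _⟩)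
    exact continuousOn_univ.1 this
  obtain ⟨ε, hε, hball⟩ := Metric.nhds_basis_closedBall.mem_iff.1 (isOpen_Ioo.mem_nhds hr)
  have hcomp : IsCompact (closedBall r ε ×ˢ uIcc a b) :=
    (isCompact_closedBall r ε).prod isCompact_uIcc
  obtain ⟨C, hC⟩ := hcomp.exists_bound_of_continuousOn
    (hF'.mono (prod_mono hball (subset_univ _)))
  refine (intervalIntegral.hasDerivAt_integral_of_dominated_loc_of_deriv_le
    (F := F) (F' := F') (bound := fun _ => C) (s := ball r ε) (ball_mem_nhds r hε) ?_ ?_ ?_ ?_ ?_ ?_).2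
  · filter_upwards [isOpen_Ioo.mem_nhds hr] with s hs
    exact (slice hF s hs).aestronglyMeasurable
  · exact (slice hF r hr).intervalIntegrable _ _
  · exact (slice hF' r hr).aestronglyMeasurable
  · refine Eventually.of_forall fun θ hθ s hs => ?_
    exact hC (s, θ) ⟨ball_subset_closedBall hs, uIoc_subset_uIcc hθ⟩
  · exact intervalIntegrable_const
  · exact Eventually.of_forall fun θ _ s hs => hd s (hball (ball_subset_closedBall hs)) θ

theorem circleMap_zero_mem_ball {R r : ℝ} (hr : r ∈ Ioo (-R) R) (θ : ℝ) :
    circleMap 0 r θ ∈ ball (0 : ℂ) R := by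
  simpa using abs_lt.2 hr

theorem continuousOn_comp_circleMap {E : Type*} [TopologicalSpace E] {u : ℂ → E} {R : ℝ}
    (hu : ContinuousOn u (ball 0 R)) :
    ContinuousOn (fun p : ℝ × ℝ => u (circleMap 0 p.1 p.2)) (Ioo (-R) R ×ˢ univ) := by
  refine hu.comp (Continuous.continuousOn ?_) fun p hp => circleMap_zero_mem_ball hp.1 _
  unfold circleMap; fun_prop

theorem hasDerivAt_circleMap_radius (r θ : ℝ) :
    HasDerivAt (fun r : ℝ => circleMap 0 r θ) (circleMap 0 1 θ) r := by
  have := (Complex.ofRealCLM.hasDerivAt (x := r)).mul_const (Complex.exp (θ * Complex.I))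
  simpa [circleMap] using this

theorem clm_apply_circleMap (A : ℂ →L[ℝ] ℝ) (r θ : ℝ) :
    A (circleMap 0 r θ) = r * A (circleMap 0 1 θ) := by
  have : circleMap 0 r θ = r • circleMap 0 1 θ := by simp [circleMap]
  rw [this, map_smul, smul_eq_mul]

/-- The vectors z and iz are orthogonal of equal length, so summing over them gives |z|² times the
trace. The cross terms cancel without symmetry of B. -/
theorem bilin_add_bilin_mul_I (B : ℂ →L[ℝ] ℂ →L[ℝ] ℝ) (z : ℂ) :
    B z z + B (z * Complex.I) (z * Complex.I) =
      ‖z‖ ^ 2 * (B 1 1 + B Complex.I Complex.I) := by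
  have h1 : z = z.re • (1 : ℂ) + z.im • Complex.I := by
    simp [Complex.re_add_im]
  have h2 : z * Complex.I = (-z.im) • (1 : ℂ) + z.re • Complex.I := by
    apply Complex.ext <;> simp
  rw [h2, ← Complex.normSq_eq_norm_sq, Complex.normSq_apply]
  nth_rw 1 2 [h1]
  simp only [map_add, map_smul, add_apply, smul_apply,
    smul_eq_mul]
  ring

/-- The iterated radial integral `∫_{r₀}^r (dt / t) ∫_0^t s · (circle average of w on |z| = s) ds`. -/
noncomputable def radialIntegral (r₀ : ℝ) (w : ℂ → ℝ) (r : ℝ) : ℝ :=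
  ∫ t in r₀..r, (∫ s in (0 : ℝ)..t, s * circleAverage w 0 s) / t

section Green

variable {u L : ℂ → ℝ} {R : ℝ}

theorem continuousOn_circleAverage {w : ℂ → ℝ} (hw : ContinuousOn w (ball 0 R)) :
    ContinuousOn (fun s => circleAverage w 0 s) (Ioo (-R) R) := by
  intro r hr
  have h2 := continuousOn_comp_circleMap hw
  obtain ⟨ε, hε, hball⟩ := Metric.nhds_basis_closedBall.mem_iff.1 (isOpen_Ioo.mem_nhds hr)
  obtain ⟨C, hC⟩ := ((isCompact_closedBall r ε).prod (isCompact_uIcc (a := 0) (b := 2 * π))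
    ).exists_bound_of_continuousOn (h2.mono (prod_mono hball (subset_univ _)))
  have slice : ∀ s ∈ Ioo (-R) R, Continuous fun θ => w (circleMap 0 s θ) := fun s hs =>
    hw.comp_continuous (continuous_circleMap 0 s) (circleMap_zero_mem_ball hs)
  refine ContinuousAt.continuousWithinAt ?_
  refine ContinuousAt.const_smul (g := fun s => ∫ θ in (0 : ℝ)..2 * π, w (circleMap 0 s θ)) ?_
    (2 * π)⁻¹
  refine intervalIntegral.continuousAt_of_dominated_interval (bound := fun _ => C) ?_ ?_
    intervalIntegrable_const ?_
  · filter_upwards [isOpen_Ioo.mem_nhds hr] with s hs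
    exact (slice s hs).aestronglyMeasurable
  · filter_upwards [ball_mem_nhds r hε] with s hs
    exact Eventually.of_forall fun θ hθ =>
      hC (s, θ) ⟨ball_subset_closedBall hs, uIoc_subset_uIcc hθ⟩
  · refine Eventually.of_forall fun θ _ => ?_
    have : ContinuousAt (fun p : ℝ × ℝ => w (circleMap 0 p.1 p.2)) (r, θ) :=
      h2.continuousAt ((isOpen_Ioo.prod isOpen_univ).mem_nhds ⟨hr, mem_univ _⟩)
    exact this.comp (f := fun s : ℝ => (s, θ)) (by fun_prop)

variable {A : ℂ → ℂ →L[ℝ] ℝ} {B : ℂ → ℂ →L[ℝ] ℂ →L[ℝ] ℝ}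

/-- The integrand is the θ-derivative of the periodic function A(z)(iz) with z = re^{iθ}; the term
-A(z)(z) comes from differentiating iz. -/
theorem intervalIntegral_angular_eq_zero (hA : ∀ z ∈ ball (0 : ℂ) R, HasFDerivAt A (B z) z)
    (hB : ContinuousOn B (ball 0 R)) {r : ℝ}
    (hr : r ∈ Ioo (-R) R) :
    ∫ θ in (0 : ℝ)..2 * π,
      (B (circleMap 0 r θ) (circleMap 0 r θ * Complex.I)
        (circleMap 0 r θ * Complex.I) - A (circleMap 0 r θ) (circleMap 0 r θ)) = 0 := by
  have hAc : ContinuousOn A (ball 0 R) := fun z hz => (hA z hz).continuousAt.continuousWithinAt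
  have hz := circleMap_zero_mem_ball hr
  have key : ∀ θ, HasDerivAt
      (fun θ => A (circleMap 0 r θ) (circleMap 0 r θ * Complex.I))
      (B (circleMap 0 r θ) (circleMap 0 r θ * Complex.I)
        (circleMap 0 r θ * Complex.I) - A (circleMap 0 r θ) (circleMap 0 r θ)) θ := by
    intro θ
    have h1 : HasFDerivAt A (B (circleMap 0 r θ)) (circleMap 0 r θ) :=
      hA _ (hz θ)
    have h2 := h1.comp_hasDerivAt θ (hasDerivAt_circleMap 0 r θ)
    have h3 := h2.clm_apply ((hasDerivAt_circleMap 0 r θ).mul_const Complex.I)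
    refine h3.congr_deriv ?_
    have : circleMap 0 r θ * Complex.I * Complex.I = -circleMap 0 r θ := by
      rw [mul_assoc, Complex.I_mul_I]; ring
    rw [this, map_neg]; simp [sub_eq_add_neg]
  have hcm : Continuous fun θ => circleMap 0 r θ := continuous_circleMap 0 r
  have hc : Continuous fun θ =>
      (B (circleMap 0 r θ) (circleMap 0 r θ * Complex.I)
        (circleMap 0 r θ * Complex.I) - A (circleMap 0 r θ) (circleMap 0 r θ)) := by
    have a1 : Continuous fun θ => B (circleMap 0 r θ) :=
      hB.comp_continuous hcm hz
    have a2 : Continuous fun θ => A (circleMap 0 r θ) :=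
      hAc.comp_continuous hcm hz
    exact ((a1.clm_apply (hcm.mul continuous_const)).clm_apply (hcm.mul continuous_const)).sub
      (a2.clm_apply hcm)
  rw [intervalIntegral.integral_eq_sub_of_hasDerivAt (fun θ _ => key θ)
    (hc.intervalIntegrable _ _)]
  have : circleMap 0 r (2 * π) = circleMap 0 r 0 := by
    simpa using (periodic_circleMap 0 r) 0
  rw [this, sub_self]

/-- Divergence theorem with A as gradient, B as Hessian and L as Laplacian: both sides vanish at t =
0, and their t-derivatives agree. -/
theorem radial_flux_eq (hA : ∀ z ∈ ball (0 : ℂ) R, HasFDerivAt A (B z) z)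
    (hB : ContinuousOn B (ball 0 R))
    (hL : ∀ z ∈ ball (0 : ℂ) R, B z 1 1 +
      B z Complex.I Complex.I = L z) {t : ℝ} (ht : t ∈ Ico 0 R) :
    ∫ θ in (0 : ℝ)..2 * π, A (circleMap 0 t θ) (circleMap 0 t θ) =
      2 * π * ∫ s in (0 : ℝ)..t, s * circleAverage L 0 s := by
  have hAc : ContinuousOn A (ball 0 R) := fun z hz => (hA z hz).continuousAt.continuousWithinAt
  have c1 := continuousOn_comp_circleMap hAc
  have c2 := continuousOn_comp_circleMap hB
  have hLc : ContinuousOn L (ball 0 R) := by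
    refine ContinuousOn.congr (f := fun z => B z 1 1 +
      B z Complex.I Complex.I) ?_ fun z hz => (hL z hz).symm
    have := hB
    fun_prop
  have hder : ∀ r ∈ Ioo (-R) R, HasDerivAt
      (fun r => ∫ θ in (0 : ℝ)..2 * π, A (circleMap 0 r θ) (circleMap 0 r θ))
      (∫ θ in (0 : ℝ)..2 * π, (B (circleMap 0 r θ) (circleMap 0 1 θ)
        (circleMap 0 r θ) + A (circleMap 0 r θ) (circleMap 0 1 θ))) r := by
    intro r hr
    have e1 : Continuous fun p : ℝ × ℝ => circleMap 0 p.1 p.2 := by unfold circleMap; fun_prop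
    have e2 : Continuous fun p : ℝ × ℝ => circleMap 0 1 p.2 := by unfold circleMap; fun_prop
    refine hasDerivAt_intervalIntegral_of_continuousOn
      (F := fun r θ => A (circleMap 0 r θ) (circleMap 0 r θ))
      (F' := fun r θ => (B (circleMap 0 r θ) (circleMap 0 1 θ)
        (circleMap 0 r θ) + A (circleMap 0 r θ) (circleMap 0 1 θ))) ?_ ?_ ?_ hr
    · have h := c1.clm_apply e1.continuousOn
      exact h
    · have h := ((c2.clm_apply e2.continuousOn).clm_apply e1.continuousOn).add
        (c1.clm_apply e2.continuousOn)
      exact h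
    · intro s hs θ
      have h1 : HasFDerivAt A (B (circleMap 0 s θ))
          (circleMap 0 s θ) :=
        hA _ (circleMap_zero_mem_ball hs θ)
      have h2 := h1.comp_hasDerivAt s (hasDerivAt_circleMap_radius s θ)
      have h3 := h2.clm_apply (hasDerivAt_circleMap_radius s θ)
      exact h3
  have hval : ∀ r ∈ Ioo 0 R, (∫ θ in (0 : ℝ)..2 * π,
      (B (circleMap 0 r θ) (circleMap 0 1 θ)
        (circleMap 0 r θ) + A (circleMap 0 r θ) (circleMap 0 1 θ))) =
      2 * π * (r * circleAverage L 0 r) := by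
    intro r hr
    have hr' : r ∈ Ioo (-R) R := ⟨by linarith [hr.1, hr.2], hr.2⟩
    have hz := circleMap_zero_mem_ball hr'
    have hcm : Continuous fun θ => circleMap 0 r θ := continuous_circleMap 0 r
    have hcm1 : Continuous fun θ => circleMap 0 1 θ := continuous_circleMap 0 1
    have a1 : Continuous fun θ => B (circleMap 0 r θ) :=
      hB.comp_continuous hcm hz
    have a2 : Continuous fun θ => A (circleMap 0 r θ) :=
      hAc.comp_continuous hcm hz
    have h0 := intervalIntegral_angular_eq_zero hA hB hr'
    -- After multiplication by r the integrand is B(z)(z)(z) + A(z)(z). Adding the angular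
    -- integrand, whose integral is 0, completes it to |z|² times the trace, which is r²L.
    refine mul_left_cancel₀ hr.1.ne' ?_
    have d1 : Continuous fun θ => r * (B (circleMap 0 r θ) (circleMap 0 1 θ) (circleMap 0 r θ) +
        A (circleMap 0 r θ) (circleMap 0 1 θ)) :=
      continuous_const.mul (((a1.clm_apply hcm1).clm_apply hcm).add (a2.clm_apply hcm1))
    have d2 : Continuous fun θ => B (circleMap 0 r θ) (circleMap 0 r θ * Complex.I)
        (circleMap 0 r θ * Complex.I) - A (circleMap 0 r θ) (circleMap 0 r θ) :=
      ((a1.clm_apply (hcm.mul continuous_const)).clm_apply (hcm.mul continuous_const)).sub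
        (a2.clm_apply hcm)
    have hadd := intervalIntegral.integral_add (d1.intervalIntegrable (μ := volume) 0 (2 * π))
      (d2.intervalIntegrable 0 (2 * π))
    rw [h0, add_zero, intervalIntegral.integral_const_mul] at hadd
    rw [← hadd]
    have hpt : ∀ θ : ℝ, r * ((B (circleMap 0 r θ) (circleMap 0 1 θ)
        (circleMap 0 r θ) + A (circleMap 0 r θ) (circleMap 0 1 θ))) +
        (B (circleMap 0 r θ) (circleMap 0 r θ * Complex.I)
        (circleMap 0 r θ * Complex.I) - A (circleMap 0 r θ) (circleMap 0 r θ)) =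
        r ^ 2 * L (circleMap 0 r θ) := by
      intro θ
      have hn : ‖circleMap 0 r θ‖ ^ 2 = r ^ 2 := by simp
      rw [← hL _ (hz θ), ← hn, ← bilin_add_bilin_mul_I, clm_apply_circleMap (A _) r θ]
      have : circleMap 0 r θ = r • circleMap 0 1 θ := by simp [circleMap]
      have e : B (circleMap 0 r θ) (circleMap 0 r θ) (circleMap 0 r θ) =
          r * B (circleMap 0 r θ) (circleMap 0 1 θ) (circleMap 0 r θ) :=
        (congrArg (fun v => B (circleMap 0 r θ) v (circleMap 0 r θ)) this).trans
          (by simp only [map_smul, smul_apply, smul_eq_mul])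
      rw [e]; ring
    simp_rw [hpt]
    rw [intervalIntegral.integral_const_mul, circleAverage_def, smul_eq_mul]
    field_simp
  have hR : 0 < R := ht.1.trans_lt ht.2
  have hsub : Icc 0 t ⊆ Ioo (-R) R := fun s hs => ⟨by linarith [hs.1], by linarith [hs.2, ht.2]⟩
  have hftc := intervalIntegral.integral_eq_sub_of_hasDerivAt_of_le ht.1
    (f := fun r => ∫ θ in (0 : ℝ)..2 * π, A (circleMap 0 r θ) (circleMap 0 r θ))
    (f' := fun r => 2 * π * (r * circleAverage L 0 r))
    (fun s hs => (hder s (hsub hs)).continuousAt.continuousWithinAt)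
    (fun s hs => hval s ⟨hs.1, hs.2.trans ht.2⟩ ▸ hder s (hsub (Ioo_subset_Icc_self hs)))
    (by
      refine ContinuousOn.intervalIntegrable ?_
      rw [uIcc_of_le ht.1]
      have := (continuousOn_circleAverage hLc).mono hsub
      fun_prop)
  rw [intervalIntegral.integral_const_mul] at hftc
  rw [hftc]
  simp

/-- Green's formula on discs centred at the origin. -/
theorem circleAverage_sub_circleAverage_eq_radialIntegral (hu : ContDiffOn ℝ 2 u (ball 0 R))
    (hL : ∀ z ∈ ball (0 : ℂ) R, fderiv ℝ (fderiv ℝ u) z 1 1 +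
      fderiv ℝ (fderiv ℝ u) z Complex.I Complex.I = L z) {r₀ r : ℝ} (hr₀ : 0 < r₀) (h : r₀ ≤ r)
    (hr : r < R) :
    circleAverage u 0 r - circleAverage u 0 r₀ = radialIntegral r₀ L r := by
  have hu1 : ContDiffOn ℝ 1 (fderiv ℝ u) (ball 0 R) :=
    hu.fderiv_of_isOpen isOpen_ball (by norm_num)
  have hu2 : ContDiffOn ℝ 0 (fderiv ℝ (fderiv ℝ u)) (ball 0 R) :=
    hu1.fderiv_of_isOpen isOpen_ball (by norm_num)
  have hA : ∀ z ∈ ball (0 : ℂ) R, HasFDerivAt (fderiv ℝ u) (fderiv ℝ (fderiv ℝ u) z) z :=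
    fun z hz => ((hu1.differentiableOn (by norm_num)).differentiableAt
      (isOpen_ball.mem_nhds hz)).hasFDerivAt
  have c0 := continuousOn_comp_circleMap hu.continuousOn
  have c1 := continuousOn_comp_circleMap hu1.continuousOn
  have e2 : Continuous fun p : ℝ × ℝ => circleMap 0 1 p.2 := by unfold circleMap; fun_prop
  have e1 : Continuous fun p : ℝ × ℝ => circleMap 0 p.1 p.2 := by unfold circleMap; fun_prop
  have hder : ∀ t ∈ Ioo (-R) R, HasDerivAt
      (fun r => ∫ θ in (0 : ℝ)..2 * π, u (circleMap 0 r θ))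
      (∫ θ in (0 : ℝ)..2 * π, fderiv ℝ u (circleMap 0 t θ) (circleMap 0 1 θ)) t := by
    intro t ht
    refine hasDerivAt_intervalIntegral_of_continuousOn
      (F := fun r θ => u (circleMap 0 r θ))
      (F' := fun r θ => fderiv ℝ u (circleMap 0 r θ) (circleMap 0 1 θ)) c0
      (c1.clm_apply e2.continuousOn) ?_ ht
    intro s hs θ
    have h1 : HasFDerivAt u (fderiv ℝ u (circleMap 0 s θ)) (circleMap 0 s θ) :=
      ((hu.differentiableOn (by norm_num)).differentiableAt
        (isOpen_ball.mem_nhds (circleMap_zero_mem_ball hs θ))).hasFDerivAt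
    exact h1.comp_hasDerivAt s (hasDerivAt_circleMap_radius s θ)
  have hR : 0 < R := hr₀.trans_le h |>.trans hr
  have hmem : ∀ t ∈ Icc r₀ r, t ∈ Ioo (-R) R := fun t ht =>
    ⟨by linarith [ht.1], by linarith [ht.2]⟩
  have hder' : ∀ t ∈ Icc r₀ r, HasDerivAt (fun r => circleAverage u 0 r)
      ((∫ s in (0 : ℝ)..t, s * circleAverage L 0 s) / t) t := by
    intro t ht
    have ht0 : 0 < t := hr₀.trans_le ht.1
    have := (hder t (hmem t ht)).const_smul (2 * π)⁻¹
    refine this.congr_deriv ?_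
    have hf := radial_flux_eq hA hu2.continuousOn hL (t := t) ⟨ht0.le, ht.2.trans_lt hr⟩
    simp_rw [fun θ => clm_apply_circleMap (fderiv ℝ u (circleMap 0 t θ)) t θ] at hf
    rw [intervalIntegral.integral_const_mul] at hf
    rw [smul_eq_mul]
    field_simp
    linarith
  have hLc : ContinuousOn L (ball 0 R) := by
    refine ContinuousOn.congr (f := fun z => fderiv ℝ (fderiv ℝ u) z 1 1 +
      fderiv ℝ (fderiv ℝ u) z Complex.I Complex.I) ?_ fun z hz => (hL z hz).symm
    have := hu2.continuousOn
    fun_prop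
  rw [radialIntegral, intervalIntegral.integral_eq_sub_of_hasDerivAt
    (f := fun r => circleAverage u 0 r)]
  · intro t ht
    rw [uIcc_of_le h] at ht
    exact hder' t ht
  · refine ContinuousOn.intervalIntegrable ?_
    rw [uIcc_of_le h]
    refine ContinuousOn.div ?_ continuousOn_id fun t ht => (hr₀.trans_le ht.1).ne'
    have hcont : ContinuousOn (fun s => s * circleAverage L 0 s) (Icc 0 r) := by
      have := (continuousOn_circleAverage hLc).mono
        (fun s (hs : s ∈ Icc 0 r) => (⟨by linarith [hs.1], by linarith [hs.2]⟩ : s ∈ Ioo (-R) R))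
      fun_prop
    have := intervalIntegral.continuousOn_primitive_interval (μ := volume) (a := 0) (b := r)
      (f := fun s => s * circleAverage L 0 s)
      (by rw [uIcc_of_le (hr₀.le.trans h)]; exact hcont.integrableOn_Icc)
    rw [uIcc_of_le (hr₀.le.trans h)] at this
    exact this.mono (Icc_subset_Icc_left hr₀.le)

end Green

/-! ### Laplacians of functions of a pair of holomorphic functions -/

/-- `|G|² + |H|²`. -/
noncomputable def pairNormSq (G H : ℂ → ℂ) (z : ℂ) : ℝ := ‖G z‖ ^ 2 + ‖H z‖ ^ 2

/-- The Wronskian `G' H - G H'`. -/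
noncomputable def pairWronskian (G H : ℂ → ℂ) (z : ℂ) : ℂ := deriv G z * H z - G z * deriv H z

/-- `π` times the density of the pull-back of the Fubini-Study form by `[G : H]`. -/
noncomputable def pairDensity (G H : ℂ → ℂ) (z : ℂ) : ℝ :=
  ‖pairWronskian G H z‖ ^ 2 / pairNormSq G H z ^ 2

/-- The squared chordal distance of `[G : H]` to `[0 : 1]`. -/
noncomputable def pairChordal (G H : ℂ → ℂ) (z : ℂ) : ℝ := ‖G z‖ ^ 2 / pairNormSq G H z

theorem hasDerivAt_line (z c : ℂ) (τ : ℝ) : HasDerivAt (fun τ : ℝ => z + τ * c) c τ := by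
  simpa using ((Complex.ofRealCLM.hasDerivAt (x := τ)).mul_const c).const_add z

theorem hasDerivAt_clm_line {A : ℂ → ℂ →L[ℝ] ℝ} {B : ℂ →L[ℝ] ℂ →L[ℝ] ℝ} {z : ℂ}
    (h : HasFDerivAt A B z) (c : ℂ) : HasDerivAt (fun τ : ℝ => A (z + τ * c) c) (B c c) 0 := by
  have h5 : HasFDerivAt A B (z + (0 : ℝ) * c) := by simpa using h
  have h6 := h5.comp_hasDerivAt (0 : ℝ) (hasDerivAt_line z c 0)
  have h7 := h6.clm_apply (hasDerivAt_const (0 : ℝ) c)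
  refine h7.congr_deriv ?_
  rw [map_zero, add_zero]

/-- Reduces the Laplacian to one-variable calculus along the real lines through z in the directions
1 and I. -/
theorem fderiv_fderiv_apply_eq_of_line {u : ℂ → ℝ} {z c : ℂ} (hu : ContDiffAt ℝ 2 u z)
    {d : ℝ → ℝ} {d2 : ℝ}
    (h1 : ∀ᶠ τ : ℝ in 𝓝 0, HasDerivAt (fun τ : ℝ => u (z + τ * c)) (d τ) τ)
    (h2 : HasDerivAt d d2 0) : fderiv ℝ (fderiv ℝ u) z c c = d2 := by
  have hl := hasDerivAt_line z c
  have hl0 : Tendsto (fun τ : ℝ => z + τ * c) (𝓝 0) (𝓝 z) := by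
    simpa using (hl 0).continuousAt.tendsto
  have hu1 : ∀ᶠ y in 𝓝 z, DifferentiableAt ℝ u y := by
    filter_upwards [hu.eventually (by simp)] with y hy using hy.differentiableAt (by norm_num)
  have heq : d =ᶠ[𝓝 0] fun τ : ℝ => fderiv ℝ u (z + τ * c) c := by
    filter_upwards [h1, hl0.eventually hu1] with τ h1 h3
    exact h1.unique (h3.hasFDerivAt.comp_hasDerivAt τ (hl τ))
  have h4 : DifferentiableAt ℝ (fderiv ℝ u) z :=
    (hu.fderiv_right (m := 1) (by norm_num)).differentiableAt (by norm_num)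
  exact ((hasDerivAt_clm_line h4.hasFDerivAt c).congr_of_eventuallyEq heq).unique h2

theorem eventually_hasDerivAt_line {G : ℂ → ℂ} {z : ℂ} (hG : AnalyticAt ℂ G z) (c : ℂ) :
    ∀ᶠ τ : ℝ in 𝓝 0, HasDerivAt (fun τ : ℝ => G (z + τ * c)) (c * deriv G (z + τ * c)) τ := by
  have hl := hasDerivAt_line z c
  have hl0 : Tendsto (fun τ : ℝ => z + τ * c) (𝓝 0) (𝓝 z) := by
    simpa using (hl 0).continuousAt.tendsto
  filter_upwards [hl0.eventually hG.eventually_analyticAt] with τ h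
  rw [mul_comm c]
  exact h.differentiableAt.hasDerivAt.comp τ (hl τ)

theorem hasDerivAt_norm_sq {a : ℝ → ℂ} {a' : ℂ} {τ : ℝ} (h : HasDerivAt a a' τ) :
    HasDerivAt (fun τ => ‖a τ‖ ^ 2) (2 * (starRingEnd ℂ (a τ) * a').re) τ := by
  refine h.norm_sq.congr_deriv ?_
  rw [Complex.inner, mul_comm a']

theorem eventually_hasDerivAt_norm_sq_line {G : ℂ → ℂ} {z : ℂ} (hG : AnalyticAt ℂ G z) (c : ℂ) :
    ∀ᶠ τ : ℝ in 𝓝 0, HasDerivAt (fun τ : ℝ => ‖G (z + τ * c)‖ ^ 2)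
      (2 * (starRingEnd ℂ (G (z + τ * c)) * (c * deriv G (z + τ * c))).re) τ :=
  (eventually_hasDerivAt_line hG c).mono fun _ h => hasDerivAt_norm_sq h

/-- The direction is kept as c so that the term with c² G'' visibly cancels in the Laplacian: 1² +
I² = 0. -/
theorem hasDerivAt_norm_sq_line_two {G : ℂ → ℂ} {z : ℂ} (hG : AnalyticAt ℂ G z) (c : ℂ) :
    HasDerivAt
      (fun τ : ℝ => 2 * (starRingEnd ℂ (G (z + τ * c)) * (c * deriv G (z + τ * c))).re)
      (2 * (‖c * deriv G z‖ ^ 2 + (starRingEnd ℂ (G z) * (c ^ 2 * deriv (deriv G) z)).re)) 0 := by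
  have h0 := (eventually_hasDerivAt_line hG c).self_of_nhds
  have h1 := (eventually_hasDerivAt_line hG.deriv c).self_of_nhds
  have h2 := (h0.star.mul (h1.const_mul c))
  have h3 := (Complex.reCLM.hasFDerivAt.comp_hasDerivAt (0 : ℝ) h2).const_mul 2
  refine h3.congr_deriv ?_
  simp only [Complex.ofReal_zero, zero_mul, add_zero, Complex.reCLM_apply, Complex.add_re,
    ← Complex.normSq_eq_norm_sq]
  simp only [Complex.normSq_apply, Complex.mul_re, Complex.mul_im, Complex.star_def,
    Complex.conj_re, Complex.conj_im, pow_two]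
  ring

section OneVariable

variable {A B A1 B1 : ℝ → ℝ} {A2 B2 : ℝ}

theorem hasDerivAt_ratio {a' b' τ : ℝ} (hA : HasDerivAt A a' τ) (hB : HasDerivAt B b' τ)
    (hP : A τ + B τ ≠ 0) :
    HasDerivAt (fun τ => A τ / (A τ + B τ)) ((a' * B τ - A τ * b') / (A τ + B τ) ^ 2) τ := by
  refine (hA.div (hA.add hB) hP).congr_deriv ?_
  simp only [Pi.add_apply]
  congr 1
  ring

theorem hasDerivAt_ratio_two (hA : HasDerivAt A (A1 0) 0) (hB : HasDerivAt B (B1 0) 0)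
    (hA1 : HasDerivAt A1 A2 0) (hB1 : HasDerivAt B1 B2 0) (hP : A 0 + B 0 ≠ 0) :
    HasDerivAt (fun τ => (A1 τ * B τ - A τ * B1 τ) / (A τ + B τ) ^ 2)
      (((A2 * B 0 - A 0 * B2) * (A 0 + B 0) -
        2 * (A1 0 * B 0 - A 0 * B1 0) * (A1 0 + B1 0)) / (A 0 + B 0) ^ 3) 0 := by
  refine (((hA1.mul hB).sub (hA.mul hB1)).div ((hA.add hB).pow 2) (pow_ne_zero 2 hP)).congr_deriv ?_
  simp only [Pi.add_apply, Pi.sub_apply, Pi.mul_apply, Pi.pow_apply]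
  field_simp
  ring

end OneVariable

section Pair

variable {G H : ℂ → ℂ} {z : ℂ}

theorem pairNormSq_pos (h0 : G z ≠ 0 ∨ H z ≠ 0) : 0 < pairNormSq G H z := by
  unfold pairNormSq
  rcases h0 with h | h
  · have := norm_pos_iff.2 h; positivity
  · have := norm_pos_iff.2 h; positivity

theorem AnalyticAt.contDiffAt_norm_sq {n : WithTop ℕ∞} (hG : AnalyticAt ℂ G z) :
    ContDiffAt ℝ n (fun z => ‖G z‖ ^ 2) z :=
  (hG.contDiffAt.restrict_scalars ℝ).norm_sq ℝ

theorem contDiffAt_pairNormSq {n : WithTop ℕ∞} (hG : AnalyticAt ℂ G z) (hH : AnalyticAt ℂ H z) :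
    ContDiffAt ℝ n (pairNormSq G H) z :=
  (AnalyticAt.contDiffAt_norm_sq hG).add (AnalyticAt.contDiffAt_norm_sq hH)

theorem contDiffAt_pairChordal {n : WithTop ℕ∞} (hG : AnalyticAt ℂ G z) (hH : AnalyticAt ℂ H z)
    (h0 : G z ≠ 0 ∨ H z ≠ 0) : ContDiffAt ℝ n (pairChordal G H) z :=
  (AnalyticAt.contDiffAt_norm_sq hG).div (contDiffAt_pairNormSq hG hH) (pairNormSq_pos h0).ne'

theorem pairChordal_nonneg : 0 ≤ pairChordal G H z := by unfold pairChordal pairNormSq; positivity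

theorem pairChordal_le_one : pairChordal G H z ≤ 1 :=
  div_le_one_of_le₀ (by unfold pairNormSq; nlinarith [sq_nonneg ‖H z‖])
    (by unfold pairNormSq; positivity)

theorem eventually_line {p : ℂ → Prop} (h : ∀ᶠ y in 𝓝 z, p y) (c : ℂ) :
    ∀ᶠ τ : ℝ in 𝓝 0, p (z + τ * c) := by
  have : Tendsto (fun τ : ℝ => z + τ * c) (𝓝 0) (𝓝 (z + (0 : ℝ) * c)) :=
    Continuous.tendsto (by fun_prop) _
  simp only [Complex.ofReal_zero, zero_mul, add_zero] at this
  exact this.eventually h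

theorem eventually_pairNormSq_pos (hG : AnalyticAt ℂ G z) (hH : AnalyticAt ℂ H z)
    (h0 : G z ≠ 0 ∨ H z ≠ 0) : ∀ᶠ y in 𝓝 z, 0 < pairNormSq G H y :=
  (contDiffAt_pairNormSq (n := 0) hG hH).continuousAt.eventually (lt_mem_nhds (pairNormSq_pos h0))

theorem contDiffAt_log_pairNormSq {n : WithTop ℕ∞} (hG : AnalyticAt ℂ G z)
    (hH : AnalyticAt ℂ H z) (h0 : G z ≠ 0 ∨ H z ≠ 0) :
    ContDiffAt ℝ n (fun z => log (pairNormSq G H z)) z :=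
  (contDiffAt_pairNormSq hG hH).log (pairNormSq_pos h0).ne'

/-- Lagrange's identity: with P = |G|² + |H|², the numerator P(|G'|² + |H'|²) - |Ḡ G' + H̄ H'|² of
∂∂̄ log P is |G'H - GH'|². The factor 4 is that of Δ = 4∂∂̄. -/
theorem fderiv_fderiv_log_pairNormSq (hG : AnalyticAt ℂ G z) (hH : AnalyticAt ℂ H z)
    (h0 : G z ≠ 0 ∨ H z ≠ 0) :
    fderiv ℝ (fderiv ℝ fun z => log (pairNormSq G H z)) z 1 1 +
      fderiv ℝ (fderiv ℝ fun z => log (pairNormSq G H z)) z Complex.I Complex.I =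
      4 * pairDensity G H z := by
  have key := fun c : ℂ => by
    have hP := eventually_line (eventually_pairNormSq_pos hG hH h0) c
    have e1 := eventually_hasDerivAt_norm_sq_line hG c
    have e2 := eventually_hasDerivAt_norm_sq_line hH c
    refine fderiv_fderiv_apply_eq_of_line (c := c)
      (contDiffAt_log_pairNormSq (n := 2) hG hH h0)
      (by
        filter_upwards [hP, e1, e2] with τ h1 h2 h3
        exact (h2.add h3).log h1.ne')
      (((hasDerivAt_norm_sq_line_two hG c).add (hasDerivAt_norm_sq_line_two hH c)).div
        (e1.self_of_nhds.add e2.self_of_nhds) hP.self_of_nhds.ne')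
  rw [key 1, key Complex.I]
  have hP : ‖G z‖ ^ 2 + ‖H z‖ ^ 2 ≠ 0 := (pairNormSq_pos h0).ne'
  simp only [Complex.ofReal_zero, zero_mul, add_zero, pairDensity, pairNormSq, pairWronskian,
    Pi.add_apply]
  rw [← add_div, ← mul_div_assoc]
  congr 1
  simp only [← Complex.normSq_eq_norm_sq]
  simp only [Complex.normSq_apply, Complex.mul_re, Complex.mul_im, Complex.conj_re,
    Complex.conj_im, pow_two, Complex.sub_re, Complex.sub_im, Complex.one_re, Complex.one_im,
    Complex.I_re, Complex.I_im]
  ring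

theorem exists_hasDerivAt_line_pairChordal (hG : AnalyticAt ℂ G z) (hH : AnalyticAt ℂ H z)
    (h0 : G z ≠ 0 ∨ H z ≠ 0) (c : ℂ) : ∃ d : ℝ → ℝ,
      d 0 = (2 * (starRingEnd ℂ (G z) * (c * deriv G z)).re * ‖H z‖ ^ 2 - ‖G z‖ ^ 2 *
        (2 * (starRingEnd ℂ (H z) * (c * deriv H z)).re)) / (‖G z‖ ^ 2 + ‖H z‖ ^ 2) ^ 2 ∧
      (∀ᶠ τ : ℝ in 𝓝 0, HasDerivAt (fun τ : ℝ => pairChordal G H (z + τ * c)) (d τ) τ) ∧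
      HasDerivAt d ((((2 * (‖c * deriv G z‖ ^ 2 +
          (starRingEnd ℂ (G z) * (c ^ 2 * deriv (deriv G) z)).re)) * ‖H z‖ ^ 2 -
        ‖G z‖ ^ 2 * (2 * (‖c * deriv H z‖ ^ 2 +
          (starRingEnd ℂ (H z) * (c ^ 2 * deriv (deriv H) z)).re))) * (‖G z‖ ^ 2 + ‖H z‖ ^ 2) -
        2 * (2 * (starRingEnd ℂ (G z) * (c * deriv G z)).re * ‖H z‖ ^ 2 - ‖G z‖ ^ 2 *
          (2 * (starRingEnd ℂ (H z) * (c * deriv H z)).re)) *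
          (2 * (starRingEnd ℂ (G z) * (c * deriv G z)).re +
            2 * (starRingEnd ℂ (H z) * (c * deriv H z)).re)) / (‖G z‖ ^ 2 + ‖H z‖ ^ 2) ^ 3) 0 := by
  have hP : ‖G z‖ ^ 2 + ‖H z‖ ^ 2 ≠ 0 := (pairNormSq_pos h0).ne'
  have hP' := eventually_line (eventually_pairNormSq_pos hG hH h0) c
  have e1 := eventually_hasDerivAt_norm_sq_line hG c
  have e2 := eventually_hasDerivAt_norm_sq_line hH c
  have r2 := hasDerivAt_ratio_two (A := fun τ : ℝ => ‖G (z + τ * c)‖ ^ 2)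
    (B := fun τ : ℝ => ‖H (z + τ * c)‖ ^ 2) e1.self_of_nhds e2.self_of_nhds
    (hasDerivAt_norm_sq_line_two hG c) (hasDerivAt_norm_sq_line_two hH c) (by simpa using hP)
  refine ⟨_, ?_, ?_, r2.congr_deriv ?_⟩
  · simp
  · filter_upwards [hP', e1, e2] with τ h1 h2 h3
    exact hasDerivAt_ratio h2 h3 h1.ne'
  · simp

/-- Chain rule Δφ(x) = φ'(x)Δx + φ''(x)|∇x|², with Δx = 4D(1 - 2x) and |∇x|² = 4D x(1 - x), D being
`pairDensity`. On functions of x the spherical Laplacian is thus the Legendre operator (x(1 -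
x)φ')'. -/
theorem fderiv_fderiv_comp_pairChordal (hG : AnalyticAt ℂ G z) (hH : AnalyticAt ℂ H z)
    (h0 : G z ≠ 0 ∨ H z ≠ 0) {φ φ1 : ℝ → ℝ} {φ2 : ℝ}
    (hφ : ContDiffAt ℝ 2 φ (pairChordal G H z))
    (hφ1 : ∀ y ∈ Icc (0 : ℝ) 1, HasDerivAt φ (φ1 y) y)
    (hφ2 : HasDerivAt φ1 φ2 (pairChordal G H z)) :
    fderiv ℝ (fderiv ℝ fun z => φ (pairChordal G H z)) z 1 1 +
      fderiv ℝ (fderiv ℝ fun z => φ (pairChordal G H z)) z Complex.I Complex.I =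
      4 * pairDensity G H z * ((1 - 2 * pairChordal G H z) * φ1 (pairChordal G H z) +
        pairChordal G H z * (1 - pairChordal G H z) * φ2) := by
  have hP : ‖G z‖ ^ 2 + ‖H z‖ ^ 2 ≠ 0 := (pairNormSq_pos h0).ne'
  have key : ∀ (c : ℂ) (d : ℝ → ℝ) (d2 : ℝ),
      (∀ᶠ τ : ℝ in 𝓝 0, HasDerivAt (fun τ : ℝ => pairChordal G H (z + τ * c)) (d τ) τ) →
      HasDerivAt d d2 0 → fderiv ℝ (fderiv ℝ fun z => φ (pairChordal G H z)) z c c =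
        φ2 * d 0 * d 0 + φ1 (pairChordal G H z) * d2 := by
    intro c d d2 r1 r2
    have h3 := (HasDerivAt.comp (0 : ℝ) (h₂ := φ1) (by simpa using hφ2) r1.self_of_nhds).mul r2
    refine (fderiv_fderiv_apply_eq_of_line (c := c)
      (u := fun z => φ (pairChordal G H z))
      (ContDiffAt.comp z hφ (contDiffAt_pairChordal (n := 2) hG hH h0))
      (d := fun τ => φ1 (pairChordal G H (z + τ * c)) * d τ) ?_ h3).trans ?_
    · filter_upwards [r1] with τ h1
      exact (hφ1 _ ⟨pairChordal_nonneg, pairChordal_le_one⟩).comp τ h1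
    · simp
  obtain ⟨d, d0, r1, r2⟩ := exists_hasDerivAt_line_pairChordal hG hH h0 1
  obtain ⟨d', d0', r1', r2'⟩ := exists_hasDerivAt_line_pairChordal hG hH h0 Complex.I
  rw [key 1 d _ r1 r2, key Complex.I d' _ r1' r2', d0, d0']
  simp only [pairDensity, pairChordal, pairNormSq, pairWronskian]
  generalize φ1 _ = p
  have e1 : 1 - 2 * (‖G z‖ ^ 2 / (‖G z‖ ^ 2 + ‖H z‖ ^ 2)) =
    (‖H z‖ ^ 2 - ‖G z‖ ^ 2) / (‖G z‖ ^ 2 + ‖H z‖ ^ 2) := by field_simp; ring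
  have e2 : 1 - (‖G z‖ ^ 2 / (‖G z‖ ^ 2 + ‖H z‖ ^ 2)) =
    (‖H z‖ ^ 2) / (‖G z‖ ^ 2 + ‖H z‖ ^ 2) := by field_simp; ring
  rw [e1, e2]
  field_simp
  simp only [← Complex.normSq_eq_norm_sq]
  simp only [Complex.normSq_apply, Complex.mul_re, Complex.mul_im, Complex.conj_re,
    Complex.conj_im, pow_two, Complex.sub_re, Complex.sub_im, Complex.I_re, Complex.I_im]
  ring

end Pair

/-! ### The regularised logarithmic gauge -/

/-- `3 - log (x + η)`. -/
noncomputable def logGauge (η x : ℝ) : ℝ := 3 - log (x + η)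

/-- The constant 3 is chosen for this: x + η ≤ 2 gives log(x + η) ≤ 1. The case x = η = 0 uses `log
0 = 0`. -/
theorem two_le_logGauge {η x : ℝ} (hη : 0 ≤ η) (hη' : η ≤ 1) (hx : x ∈ Icc (0 : ℝ) 1) :
    2 ≤ logGauge η x := by
  have h1 : log (x + η) ≤ 1 := by
    rcases (add_nonneg hx.1 hη).eq_or_lt with h | h
    · simp [← h]
    · linarith [log_le_sub_one_of_pos h, hx.2]
  unfold logGauge; linarith

theorem hasDerivAt_logGauge {η x : ℝ} (h : 0 < x + η) :
    HasDerivAt (logGauge η) (-(x + η)⁻¹) x := by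
  have := (((hasDerivAt_id x).add_const η).log (by simpa using h.ne')).const_sub 3
  exact this.congr_deriv (by simp [div_eq_mul_inv])

theorem hasDerivAt_neg_log_logGauge {η x : ℝ} (h : 0 < x + η) (hs : logGauge η x ≠ 0) :
    HasDerivAt (fun x => -log (logGauge η x)) (logGauge η x * (x + η))⁻¹ x := by
  refine ((hasDerivAt_logGauge h).log hs).neg.congr_deriv ?_
  field_simp

theorem hasDerivAt_inv_logGauge_mul {η x : ℝ} (h : 0 < x + η) (hs : logGauge η x ≠ 0) :
    HasDerivAt (fun x => (logGauge η x * (x + η))⁻¹)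
      ((1 - logGauge η x) / (logGauge η x ^ 2 * (x + η) ^ 2)) x := by
  have := ((hasDerivAt_logGauge h).mul ((hasDerivAt_id x).add_const η)).inv
    (mul_ne_zero hs h.ne')
  refine this.congr_deriv ?_
  simp only [id, Pi.mul_apply]
  field_simp
  ring

theorem contDiffAt_neg_log_logGauge {η x : ℝ} {n : WithTop ℕ∞} (h : 0 < x + η)
    (hs : logGauge η x ≠ 0) : ContDiffAt ℝ n (fun x => -log (logGauge η x)) x := by
  refine (ContDiffAt.log ?_ hs).neg
  exact contDiffAt_const.sub (ContDiffAt.log (by fun_prop) h.ne')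

/-- For φ = -log s the singular terms of order 1/(s x) in φ' and xφ'' cancel, and 1/(s²x) survives.
The remaining terms are bounded, and -2 absorbs them. -/
theorem le_legendre_logGauge {η x : ℝ} (hη : 0 < η) (hη' : η ≤ 1) (hx : x ∈ Icc (0 : ℝ) 1) :
    (logGauge η x ^ 2 * (x + η))⁻¹ - 2 ≤ (1 - 2 * x) * (logGauge η x * (x + η))⁻¹ +
      x * (1 - x) * ((1 - logGauge η x) / (logGauge η x ^ 2 * (x + η) ^ 2)) := by
  have hs := two_le_logGauge hη.le hη' hx
  obtain ⟨hx0, hx1⟩ := hx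
  set s := logGauge η x
  have hy : 0 < x + η := by linarith
  have hs0 : 0 < s := by linarith
  have e1 : (s ^ 2 * (x + η))⁻¹ - 2 =
      ((x + η) - 2 * s ^ 2 * (x + η) ^ 2) / (s ^ 2 * (x + η) ^ 2) := by field_simp
  have e2 : (1 - 2 * x) * (s * (x + η))⁻¹ + x * (1 - x) * ((1 - s) / (s ^ 2 * (x + η) ^ 2)) =
      (x * (1 - x) + s * (η - x ^ 2 - 2 * x * η)) / (s ^ 2 * (x + η) ^ 2) := by
    field_simp; ring
  rw [e1, e2]
  gcongr
  -- Over the common denominator s²(x + η)² the loss -2 provides two copies of s²(x + η)²: one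
  -- absorbs x², the other s(x² + 2xη). The remaining η is at most sη.
  have a1 : x ^ 2 ≤ s ^ 2 * (x + η) ^ 2 := by
    rw [← mul_pow]; gcongr
    nlinarith
  have a2 : s * (x ^ 2 + 2 * x * η) ≤ s ^ 2 * (x + η) ^ 2 := by
    have : s * (x + η) ^ 2 ≤ s ^ 2 * (x + η) ^ 2 := by
      gcongr; nlinarith
    nlinarith [mul_nonneg hs0.le (sq_nonneg η)]
  nlinarith

/-! ### Linearity and monotonicity of iterated radial integrals -/

section Radial

variable {w v : ℂ → ℝ} {R r₀ r : ℝ}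

theorem continuousOn_flux (hw : ContinuousOn w (ball 0 R)) (hr : r < R) :
    ContinuousOn (fun t => ∫ s in (0 : ℝ)..t, s * circleAverage w 0 s) (Icc 0 r) := by
  rcases lt_or_ge r 0 with h | h
  · simp [Icc_eq_empty h.not_ge]
  have hcont : ContinuousOn (fun s => s * circleAverage w 0 s) (Icc 0 r) := by
    have := (continuousOn_circleAverage hw).mono
      (fun s (hs : s ∈ Icc 0 r) => (⟨by linarith [hs.1], by linarith [hs.2]⟩ : s ∈ Ioo (-R) R))
    fun_prop
  have := intervalIntegral.continuousOn_primitive_interval (μ := volume) (a := 0) (b := r)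
    (f := fun s => s * circleAverage w 0 s) (by rw [uIcc_of_le h]; exact hcont.integrableOn_Icc)
  rwa [uIcc_of_le h] at this

theorem intervalIntegrable_mul_circleAverage (hw : ContinuousOn w (ball 0 R)) (h : 0 ≤ r)
    (hr : r < R) : IntervalIntegrable (fun s => s * circleAverage w 0 s) volume 0 r := by
  refine ContinuousOn.intervalIntegrable ?_
  rw [uIcc_of_le h]
  have := (continuousOn_circleAverage hw).mono
    (fun s (hs : s ∈ Icc 0 r) => (⟨by linarith [hs.1], by linarith [hs.2]⟩ : s ∈ Ioo (-R) R))
  fun_prop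

theorem intervalIntegrable_flux_div (hw : ContinuousOn w (ball 0 R)) (hr₀ : 0 < r₀) (h : r₀ ≤ r)
    (hr : r < R) : IntervalIntegrable
      (fun t => (∫ s in (0 : ℝ)..t, s * circleAverage w 0 s) / t) volume r₀ r := by
  refine ContinuousOn.intervalIntegrable ?_
  rw [uIcc_of_le h]
  exact ((continuousOn_flux hw hr).mono (Icc_subset_Icc_left hr₀.le)).div continuousOn_id
    fun t ht => (hr₀.trans_le ht.1).ne'

theorem circleIntegrable_of_continuousOn_ball (hw : ContinuousOn w (ball 0 R)) (h : 0 ≤ r)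
    (hr : r < R) : CircleIntegrable w 0 r := by
  refine (hw.mono fun z hz => ?_).circleIntegrable h
  rw [mem_sphere] at hz
  rw [mem_ball, hz]; exact hr

theorem radialIntegral_mono (hw : ContinuousOn w (ball 0 R)) (hv : ContinuousOn v (ball 0 R))
    (hwv : ∀ z ∈ ball (0 : ℂ) R, w z ≤ v z) (hr₀ : 0 < r₀) (h : r₀ ≤ r) (hr : r < R) :
    radialIntegral r₀ w r ≤ radialIntegral r₀ v r := by
  refine intervalIntegral.integral_mono_on h (intervalIntegrable_flux_div hw hr₀ h hr)
    (intervalIntegrable_flux_div hv hr₀ h hr) fun t ht => ?_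
  have ht0 : 0 < t := hr₀.trans_le ht.1
  have htR : t < R := ht.2.trans_lt hr
  gcongr
  refine intervalIntegral.integral_mono_on ht0.le (intervalIntegrable_mul_circleAverage hw ht0.le htR)
    (intervalIntegrable_mul_circleAverage hv ht0.le htR) fun s hs => ?_
  have hsR : s < R := hs.2.trans_lt htR
  refine mul_le_mul_of_nonneg_left ?_ hs.1
  refine circleAverage_mono (circleIntegrable_of_continuousOn_ball hw hs.1 hsR)
    (circleIntegrable_of_continuousOn_ball hv hs.1 hsR) fun z hz => hwv z ?_
  rw [mem_sphere, abs_of_nonneg hs.1] at hz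
  rw [mem_ball, hz]; exact hsR

theorem radialIntegral_const_mul (a : ℝ) :
    radialIntegral r₀ (fun z => a * w z) r = a * radialIntegral r₀ w r := by
  unfold radialIntegral
  have : ∀ s, circleAverage (fun z => a * w z) 0 s = a * circleAverage w 0 s := fun s => by
    simpa using circleAverage_fun_smul (𝕜 := ℝ) (a := a) (f := w) (c := 0) (R := s)
  simp_rw [this, mul_left_comm _ a, intervalIntegral.integral_const_mul, mul_div_assoc,
    intervalIntegral.integral_const_mul]

theorem radialIntegral_sub (hw : ContinuousOn w (ball 0 R)) (hv : ContinuousOn v (ball 0 R))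
    (hr₀ : 0 < r₀) (h : r₀ ≤ r) (hr : r < R) :
    radialIntegral r₀ (fun z => w z - v z) r = radialIntegral r₀ w r - radialIntegral r₀ v r := by
  unfold radialIntegral
  rw [← intervalIntegral.integral_sub (intervalIntegrable_flux_div hw hr₀ h hr)
    (intervalIntegrable_flux_div hv hr₀ h hr)]
  refine intervalIntegral.integral_congr fun t ht => ?_
  rw [uIcc_of_le h] at ht
  have ht0 : 0 < t := hr₀.trans_le ht.1
  have htR : t < R := ht.2.trans_lt hr
  rw [← sub_div, ← intervalIntegral.integral_sub (intervalIntegrable_mul_circleAverage hw ht0.le htR)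
    (intervalIntegrable_mul_circleAverage hv ht0.le htR)]
  congr 1
  refine intervalIntegral.integral_congr fun s hs => ?_
  rw [uIcc_of_le ht0.le] at hs
  have hsR : s < R := hs.2.trans_lt htR
  rw [circleAverage_fun_sub (circleIntegrable_of_continuousOn_ball hw hs.1 hsR)
    (circleIntegrable_of_continuousOn_ball hv hs.1 hsR), mul_sub]

end Radial

/-! ### Integral formulas for a reduced pair -/

/-- `G` and `H` are holomorphic without common zeros on the disc of radius `R`. -/
structure IsReducedPair (G H : ℂ → ℂ) (R : ℝ) : Prop where
  analytic_left : AnalyticOnNhd ℂ G (ball 0 R)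
  analytic_right : AnalyticOnNhd ℂ H (ball 0 R)
  ne_zero : ∀ z ∈ ball (0 : ℂ) R, G z ≠ 0 ∨ H z ≠ 0

namespace IsReducedPair

variable {G H : ℂ → ℂ} {R r₀ r : ℝ} (h : IsReducedPair G H R)
include h

theorem analyticOnNhd_pairWronskian : AnalyticOnNhd ℂ (pairWronskian G H) (ball 0 R) :=
  (h.analytic_left.deriv.mul h.analytic_right).sub (h.analytic_left.mul h.analytic_right.deriv)

theorem pairNormSq_pos {z : ℂ} (hz : z ∈ ball (0 : ℂ) R) : 0 < pairNormSq G H z :=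
  DiscNevanlinna.pairNormSq_pos (h.ne_zero z hz)

theorem continuousOn_pairNormSq : ContinuousOn (pairNormSq G H) (ball 0 R) :=
  (h.analytic_left.continuousOn.norm.pow 2).add (h.analytic_right.continuousOn.norm.pow 2)

theorem continuousOn_pairDensity : ContinuousOn (pairDensity G H) (ball 0 R) :=
  (h.analyticOnNhd_pairWronskian.continuousOn.norm.pow 2).div (h.continuousOn_pairNormSq.pow 2)
    fun _ hz => pow_ne_zero 2 (h.pairNormSq_pos hz).ne'

theorem continuousOn_pairChordal : ContinuousOn (pairChordal G H) (ball 0 R) :=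
  (h.analytic_left.continuousOn.norm.pow 2).div h.continuousOn_pairNormSq
    fun _ hz => (h.pairNormSq_pos hz).ne'

theorem circleAverage_log_pairNormSq_sub (hr₀ : 0 < r₀) (hr : r₀ ≤ r) (hrR : r < R) :
    circleAverage (fun z => log (pairNormSq G H z)) 0 r -
      circleAverage (fun z => log (pairNormSq G H z)) 0 r₀ =
      4 * radialIntegral r₀ (pairDensity G H) r := by
  rw [← radialIntegral_const_mul]
  exact circleAverage_sub_circleAverage_eq_radialIntegral
    (fun z hz => (contDiffAt_log_pairNormSq (h.analytic_left z hz) (h.analytic_right z hz)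
      (h.ne_zero z hz)).contDiffWithinAt)
    (fun z hz => fderiv_fderiv_log_pairNormSq (h.analytic_left z hz) (h.analytic_right z hz)
      (h.ne_zero z hz)) hr₀ hr hrR

theorem continuousOn_logGauge {η : ℝ} (hη : 0 < η) :
    ContinuousOn (fun z => logGauge η (pairChordal G H z)) (ball 0 R) :=
  continuousOn_const.sub ((h.continuousOn_pairChordal.add continuousOn_const).log
    fun _ _ => (add_pos_of_nonneg_of_pos pairChordal_nonneg hη).ne')

theorem continuousOn_gauge_density {η : ℝ} (hη : 0 < η) (hη' : η ≤ 1) :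
    ContinuousOn (fun z => pairDensity G H z *
      (logGauge η (pairChordal G H z) ^ 2 * (pairChordal G H z + η))⁻¹) (ball 0 R) := by
  refine h.continuousOn_pairDensity.mul (ContinuousOn.inv₀
    (((h.continuousOn_logGauge hη).pow 2).mul (h.continuousOn_pairChordal.add continuousOn_const))
    fun z _ => ?_)
  have h1 := two_le_logGauge hη.le hη' ⟨pairChordal_nonneg (G := G) (H := H) (z := z), pairChordal_le_one⟩
  have h2 := pairChordal_nonneg (G := G) (H := H) (z := z)
  positivity

/-- Green's formula for -log s(x), with the Legendre bound below its Laplacian. The boundary term at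
r has a favourable sign because s ≥ 2, so only the one at r₀ remains. Taking η > 0 keeps the
function C² at the zeros of G. -/
theorem radialIntegral_gauge_density_le {η : ℝ} (hη : 0 < η) (hη' : η ≤ 1) (hr₀ : 0 < r₀)
    (hr : r₀ ≤ r) (hrR : r < R) :
    4 * radialIntegral r₀ (fun z => pairDensity G H z *
      (logGauge η (pairChordal G H z) ^ 2 * (pairChordal G H z + η))⁻¹) r ≤
    8 * radialIntegral r₀ (pairDensity G H) r +
      circleAverage (fun z => log (logGauge η (pairChordal G H z))) 0 r₀ := by
  set x := pairChordal G H
  have hx : ∀ z, x z ∈ Icc (0 : ℝ) 1 := fun z => ⟨pairChordal_nonneg, pairChordal_le_one⟩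
  have hpos : ∀ y ∈ Icc (0 : ℝ) 1, 0 < y + η := fun y hy => by linarith [hy.1]
  have hs : ∀ y ∈ Icc (0 : ℝ) 1, logGauge η y ≠ 0 := fun y hy => by
    linarith [two_le_logGauge hη.le hη' hy]
  have hgreen := circleAverage_sub_circleAverage_eq_radialIntegral (R := R)
    (u := fun z => -log (logGauge η (x z)))
    (fun z hz => (ContDiffAt.comp z (contDiffAt_neg_log_logGauge (hpos _ (hx z)) (hs _ (hx z)))
      (contDiffAt_pairChordal (h.analytic_left z hz) (h.analytic_right z hz)
        (h.ne_zero z hz))).contDiffWithinAt)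
    (fun z hz => fderiv_fderiv_comp_pairChordal (h.analytic_left z hz) (h.analytic_right z hz)
      (h.ne_zero z hz) (contDiffAt_neg_log_logGauge (hpos _ (hx z)) (hs _ (hx z)))
      (fun y hy => hasDerivAt_neg_log_logGauge (hpos y hy) (hs y hy))
      (hasDerivAt_inv_logGauge_mul (hpos _ (hx z)) (hs _ (hx z)))) hr₀ hr hrR
  have hneg : ∀ t, circleAverage (fun z => -log (logGauge η (x z))) 0 t =
      -circleAverage (fun z => log (logGauge η (x z))) 0 t := fun t => by
    simpa using circleAverage_fun_smul (𝕜 := ℝ) (a := (-1 : ℝ))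
      (f := fun z => log (logGauge η (x z))) (c := 0) (R := t)
  rw [hneg, hneg] at hgreen
  have h0 : 0 ≤ circleAverage (fun z => log (logGauge η (x z))) 0 r :=
    circleAverage_nonneg_of_nonneg fun z _ =>
      log_nonneg (by linarith [two_le_logGauge hη.le hη' (hx z)])
  rw [← radialIntegral_const_mul, ← radialIntegral_const_mul]
  have hw := h.continuousOn_gauge_density hη hη'
  have hD := h.continuousOn_pairDensity
  have c1 : ContinuousOn (fun z => 4 * (pairDensity G H z *
      (logGauge η (pairChordal G H z) ^ 2 * (pairChordal G H z + η))⁻¹)) (ball 0 R) :=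
    continuousOn_const.mul hw
  have c2 : ContinuousOn (fun z => 8 * pairDensity G H z) (ball 0 R) := continuousOn_const.mul hD
  have hsub := radialIntegral_sub (r₀ := r₀) (r := r) c1 c2 hr₀ hr hrR
  have cs := h.continuousOn_logGauge hη
  have cx := h.continuousOn_pairChordal
  have c3 : ContinuousOn (fun z => 4 * (pairDensity G H z *
      (logGauge η (pairChordal G H z) ^ 2 * (pairChordal G H z + η))⁻¹) -
        8 * pairDensity G H z) (ball 0 R) := c1.sub c2
  have hmono := radialIntegral_mono c3 (v := fun z => 4 * pairDensity G H z *
    ((1 - 2 * x z) * (logGauge η (x z) * (x z + η))⁻¹ +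
      x z * (1 - x z) * ((1 - logGauge η (x z)) / (logGauge η (x z) ^ 2 * (x z + η) ^ 2))))
    (by
      refine (continuousOn_const.mul hD).mul (ContinuousOn.add ?_ ?_)
      · refine (continuousOn_const.sub (continuousOn_const.mul cx)).mul
          ((cs.mul (cx.add continuousOn_const)).inv₀ fun z _ => ?_)
        exact mul_ne_zero (hs _ (hx z)) (hpos _ (hx z)).ne'
      · refine (cx.mul (continuousOn_const.sub cx)).mul ((continuousOn_const.sub cs).div
          ((cs.pow 2).mul ((cx.add continuousOn_const).pow 2)) fun z _ => ?_)
        exact mul_ne_zero (pow_ne_zero 2 (hs _ (hx z))) (pow_ne_zero 2 (hpos _ (hx z)).ne'))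
    (fun z _ => by
      have h1 := le_legendre_logGauge hη hη' (hx z)
      have h2 : 0 ≤ 4 * pairDensity G H z := by unfold pairDensity; positivity
      have h3 := mul_le_mul_of_nonneg_left h1 h2
      simp only [x] at h3 ⊢
      linarith) hr₀ hr hrR
  linarith

end IsReducedPair

/-! ### Counting kernels and Jensen's formula -/

/-- The contribution `∫_{r₀}^r 1_{|u| < t} dt / t` of a point `u` to a counting function. -/
noncomputable def countKernel (r₀ r : ℝ) (u : ℂ) : ℝ :=
  ∫ t in r₀..r, (Ioi ‖u‖).indicator (fun t => t⁻¹) t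

variable {r₀ r : ℝ}

theorem intervalIntegrable_indicator_inv (hr₀ : 0 < r₀) (h : r₀ ≤ r) (ρ : ℝ) :
    IntervalIntegrable ((Ioi ρ).indicator fun t : ℝ => t⁻¹) volume r₀ r := by
  have : IntervalIntegrable (fun t : ℝ => t⁻¹) volume r₀ r := by
    refine intervalIntegral.intervalIntegrable_inv (fun t ht => ?_) continuousOn_id
    rw [uIcc_of_le h] at ht
    exact (hr₀.trans_le ht.1).ne'
  rw [intervalIntegrable_iff] at this ⊢
  exact this.indicator measurableSet_Ioi

theorem countKernel_nonneg (h : r₀ ≤ r) (u : ℂ) : 0 ≤ countKernel r₀ r u := by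
  refine intervalIntegral.integral_nonneg h fun t ht => ?_
  exact indicator_nonneg (fun s hs => inv_nonneg.2 ((norm_nonneg u).trans (le_of_lt hs))) t

/-- The integrand is 1/t beyond the modulus of u clamped to [r₀, r], and 0 before it. -/
theorem countKernel_eq (hr₀ : 0 < r₀) (h : r₀ ≤ r) (u : ℂ) :
    countKernel r₀ r u = log r - log (max r₀ (min ‖u‖ r)) := by
  set m := max r₀ (min ‖u‖ r)
  have hm0 : r₀ ≤ m := le_max_left _ _
  have hm1 : m ≤ r := max_le h (min_le_right _ _)
  have i1 := intervalIntegrable_indicator_inv hr₀ hm0 ‖u‖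
  have i2 := intervalIntegrable_indicator_inv (hr₀.trans_le hm0) hm1 ‖u‖
  rw [countKernel, ← intervalIntegral.integral_add_adjacent_intervals i1 i2]
  have e1 : ∫ t in r₀..m, (Ioi ‖u‖).indicator (fun t => t⁻¹) t = ∫ t in r₀..m, (0 : ℝ) := by
    refine intervalIntegral.integral_congr_ae (Eventually.of_forall fun t ht => ?_)
    rw [uIoc_of_le hm0] at ht
    refine indicator_of_notMem (fun hu => ?_) _
    rcases le_max_iff.1 ht.2 with h1 | h1
    · exact ht.1.not_ge h1
    · exact (mem_Ioi.1 hu).not_ge (h1.trans (min_le_left _ _))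
  have e2 : ∫ t in m..r, (Ioi ‖u‖).indicator (fun t => t⁻¹) t = ∫ t in m..r, t⁻¹ := by
    refine intervalIntegral.integral_congr_ae (Eventually.of_forall fun t ht => ?_)
    rw [uIoc_of_le hm1] at ht
    refine indicator_of_mem ?_ _
    have h1 := (le_max_right r₀ (min ‖u‖ r)).trans_lt ht.1
    rcases min_lt_iff.1 h1 with h2 | h2
    · exact h2
    · exact absurd h2 ht.2.not_gt
  have hm : 0 < m := hr₀.trans_le hm0
  rw [e1, e2, integral_inv_of_pos hm (hm.trans_le hm1), log_div (hm.trans_le hm1).ne' hm.ne']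
  simp

/-- Jensen's formula indexed by a set S that need not depend on ρ: with max(ρ, |u|) in place of ρ,
points outside the disc contribute 0. Two radii can then be compared term by term, and the trailing
coefficient cancels. -/
theorem circleAverage_log_norm_eq_sum {g : ℂ → ℂ} {ρ : ℝ} (hρ : 0 < ρ)
    (hg : AnalyticOnNhd ℂ g (closedBall 0 ρ))
    {S : Finset ℂ}
    (hS : ∀ u ∈ closedBall (0 : ℂ) ρ, g u = 0 → u ∈ S) :
    circleAverage (fun z => log ‖g z‖) 0 ρ =
      ∑ u ∈ S, (analyticOrderNatAt g u : ℝ) * (if u = 0 then log ρ else log (max ρ ‖u‖) - log ‖u‖) +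
        log ‖meromorphicTrailingCoeffAt g 0‖ := by
  classical
  have hD : ∀ u ∈ closedBall (0 : ℂ) ρ,
      MeromorphicOn.divisor g (closedBall 0 ρ) u = (analyticOrderNatAt g u : ℤ) := fun u hu => by
    rw [MeromorphicOn.AnalyticOnNhd.divisor_apply hg hu, analyticOrderNatAt]
    cases analyticOrderAt g u <;> simp
  have hD' : ∀ u ∉ closedBall (0 : ℂ) ρ, MeromorphicOn.divisor g (closedBall 0 ρ) u = 0 :=
    fun u hu => Function.locallyFinsuppWithin.apply_eq_zero_of_notMem _ hu
  have hn : ∀ u ∈ closedBall (0 : ℂ) ρ, u ∉ S → analyticOrderNatAt g u = 0 := fun u hu huS =>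
    by_contra fun h => huS (hS u hu (apply_eq_zero_of_analyticOrderNatAt_ne_zero h))
  have h0 : (0 : ℂ) ∈ closedBall (0 : ℂ) ρ := by simp [hρ.le]
  have hJ := MeromorphicOn.circleAverage_log_norm (c := 0) (R := ρ) hρ.ne'
    (by rw [abs_of_pos hρ]; exact hg.meromorphicOn)
  rw [abs_of_pos hρ] at hJ
  rw [hJ, hD 0 h0]
  congr 1
  rw [finsum_eq_sum_of_support_subset (s := S)]
  · have hz : (((analyticOrderNatAt g 0 : ℕ) : ℤ) : ℝ) * log ρ =
        ∑ u ∈ S, if u = 0 then (analyticOrderNatAt g 0 : ℝ) * log ρ else 0 := by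
      rw [Finset.sum_ite_eq' S (0 : ℂ)]
      split_ifs with h
      · simp
      · simp [hn 0 h0 h]
    rw [hz, ← Finset.sum_add_distrib]
    refine Finset.sum_congr rfl fun u _ => ?_
    by_cases hu : u = 0
    · simp [hu]
    · simp only [hu, if_false, add_zero, zero_sub, norm_neg]
      have hu' : 0 < ‖u‖ := norm_pos_iff.2 hu
      by_cases hb : u ∈ closedBall (0 : ℂ) ρ
      · rw [hD u hb, max_eq_left (by simpa using hb), log_mul hρ.ne' (by positivity), log_inv]
        simp [sub_eq_add_neg]
      · have : ρ ≤ ‖u‖ := by simpa using (not_le.1 (by simpa using hb : ¬ ‖u‖ ≤ ρ)).le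
        rw [hD' u hb, max_eq_right this]
        simp
  · intro u hu
    by_contra huS
    refine hu ?_
    by_cases hb : u ∈ closedBall (0 : ℂ) ρ
    · simp [hD u hb, hn u hb huS]
    · simp [hD' u hb]

/-- Jensen's formula between two radii. -/
theorem circleAverage_log_norm_sub {g : ℂ → ℂ} (hr₀ : 0 < r₀) (h : r₀ ≤ r)
    (hg : AnalyticOnNhd ℂ g (closedBall 0 r))
    {S : Finset ℂ}
    (hS : ∀ u ∈ closedBall (0 : ℂ) r, g u = 0 → u ∈ S) :
    circleAverage (fun z => log ‖g z‖) 0 r - circleAverage (fun z => log ‖g z‖) 0 r₀ =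
      ∑ u ∈ S, (analyticOrderNatAt g u : ℝ) * countKernel r₀ r u := by
  have hsub : closedBall (0 : ℂ) r₀ ⊆ closedBall 0 r := closedBall_subset_closedBall h
  rw [circleAverage_log_norm_eq_sum (hr₀.trans_le h) hg hS,
    circleAverage_log_norm_eq_sum hr₀ (hg.mono hsub) (fun u hu => hS u (hsub hu)), add_sub_add_right_eq_sub, ← Finset.sum_sub_distrib]
  refine Finset.sum_congr rfl fun u _ => ?_
  rw [← mul_sub, countKernel_eq hr₀ h]
  congr 1
  split_ifs with hu
  · simp [hu, min_eq_left (hr₀.le.trans h), max_eq_left hr₀.le]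
  · rcases le_total ‖u‖ r with h1 | h1
    · rw [max_eq_left h1, min_eq_left h1]; ring
    · rw [max_eq_right h1, min_eq_right h1, max_eq_right h, max_eq_right (h.trans h1)]; ring

/-- Simple counting functions of finite sets. -/
theorem integral_ncard_div_eq_sum (hr₀ : 0 < r₀) (h : r₀ ≤ r) {p : ℂ → Prop} {Z : Finset ℂ}
    (hZ : ∀ z ∈ ball (0 : ℂ) r, p z ↔ z ∈ Z) :
    ∫ t in r₀..r, (({z : ℂ | z ∈ ball (0 : ℂ) t ∧ p z}.ncard : ℕ) : ℝ) / t =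
      ∑ u ∈ Z, countKernel r₀ r u := by
  unfold countKernel
  rw [← intervalIntegral.integral_finsetSum
    fun u _ => intervalIntegrable_indicator_inv hr₀ h ‖u‖]
  refine intervalIntegral.integral_congr fun t ht => ?_
  rw [uIcc_of_le h] at ht
  have hset : {z : ℂ | z ∈ ball (0 : ℂ) t ∧ p z} = ↑(Z.filter fun u => ‖u‖ < t) := by
    ext z
    simp only [mem_ofPred_eq, Finset.coe_filter, mem_ball_zero_iff]
    constructor
    · exact fun hz => ⟨(hZ z (by simpa using hz.1.trans_le ht.2)).1 hz.2, hz.1⟩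
    · exact fun hz => ⟨hz.2, (hZ z (by simpa using hz.2.trans_le ht.2)).2 hz.1⟩
  simp only [hset, Set.ncard_coe_finset]
  rw [Finset.card_filter]
  push_cast
  rw [Finset.sum_div]
  refine Finset.sum_congr rfl fun u _ => ?_
  by_cases hu : ‖u‖ < t <;> simp [hu, indicator]

/-! ### Local representation of a meromorphic function by a reduced pair -/

theorem mem_codiscreteWithin_ball_iff {R : ℝ} {p : ℂ → Prop} :
    (∀ᶠ z in codiscreteWithin (ball (0 : ℂ) R), p z) ↔
      ∀ z ∈ ball (0 : ℂ) R, ∀ᶠ w in 𝓝[≠] z, p w := by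
  rw [Filter.Eventually, mem_codiscreteWithin_iff_forall_mem_nhdsNE]
  refine forall₂_congr fun z hz => ?_
  constructor
  · intro h
    filter_upwards [h, nhdsWithin_le_nhds (isOpen_ball.mem_nhds hz)] with w h1 h2
    exact h1.resolve_right fun h3 => h3 h2
  · intro h
    filter_upwards [h] with w hw using Or.inl hw

/-- Identity theorem: infinite order at one point would spread over the connected disc and make f
constant. -/
theorem meromorphicOrderAt_sub_const_ne_top {f : ℂ → ℂ} (hf : MeromorphicOn f (ball (0 : ℂ) 1))
    (hfc : Nonconstant f) (c : ℂ) {z : ℂ} (hz : z ∈ ball (0 : ℂ) 1) :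
    meromorphicOrderAt (fun w => f w - c) z ≠ ⊤ := by
  intro h
  have hm : MeromorphicOn (fun w => f w - c) (ball (0 : ℂ) 1) := fun w hw =>
    (hf w hw).sub (MeromorphicAt.const c w)
  refine hfc c (mem_codiscreteWithin_ball_iff.2 fun w hw => ?_)
  by_contra hw'
  refine hm.meromorphicOrderAt_ne_top_of_isPreconnected (convex_ball 0 1).isPreconnected hw hz
    (fun htop => hw' ?_) h
  filter_upwards [meromorphicOrderAt_eq_top_iff.1 htop] with y hy using sub_eq_zero.1 hy

/-- `f = G / H` on the disc of radius `R`, with `G` and `H` holomorphic without common zeros and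
linearly independent. -/
structure IsReducedQuotient (f G H : ℂ → ℂ) (R : ℝ) : Prop extends IsReducedPair G H R where
  eq : f =ᶠ[codiscreteWithin (ball 0 R)] fun z => G z / H z
  wronskian_order : ∀ z ∈ ball (0 : ℂ) R, analyticOrderAt (pairWronskian G H) z ≠ ⊤

theorem analyticOrderAt_pairWronskian_eq_top_of_right {G H : ℂ → ℂ} {z : ℂ}
    (h : analyticOrderAt H z = ⊤) : analyticOrderAt (pairWronskian G H) z = ⊤ := by
  rw [analyticOrderAt_eq_top] at h ⊢
  filter_upwards [h, h.eventually_nhds] with w h1 h2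
  have : deriv H w = 0 := by
    rw [EventuallyEq.deriv_eq (f₁ := H) (f := fun _ => (0 : ℂ)) h2]; simp
  simp [pairWronskian, h1, this]

theorem analyticOrderAt_pairWronskian_eq_top_of_left {G H : ℂ → ℂ} {z : ℂ}
    (h : analyticOrderAt G z = ⊤) : analyticOrderAt (pairWronskian G H) z = ⊤ := by
  rw [analyticOrderAt_eq_top] at h ⊢
  filter_upwards [h, h.eventually_nhds] with w h1 h2
  have : deriv G w = 0 := by
    rw [EventuallyEq.deriv_eq (f₁ := G) (f := fun _ => (0 : ℂ)) h2]; simp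
  simp [pairWronskian, h1, this]

theorem zpow_eq_pow_div_pow (x : ℂ) (n : ℤ) : x ^ n = x ^ n.toNat / x ^ (-n).toNat := by
  rcases le_total 0 n with h | h
  · lift n to ℕ using h
    have : (-(n : ℤ)).toNat = 0 := by omega
    simp [this]
  · obtain ⟨k, rfl⟩ : ∃ k : ℕ, n = -(k : ℤ) := ⟨(-n).toNat, by omega⟩
    have : (-(k : ℤ)).toNat = 0 := by omega
    simp [this]

/-- For R < 1 the divisor of f has finite support, so f is a finite product of powers (z - u)^{d(u)}
times a zero-free holomorphic g. Positive exponents go into G and negative ones into H; no u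
receives both, hence no common zero. -/
theorem exists_isReducedPair {f : ℂ → ℂ} {R : ℝ} (hR : R < 1)
    (hf : MeromorphicOn f (ball (0 : ℂ) 1)) (hfc : Nonconstant f) :
    ∃ G H : ℂ → ℂ, IsReducedPair G H R ∧
      (f =ᶠ[codiscreteWithin (ball 0 R)] fun z => G z / H z) ∧
      ∀ z ∈ ball (0 : ℂ) R, ∀ᶠ w in 𝓝[≠] z, H w ≠ 0 := by
  classical
  have hsub : ball (0 : ℂ) R ⊆ ball 0 1 := ball_subset_ball hR.le
  have hsub' : closedBall (0 : ℂ) R ⊆ ball 0 1 := closedBall_subset_ball hR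
  have hfR : MeromorphicOn f (ball (0 : ℂ) R) := hf.mono_set hsub
  have hfin : (MeromorphicOn.divisor f (ball (0 : ℂ) R)).support.Finite :=
    MeromorphicOn.divisor_ball_support_finite (hf.mono_set hsub')
  obtain ⟨g, hg, hg0, hfg⟩ := hfR.extract_zeros_poles (fun u => by
    simpa using meromorphicOrderAt_sub_const_ne_top hf hfc 0 (hsub u.2)) hfin
  set d := MeromorphicOn.divisor f (ball (0 : ℂ) R)
  set S := hfin.toFinset
  have hprod : ∀ z, (∏ᶠ u, (· - u) ^ d u : ℂ → ℂ) z = ∏ u ∈ S, (z - u) ^ d u := by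
    intro z
    rw [Function.FactorizedRational.finprod_eq_fun hfin]
    refine finprod_eq_prod_of_mulSupport_subset _ fun u hu => ?_
    simp only [S, Finite.coe_toFinset, Function.mem_support]
    exact fun h => hu (by simp [h])
  refine ⟨fun z => (∏ u ∈ S, (z - u) ^ (d u).toNat) * g z,
    fun z => ∏ u ∈ S, (z - u) ^ (-d u).toNat, ⟨?_, ?_, ?_⟩, ?_, ?_⟩
  · intro z hz
    refine AnalyticAt.mul ?_ (hg z hz)
    exact Finset.analyticAt_fun_prod _ fun u _ => by fun_prop
  · intro z _
    exact Finset.analyticAt_fun_prod _ fun u _ => by fun_prop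
  · intro z hz
    by_contra! hcon
    obtain ⟨h1, h2⟩ := hcon
    have h1 := (mul_eq_zero.1 h1).resolve_right (hg0 ⟨z, hz⟩)
    obtain ⟨u, -, hu⟩ := Finset.prod_eq_zero_iff.1 h1
    obtain ⟨v, -, hv⟩ := Finset.prod_eq_zero_iff.1 h2
    rw [pow_eq_zero_iff', sub_eq_zero] at hu hv
    obtain ⟨rfl, hu⟩ := hu
    obtain ⟨rfl, hv⟩ := hv
    omega
  · filter_upwards [hfg] with z hz
    rw [hz, Pi.smul_apply', hprod, smul_eq_mul, mul_div_right_comm, ← Finset.prod_div_distrib]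
    congr 1
    exact Finset.prod_congr rfl fun u _ => zpow_eq_pow_div_pow _ _
  · intro z _
    have : ∀ᶠ w in 𝓝[≠] z, ∀ u ∈ S, w ≠ u := by
      rw [Filter.eventually_all_finset]
      intro u _
      by_cases h : u = z
      · rw [h]; exact self_mem_nhdsWithin
      · exact nhdsWithin_le_nhds (isOpen_ne.mem_nhds (Ne.symm h))
    filter_upwards [this] with w hw
    exact Finset.prod_ne_zero_iff.2 fun u hu => pow_ne_zero _ (sub_ne_zero.2 (hw u hu))

/-- If W vanished near a point, then (G/H)' = W/H² = 0 on a small ball where H has no zeros, so f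
would be constant there. -/
theorem exists_isReducedQuotient {f : ℂ → ℂ} {R : ℝ} (hR : R < 1)
    (hf : MeromorphicOn f (ball (0 : ℂ) 1)) (hfc : Nonconstant f) :
    ∃ G H : ℂ → ℂ, IsReducedQuotient f G H R := by
  obtain ⟨G, H, hGH, heq, hH⟩ := exists_isReducedPair hR hf hfc
  refine ⟨G, H, hGH, heq, fun z hz htop => ?_⟩
  rw [analyticOrderAt_eq_top] at htop
  have hball : ∀ᶠ w in 𝓝[≠] z, w ∈ ball (0 : ℂ) R := nhdsWithin_le_nhds (isOpen_ball.mem_nhds hz)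
  have htop' : ∀ᶠ w in 𝓝[≠] z, ∀ᶠ y in 𝓝 w, pairWronskian G H y = 0 :=
    nhdsWithin_le_nhds htop.eventually_nhds
  obtain ⟨z₁, h1, h2, h3⟩ := ((hH z hz).and (htop'.and hball)).exists
  have hHz : ∀ᶠ w in 𝓝 z₁, H w ≠ 0 :=
    (hGH.analytic_right z₁ h3).continuousAt.eventually_ne h1
  obtain ⟨ε, hε, hε'⟩ := Metric.eventually_nhds_iff_ball.1
    (hHz.and (h2.and (isOpen_ball.mem_nhds h3)))
  have hd : ∀ w ∈ ball z₁ ε, HasDerivAt (fun z => G z / H z) 0 w := fun w hw => by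
    obtain ⟨a, b, c⟩ := hε' w hw
    refine ((hGH.analytic_left w c).differentiableAt.hasDerivAt.div
      (hGH.analytic_right w c).differentiableAt.hasDerivAt a).congr_deriv ?_
    rw [show deriv G w * H w - G w * deriv H w = 0 from b, zero_div]
  have hconst : ∀ w ∈ ball z₁ ε, G w / H w = G z₁ / H z₁ := fun w hw => by
    refine (convex_ball z₁ ε).is_const_of_fderivWithin_eq_zero (𝕜 := ℂ)
      (f := fun z => G z / H z)
      (fun w hw => (hd w hw).differentiableAt.differentiableWithinAt) (fun w hw => ?_) hw
      (mem_ball_self hε)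
    rw [fderivWithin_of_isOpen isOpen_ball hw]
    have := (hd w hw).hasFDerivAt.fderiv
    rw [this]
    ext; simp
  refine meromorphicOrderAt_sub_const_ne_top hf hfc (G z₁ / H z₁)
    (ball_subset_ball hR.le h3) (meromorphicOrderAt_eq_top_iff.2 ?_)
  filter_upwards [mem_codiscreteWithin_ball_iff.1 heq z₁ h3,
    nhdsWithin_le_nhds (ball_mem_nhds z₁ hε)] with w a b
  rw [a, hconst w b, sub_self]

/-! ### Linear forms attached to points of the sphere -/

/-- First coefficient of the unit linear form on `ℂ²` vanishing on the line `a`. -/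
noncomputable def formFst : OnePoint ℂ → ℂ
  | none => 0
  | some a => ((√(1 + ‖a‖ ^ 2))⁻¹ : ℝ)

/-- Second coefficient of the unit linear form on `ℂ²` vanishing on the line `a`. -/
noncomputable def formSnd : OnePoint ℂ → ℂ
  | none => 1
  | some a => -a * ((√(1 + ‖a‖ ^ 2))⁻¹ : ℝ)

theorem formFst_normSq_add (a : OnePoint ℂ) : ‖formFst a‖ ^ 2 + ‖formSnd a‖ ^ 2 = 1 := by
  cases a with
  | infty => simp [formFst, formSnd]
  | coe a =>
    have h : (0 : ℝ) < 1 + ‖a‖ ^ 2 := by positivity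
    have h2 : √(1 + ‖a‖ ^ 2) ^ 2 = 1 + ‖a‖ ^ 2 := sq_sqrt h.le
    change ‖(((√(1 + ‖a‖ ^ 2))⁻¹ : ℝ) : ℂ)‖ ^ 2 + ‖-a * (((√(1 + ‖a‖ ^ 2))⁻¹ : ℝ) : ℂ)‖ ^ 2 = 1
    rw [norm_mul, norm_neg, Complex.norm_real, norm_inv, mul_pow, inv_pow, Real.norm_eq_abs, sq_abs,
      h2]
    field_simp

theorem form_det_ne_zero {a b : OnePoint ℂ} (hab : a ≠ b) :
    formFst a * formSnd b - formSnd a * formFst b ≠ 0 := by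
  have hne : ∀ a : ℂ, (((√(1 + ‖a‖ ^ 2))⁻¹ : ℝ) : ℂ) ≠ 0 := fun a => by
    have h : (0 : ℝ) < 1 + ‖a‖ ^ 2 := by positivity
    exact_mod_cast (inv_pos.2 (sqrt_pos.2 h)).ne'
  cases a with
  | infty =>
    cases b with
    | infty => exact absurd rfl hab
    | coe b =>
      change 0 * (-b * (((√(1 + ‖b‖ ^ 2))⁻¹ : ℝ) : ℂ)) - 1 * (((√(1 + ‖b‖ ^ 2))⁻¹ : ℝ) : ℂ) ≠ 0
      simpa using hne b
  | coe a =>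
    cases b with
    | infty =>
      change (((√(1 + ‖a‖ ^ 2))⁻¹ : ℝ) : ℂ) * 1 - -a * (((√(1 + ‖a‖ ^ 2))⁻¹ : ℝ) : ℂ) * 0 ≠ 0
      simpa using hne a
    | coe b =>
      have hab' : a - b ≠ 0 := sub_ne_zero.2 fun h => hab (by rw [h])
      change (((√(1 + ‖a‖ ^ 2))⁻¹ : ℝ) : ℂ) * (-b * (((√(1 + ‖b‖ ^ 2))⁻¹ : ℝ) : ℂ)) -
        -a * (((√(1 + ‖a‖ ^ 2))⁻¹ : ℝ) : ℂ) * (((√(1 + ‖b‖ ^ 2))⁻¹ : ℝ) : ℂ) ≠ 0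
      have := mul_ne_zero (mul_ne_zero (hne a) (hne b)) hab'
      convert this using 1
      ring

/-- The linear form attached to `a`, evaluated at `(G, H)`. -/
noncomputable def form (a : OnePoint ℂ) (G H : ℂ → ℂ) (z : ℂ) : ℂ :=
  formFst a * G z + formSnd a * H z

/-- The linear form orthogonal to `form a`. -/
noncomputable def coform (a : OnePoint ℂ) (G H : ℂ → ℂ) (z : ℂ) : ℂ :=
  -starRingEnd ℂ (formSnd a) * G z + starRingEnd ℂ (formFst a) * H z

/-- The pair of forms is the image of (G, H) under a matrix of SU(2), so the norm, the Wronskian and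
the density are unchanged. Every target point is thereby reduced to the zeros of the first
component. -/
theorem pairNormSq_form (a : OnePoint ℂ) (G H : ℂ → ℂ) :
    pairNormSq (form a G H) (coform a G H) = pairNormSq G H := by
  funext z
  have h := formFst_normSq_add a
  unfold pairNormSq form coform
  rw [← one_mul (‖G z‖ ^ 2 + ‖H z‖ ^ 2), ← h]
  simp only [← Complex.normSq_eq_norm_sq]
  simp only [Complex.normSq_apply, Complex.mul_re, Complex.mul_im, Complex.conj_re,
    Complex.conj_im, Complex.add_re, Complex.add_im, Complex.neg_re, Complex.neg_im]
  ring


theorem form_smul_sub (a b : OnePoint ℂ) (G H : ℂ → ℂ) (z : ℂ) :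
    formSnd b * form a G H z - formSnd a * form b G H z =
      (formFst a * formSnd b - formSnd a * formFst b) * G z ∧
    formFst a * form b G H z - formFst b * form a G H z =
      (formFst a * formSnd b - formSnd a * formFst b) * H z := by
  unfold form; constructor <;> ring

theorem norm_formFst_le_one (a : OnePoint ℂ) : ‖formFst a‖ ≤ 1 := by
  have := formFst_normSq_add a
  nlinarith [sq_nonneg ‖formSnd a‖, norm_nonneg (formFst a)]

theorem norm_formSnd_le_one (a : OnePoint ℂ) : ‖formSnd a‖ ≤ 1 := by
  have := formFst_normSq_add a
  nlinarith [sq_nonneg ‖formFst a‖, norm_nonneg (formSnd a)]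

/-- Two distinct points of the sphere cannot both be close to a third one. -/
theorem det_sq_le_pairChordal_add {a b : OnePoint ℂ} {G H : ℂ → ℂ} {z : ℂ}
    (h0 : G z ≠ 0 ∨ H z ≠ 0) :
    ‖formFst a * formSnd b - formSnd a * formFst b‖ ^ 2 / 4 ≤
      pairChordal (form a G H) (coform a G H) z + pairChordal (form b G H) (coform b G H) z := by
  have hP := pairNormSq_pos h0
  unfold pairChordal
  rw [pairNormSq_form, pairNormSq_form, ← add_div, le_div_iff₀ hP]
  obtain ⟨e1, e2⟩ := form_smul_sub a b G H z
  set D := formFst a * formSnd b - formSnd a * formFst b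
  have key : ∀ (p q x y : ℂ), ‖p‖ ≤ 1 → ‖q‖ ≤ 1 → ‖p * x - q * y‖ ^ 2 ≤ 2 * (‖x‖ ^ 2 + ‖y‖ ^ 2) := by
    intro p q x y hp hq
    have h1 : ‖p * x - q * y‖ ≤ ‖x‖ + ‖y‖ := by
      refine (norm_sub_le _ _).trans ?_
      rw [norm_mul, norm_mul]
      exact add_le_add (mul_le_of_le_one_left (norm_nonneg _) hp)
        (mul_le_of_le_one_left (norm_nonneg _) hq)
    have h2 : ‖p * x - q * y‖ ^ 2 ≤ (‖x‖ + ‖y‖) ^ 2 := by gcongr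
    nlinarith [sq_nonneg (‖x‖ - ‖y‖)]
  have k1 := key _ _ (form a G H z) (form b G H z) (norm_formSnd_le_one b) (norm_formSnd_le_one a)
  have k2 := key _ _ (form b G H z) (form a G H z) (norm_formFst_le_one a) (norm_formFst_le_one b)
  rw [e1, norm_mul, mul_pow] at k1
  rw [e2, norm_mul, mul_pow] at k2
  unfold pairNormSq
  linarith

section Form

variable {f G H : ℂ → ℂ} {R : ℝ} {z : ℂ}

theorem analyticAt_form (a : OnePoint ℂ) (hG : AnalyticAt ℂ G z) (hH : AnalyticAt ℂ H z) :
    AnalyticAt ℂ (form a G H) z :=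
  (analyticAt_const.mul hG).add (analyticAt_const.mul hH)

theorem analyticAt_coform (a : OnePoint ℂ) (hG : AnalyticAt ℂ G z) (hH : AnalyticAt ℂ H z) :
    AnalyticAt ℂ (coform a G H) z :=
  (analyticAt_const.mul hG).add (analyticAt_const.mul hH)

theorem pairWronskian_form (a : OnePoint ℂ) (hG : AnalyticAt ℂ G z) (hH : AnalyticAt ℂ H z) :
    pairWronskian (form a G H) (coform a G H) z = pairWronskian G H z := by
  have h : formFst a * starRingEnd ℂ (formFst a) + formSnd a * starRingEnd ℂ (formSnd a) = 1 := by
    rw [Complex.mul_conj, Complex.mul_conj, Complex.normSq_eq_norm_sq, Complex.normSq_eq_norm_sq]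
    exact_mod_cast formFst_normSq_add a
  have d1 : deriv (form a G H) z = formFst a * deriv G z + formSnd a * deriv H z :=
    ((hG.differentiableAt.hasDerivAt.const_mul _).add
      (hH.differentiableAt.hasDerivAt.const_mul _)).deriv
  have d2 : deriv (coform a G H) z = -starRingEnd ℂ (formSnd a) * deriv G z +
      starRingEnd ℂ (formFst a) * deriv H z :=
    ((hG.differentiableAt.hasDerivAt.const_mul _).add
      (hH.differentiableAt.hasDerivAt.const_mul _)).deriv
  unfold pairWronskian
  rw [d1, d2, ← mul_one (deriv G z * H z - G z * deriv H z), ← h]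
  unfold form coform
  ring

theorem pairDensity_form (a : OnePoint ℂ) (hG : AnalyticAt ℂ G z) (hH : AnalyticAt ℂ H z) :
    pairDensity (form a G H) (coform a G H) z = pairDensity G H z := by
  unfold pairDensity
  rw [pairWronskian_form a hG hH, pairNormSq_form]

theorem IsReducedPair.form (h : IsReducedPair G H R) (a : OnePoint ℂ) :
    IsReducedPair (form a G H) (coform a G H) R where
  analytic_left z hz := analyticAt_form a (h.analytic_left z hz) (h.analytic_right z hz)
  analytic_right z hz := analyticAt_coform a (h.analytic_left z hz) (h.analytic_right z hz)
  ne_zero z hz := by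
    by_contra! hcon
    have := h.pairNormSq_pos hz
    rw [← pairNormSq_form a] at this
    simp [pairNormSq, hcon.1, hcon.2] at this

/-- A zero of G of order n + 1 is a zero of order at least n of both G' and G, hence of G'H - GH'.
This is the source of the truncated counting. Testing against all finite n also covers infinite
order. -/
theorem analyticOrderAt_le_pairWronskian_add_one (hG : AnalyticAt ℂ G z) (hH : AnalyticAt ℂ H z) :
    analyticOrderAt G z ≤ analyticOrderAt (pairWronskian G H) z + 1 := by
  refine ENat.forall_natCast_le_iff_le.mp fun n hn => ?_
  cases n with
  | zero => simp
  | succ n =>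
    have h1 : (n : ℕ∞) ≤ analyticOrderAt (deriv G) z := by
      have hG0 : G z = 0 := apply_eq_zero_of_analyticOrderAt_ne_zero
        (by intro h; rw [h] at hn; simp at hn)
      exact (analyticOrderAt_deriv_ge_iff hG hG0).2 (by exact_mod_cast hn)
    have h2 : (n : ℕ∞) ≤ analyticOrderAt G z := le_trans (by exact_mod_cast Nat.le_succ n) hn
    have h3 : (n : ℕ∞) ≤ analyticOrderAt (pairWronskian G H) z := by
      refine le_trans (le_min ?_ ?_) (le_analyticOrderAt_sub (f := deriv G * H) (g := G * deriv H))
      · rw [analyticOrderAt_mul hG.deriv hH]; exact le_add_right h1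
      · rw [analyticOrderAt_mul hG hH.deriv]; exact le_add_right h2
    push_cast
    gcongr

end Form

theorem eventually_ne_of_order_ne_top {g : ℂ → ℂ} {R : ℝ} (hg : AnalyticOnNhd ℂ g (ball 0 R))
    (hord : ∀ z ∈ ball (0 : ℂ) R, analyticOrderAt g z ≠ ⊤) :
    ∀ᶠ z in codiscreteWithin (ball (0 : ℂ) R), g z ≠ 0 := by
  rw [mem_codiscreteWithin_ball_iff]
  intro z hz
  rcases (hg z hz).eventually_eq_zero_or_eventually_ne_zero with h1 | h1
  · exact absurd (analyticOrderAt_eq_top.2 h1) (hord z hz)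
  · exact h1

theorem meromorphicOrderAt_div_eq_sub {A B : ℂ → ℂ} {z : ℂ} (hA : AnalyticAt ℂ A z)
    (hB : AnalyticAt ℂ B z) (hA' : analyticOrderAt A z ≠ ⊤) (hB' : analyticOrderAt B z ≠ ⊤) :
    meromorphicOrderAt (fun w => A w / B w) z =
      (((analyticOrderNatAt A z : ℤ) - (analyticOrderNatAt B z : ℤ) : ℤ) : WithTop ℤ) := by
  rw [fun_meromorphicOrderAt_div hA.meromorphicAt hB.meromorphicAt, hA.meromorphicOrderAt_eq,
    hB.meromorphicOrderAt_eq, ← Nat.cast_analyticOrderNatAt hA', ← Nat.cast_analyticOrderNatAt hB']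
  rfl

theorem analyticOrderNatAt_pos_iff {A : ℂ → ℂ} {z : ℂ} (hA : AnalyticAt ℂ A z)
    (hA' : analyticOrderAt A z ≠ ⊤) : 0 < analyticOrderNatAt A z ↔ A z = 0 := by
  rw [← hA.analyticOrderAt_ne_zero, ← Nat.cast_analyticOrderNatAt hA', pos_iff_ne_zero]
  simp

/-! ### Translation between f and a reduced pair -/

namespace IsReducedQuotient

variable {f G H : ℂ → ℂ} {R : ℝ} (h : IsReducedQuotient f G H R) {z : ℂ}
include h

theorem wronskian_form_order (a : OnePoint ℂ) (hz : z ∈ ball (0 : ℂ) R) :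
    analyticOrderAt (pairWronskian (form a G H) (coform a G H)) z =
      analyticOrderAt (pairWronskian G H) z := by
  refine analyticOrderAt_congr ?_
  filter_upwards [isOpen_ball.mem_nhds hz] with w hw
  exact pairWronskian_form a (h.analytic_left w hw) (h.analytic_right w hw)

theorem form_order_ne_top (a : OnePoint ℂ) (hz : z ∈ ball (0 : ℂ) R) :
    analyticOrderAt (form a G H) z ≠ ⊤ := fun htop => by
  refine h.wronskian_order z hz ?_
  rw [← h.wronskian_form_order a hz]
  exact analyticOrderAt_pairWronskian_eq_top_of_left htop

theorem right_order_ne_top (hz : z ∈ ball (0 : ℂ) R) : analyticOrderAt H z ≠ ⊤ := fun htop =>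
  h.wronskian_order z hz (analyticOrderAt_pairWronskian_eq_top_of_right htop)

theorem order_form_le (a : OnePoint ℂ) (hz : z ∈ ball (0 : ℂ) R) :
    analyticOrderNatAt (form a G H) z ≤ analyticOrderNatAt (pairWronskian G H) z + 1 := by
  have := analyticOrderAt_le_pairWronskian_add_one
    (analyticAt_form a (h.analytic_left z hz) (h.analytic_right z hz))
    (analyticAt_coform a (h.analytic_left z hz) (h.analytic_right z hz))
  rw [h.wronskian_form_order a hz, ← Nat.cast_analyticOrderNatAt (h.form_order_ne_top a hz),
    ← Nat.cast_analyticOrderNatAt (h.wronskian_order z hz)] at this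
  exact_mod_cast this

theorem left_order_ne_top (hz : z ∈ ball (0 : ℂ) R) : analyticOrderAt G z ≠ ⊤ := fun htop =>
  h.wronskian_order z hz (analyticOrderAt_pairWronskian_eq_top_of_left htop)

theorem eventually_right_ne : ∀ᶠ z in codiscreteWithin (ball (0 : ℂ) R), H z ≠ 0 :=
  eventually_ne_of_order_ne_top h.analytic_right fun _ => h.right_order_ne_top

/-- The order of f - a, or of f when a = ∞, is a difference of the orders of two functions without
common zeros at z, so its sign tells which of them vanishes. -/
theorem takesValue_iff (a : OnePoint ℂ) (hz : z ∈ ball (0 : ℂ) R) :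
    TakesValue f a z ↔ form a G H z = 0 := by
  have hG := h.analytic_left z hz
  have hH := h.analytic_right z hz
  have heq := mem_codiscreteWithin_ball_iff.1 h.eq z hz
  have hne := mem_codiscreteWithin_ball_iff.1 h.eventually_right_ne z hz
  have hH' := analyticOrderNatAt_pos_iff hH (h.right_order_ne_top hz)
  have hG' := analyticOrderNatAt_pos_iff hG (h.left_order_ne_top hz)
  have h0 := h.ne_zero z hz
  cases a with
  | infty =>
    change meromorphicOrderAt f z < 0 ↔ 0 * G z + 1 * H z = 0
    rw [meromorphicOrderAt_congr heq,
      meromorphicOrderAt_div_eq_sub hG hH (h.left_order_ne_top hz) (h.right_order_ne_top hz),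
      zero_mul, zero_add, one_mul, ← hH', ← WithTop.coe_zero, WithTop.coe_lt_coe]
    by_cases h1 : H z = 0
    · have h2 : ¬ G z = 0 := fun h2 => h0.elim (fun h => h h2) (fun h => h h1)
      rw [← hG'] at h2
      rw [← hH'] at h1
      omega
    · rw [← hH'] at h1
      omega
  | coe a =>
    have hc : formFst (a : OnePoint ℂ) ≠ 0 := by
      have h : (0 : ℝ) < 1 + ‖a‖ ^ 2 := by positivity
      change (((√(1 + ‖a‖ ^ 2))⁻¹ : ℝ) : ℂ) ≠ 0
      exact_mod_cast (inv_pos.2 (sqrt_pos.2 h)).ne'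
    have hs : formSnd (a : OnePoint ℂ) = -a * formFst (a : OnePoint ℂ) := rfl
    have hF := analyticAt_form (a : OnePoint ℂ) hG hH
    have hF0 := h.form_order_ne_top (a : OnePoint ℂ) hz
    have hB : AnalyticAt ℂ (fun w => formFst (a : OnePoint ℂ) * H w) z := analyticAt_const.mul hH
    have hB0 : analyticOrderAt (fun w => formFst (a : OnePoint ℂ) * H w) z ≠ ⊤ := by
      intro htop
      refine h.right_order_ne_top hz (analyticOrderAt_eq_top.2 ?_)
      filter_upwards [analyticOrderAt_eq_top.1 htop] with w hw
      exact (mul_eq_zero.1 hw).resolve_left hc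
    have e : (fun w => f w - a) =ᶠ[𝓝[≠] z]
        fun w => form (a : OnePoint ℂ) G H w / (formFst (a : OnePoint ℂ) * H w) := by
      filter_upwards [heq, hne] with w h1 h2
      rw [h1, form, hs]
      field_simp
      ring
    change 0 < meromorphicOrderAt (fun w => f w - a) z ↔ _
    rw [meromorphicOrderAt_congr e, meromorphicOrderAt_div_eq_sub hF hB hF0 hB0,
      ← analyticOrderNatAt_pos_iff hF hF0, ← WithTop.coe_zero, WithTop.coe_lt_coe]
    have hF' := analyticOrderNatAt_pos_iff hF hF0
    have hB' := analyticOrderNatAt_pos_iff hB hB0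
    by_cases h1 : form (a : OnePoint ℂ) G H z = 0
    · have h2 : ¬ (formFst (a : OnePoint ℂ) * H z = 0) := by
        intro h2
        have h3 := (mul_eq_zero.1 h2).resolve_left hc
        have h4 : formFst (a : OnePoint ℂ) * G z = 0 := by simpa [form, h3] using h1
        exact h0.elim (fun h => h ((mul_eq_zero.1 h4).resolve_left hc)) (fun h => h h3)
      rw [← hB'] at h2
      omega
    · rw [← hF'] at h1
      omega

theorem eventually_fubiniStudyDensity_eq : ∀ᶠ z in codiscreteWithin (ball (0 : ℂ) R),
    fubiniStudyDensity f z = 1 / π * pairDensity G H z := by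
  rw [mem_codiscreteWithin_ball_iff]
  intro z hz
  have heq := eventually_eventually_nhdsWithin.2 (mem_codiscreteWithin_ball_iff.1 h.eq z hz)
  filter_upwards [heq, mem_codiscreteWithin_ball_iff.1 h.eventually_right_ne z hz,
    nhdsWithin_le_nhds (isOpen_ball.mem_nhds hz), self_mem_nhdsWithin] with w h1 h2 h3 h4
  -- At w ≠ z the equality on punctured neighbourhoods of z holds on a full neighbourhood of w, so
  -- the derivatives agree too.
  have h5 : f =ᶠ[𝓝 w] fun z => G z / H z := by
    rwa [nhdsWithin_eq_nhds.2 (isOpen_compl_singleton.mem_nhds h4)] at h1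
  have hd : deriv f w = pairWronskian G H w / H w ^ 2 := by
    rw [h5.deriv_eq]
    exact ((h.analytic_left w h3).differentiableAt.hasDerivAt.div
      (h.analytic_right w h3).differentiableAt.hasDerivAt h2).deriv
  have hP : 0 < pairNormSq G H w := h.toIsReducedPair.pairNormSq_pos h3
  have hH : 0 < ‖H w‖ := norm_pos_iff.2 h2
  unfold fubiniStudyDensity pairDensity
  rw [hd, h5.self_of_nhds]
  congr 1
  have e : 1 + ‖G w / H w‖ ^ 2 = pairNormSq G H w / ‖H w‖ ^ 2 := by
    unfold pairNormSq; rw [norm_div]; field_simp; ring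
  rw [e, norm_div, norm_pow]
  field_simp

/-- The squared chordal distance of `f` to the point `a`. -/
theorem eventually_chordal_eq (a : OnePoint ℂ) : ∀ᶠ z in codiscreteWithin (ball (0 : ℂ) R),
    ‖formFst a * f z + formSnd a‖ ^ 2 / (1 + ‖f z‖ ^ 2) =
      pairChordal (form a G H) (coform a G H) z := by
  filter_upwards [h.eq, h.eventually_right_ne] with w h1 h2
  have hH : 0 < ‖H w‖ := norm_pos_iff.2 h2
  have e : 1 + ‖G w / H w‖ ^ 2 = pairNormSq G H w / ‖H w‖ ^ 2 := by
    unfold pairNormSq; rw [norm_div]; field_simp; ring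
  have e2 : formFst a * (G w / H w) + formSnd a = form a G H w / H w := by
    unfold form; field_simp
  unfold pairChordal
  rw [h1, e, e2, pairNormSq_form, norm_div]
  field_simp

end IsReducedQuotient

/-! ### Polar coordinates -/

theorem intervalIntegral_circleMap_shift (w : ℂ → ℝ) (s : ℝ) :
    ∫ θ in (-π)..π, w (circleMap 0 s θ) = 2 * π * circleAverage w 0 s := by
  have hp : Function.Periodic (fun θ => w (circleMap 0 s θ)) (2 * π) := fun θ => by
    simp [periodic_circleMap 0 s θ]
  have := hp.intervalIntegral_add_eq (-π) 0
  rw [show -π + 2 * π = π by ring, zero_add] at this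
  rw [this, circleAverage_def, smul_eq_mul]
  field_simp

theorem setIntegral_ball_eq {w : ℂ → ℝ} {R t : ℝ} (hw : ContinuousOn w (ball 0 R)) (ht : 0 ≤ t)
    (htR : t < R) :
    ∫ z in ball (0 : ℂ) t, w z = 2 * π * ∫ s in (0 : ℝ)..t, s * circleAverage w 0 s := by
  have hcirc : ∀ p : ℝ × ℝ, Complex.polarCoord.symm p = circleMap 0 p.1 p.2 := fun p => by
    rw [Complex.polarCoord_symm_apply, circleMap, zero_add, Complex.exp_mul_I]
    simp
  rw [← integral_indicator measurableSet_ball, ← Complex.integral_comp_polarCoord_symm,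
    polarCoord_target]
  have hset : ∀ p ∈ Ioi (0 : ℝ) ×ˢ Ioo (-π) π,
      p.1 • (ball (0 : ℂ) t).indicator w (Complex.polarCoord.symm p) =
      (Ioo 0 t ×ˢ (univ : Set ℝ)).indicator (fun p : ℝ × ℝ => p.1 * w (circleMap 0 p.1 p.2)) p := by
    intro p hp
    rw [hcirc]
    have hp0 : 0 < p.1 := hp.1
    have hmem : circleMap 0 p.1 p.2 ∈ ball (0 : ℂ) t ↔ p.1 < t := by simp [abs_of_pos hp0]
    by_cases h : p.1 < t
    · rw [indicator_of_mem (hmem.2 h),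
        indicator_of_mem (show p ∈ Ioo 0 t ×ˢ (univ : Set ℝ) from ⟨⟨hp0, h⟩, mem_univ _⟩),
        smul_eq_mul]
    · rw [indicator_of_notMem (fun h' => h (hmem.1 h')),
        indicator_of_notMem (fun h' => h h'.1.2), smul_zero]
  rw [setIntegral_congr_fun (measurableSet_Ioi.prod measurableSet_Ioo) hset,
    setIntegral_indicator (measurableSet_Ioo.prod MeasurableSet.univ), prod_inter_prod, inter_univ,
    inter_eq_right.2 (Ioo_subset_Ioi_self), Measure.volume_eq_prod, setIntegral_prod]
  · rw [intervalIntegral.integral_of_le ht, integral_Ioc_eq_integral_Ioo, ← integral_const_mul]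
    refine setIntegral_congr_fun measurableSet_Ioo fun s _ => ?_
    simp only
    rw [integral_const_mul, ← integral_Ioc_eq_integral_Ioo,
      ← intervalIntegral.integral_of_le (by linarith [pi_pos]), intervalIntegral_circleMap_shift]
    ring
  · have hc : ContinuousOn (fun p : ℝ × ℝ => p.1 * w (circleMap 0 p.1 p.2))
        (Icc 0 t ×ˢ Icc (-π) π) := by
      refine continuousOn_fst.mul ((continuousOn_comp_circleMap hw).mono ?_)
      exact prod_mono (fun s hs => ⟨by linarith [hs.1], hs.2.trans_lt htR⟩) (subset_univ _)
    refine (hc.integrableOn_compact (isCompact_Icc.prod isCompact_Icc)).mono_set ?_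
    exact prod_mono Ioo_subset_Icc_self Ioo_subset_Icc_self

theorem setIntegral_ball_congr {w v : ℂ → ℝ} {R t : ℝ} (htR : t ≤ R)
    (h : w =ᶠ[codiscreteWithin (ball (0 : ℂ) R)] v) :
    ∫ z in ball (0 : ℂ) t, w z = ∫ z in ball (0 : ℂ) t, v z := by
  refine integral_congr_ae ?_
  exact ae_restrict_le_codiscreteWithin measurableSet_ball
    (codiscreteWithin_mono (ball_subset_ball htR) h)

/-- The factor 2 is 1/π from the Fubini–Study form times 2π from polar coordinates. -/
theorem IsReducedQuotient.T_eq {f G H : ℂ → ℂ} {R r₀ r : ℝ} (h : IsReducedQuotient f G H R)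
    (hr₀ : 0 < r₀) (hr : r₀ ≤ r) (hrR : r < R) :
    T r₀ f r = 2 * radialIntegral r₀ (pairDensity G H) r := by
  unfold T radialIntegral
  rw [← intervalIntegral.integral_const_mul]
  refine intervalIntegral.integral_congr fun t ht => ?_
  rw [uIcc_of_le hr] at ht
  rw [setIntegral_ball_congr (ht.2.trans hrR.le) h.eventually_fubiniStudyDensity_eq,
    integral_const_mul, setIntegral_ball_eq h.continuousOn_pairDensity (hr₀.le.trans ht.1)
      (ht.2.trans_lt hrR)]
  field_simp

/-! ### Extended nonnegative radial integrals -/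

/-- `∫_0^{2π} h(s e^{iθ}) dθ`. -/
noncomputable def circleLintegral (h : ℂ → ℝ≥0∞) (s : ℝ) : ℝ≥0∞ :=
  ∫⁻ θ in Ioc 0 (2 * π), h (circleMap 0 s θ)

/-- `∫_{|z| < t} h`, as a radial integral. -/
noncomputable def discLintegral (h : ℂ → ℝ≥0∞) (t : ℝ) : ℝ≥0∞ :=
  ∫⁻ s in Ioo 0 t, ENNReal.ofReal s * circleLintegral h s

/-- `∫_{r₀}^r (dt / t) ∫_{|z| < t} h`. -/
noncomputable def radialLintegral (r₀ : ℝ) (h : ℂ → ℝ≥0∞) (r : ℝ) : ℝ≥0∞ :=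
  ∫⁻ t in Ioo r₀ r, ENNReal.ofReal t⁻¹ * discLintegral h t

theorem monotone_discLintegral (h : ℂ → ℝ≥0∞) : Monotone (discLintegral h) := fun _ _ hst =>
  lintegral_mono_set (Ioo_subset_Ioo_right hst)

theorem measurable_circleLintegral {h : ℂ → ℝ≥0∞} (hh : Measurable h) :
    Measurable (circleLintegral h) := by
  have : Measurable fun p : ℝ × ℝ => h (circleMap 0 p.1 p.2) :=
    hh.comp (Continuous.measurable (by unfold circleMap; fun_prop))
  exact this.lintegral_prod_right'

/-- Fatou's lemma three times, in θ, s and t. Extended values are used because finiteness of the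
limiting integral is part of what has to be proved. -/
theorem radialLintegral_le_liminf {h : ℂ → ℝ≥0∞} {hn : ℕ → ℂ → ℝ≥0∞}
    (hm : ∀ n, Measurable (hn n)) (hle : ∀ z, h z ≤ liminf (fun n => hn n z) atTop) (r₀ r : ℝ) :
    radialLintegral r₀ h r ≤ liminf (fun n => radialLintegral r₀ (hn n) r) atTop := by
  have hmul : ∀ (c : ℝ) (u : ℕ → ℝ≥0∞), ENNReal.ofReal c * liminf u atTop =
      liminf (fun n => ENNReal.ofReal c * u n) atTop := fun c u =>
    (ENNReal.liminf_const_mul_of_ne_top ENNReal.ofReal_ne_top).symm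
  have h1 : ∀ s, circleLintegral h s ≤ liminf (fun n => circleLintegral (hn n) s) atTop :=
    fun s => (lintegral_mono fun θ => hle _).trans
      (lintegral_liminf_le fun n => (hm n).comp (continuous_circleMap 0 s).measurable)
  have h2 : ∀ t, discLintegral h t ≤ liminf (fun n => discLintegral (hn n) t) atTop := fun t => by
    refine (lintegral_mono fun s => ?_).trans
      (lintegral_liminf_le fun n => ENNReal.measurable_ofReal.mul (measurable_circleLintegral (hm n)))
    exact (mul_le_mul_right (h1 s) _).trans (hmul _ _).le
  refine (lintegral_mono fun t => ?_).trans
    (lintegral_liminf_le fun n => (ENNReal.measurable_ofReal.comp measurable_inv).mul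
      (monotone_discLintegral (hn n)).measurable)
  exact (mul_le_mul_right (h2 t) _).trans (hmul _ _).le

section Real

variable {w : ℂ → ℝ} {R r₀ r s t : ℝ}

theorem circleLintegral_ofReal (hw : ContinuousOn w (ball 0 R)) (h0 : ∀ z ∈ ball (0 : ℂ) R, 0 ≤ w z)
    (hs : s ∈ Ioo (-R) R) :
    circleLintegral (fun z => ENNReal.ofReal (w z)) s =
      ENNReal.ofReal (2 * π * circleAverage w 0 s) := by
  have hc : Continuous fun θ => w (circleMap 0 s θ) :=
    hw.comp_continuous (continuous_circleMap 0 s) (circleMap_zero_mem_ball hs)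
  have e : 2 * π * circleAverage w 0 s = ∫ θ in Ioc 0 (2 * π), w (circleMap 0 s θ) := by
    rw [circleAverage_def, intervalIntegral.integral_of_le (by positivity), smul_eq_mul]
    field_simp
  rw [e, circleLintegral, ofReal_integral_eq_lintegral_ofReal]
  · exact (hc.intervalIntegrable 0 (2 * π)).1
  · exact Eventually.of_forall fun θ => h0 _ (circleMap_zero_mem_ball hs θ)

theorem circleAverage_nonneg_of_ball (h0 : ∀ z ∈ ball (0 : ℂ) R, 0 ≤ w z) (hs : s ∈ Ioo (-R) R) :
    0 ≤ circleAverage w 0 s := by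
  refine circleAverage_nonneg_of_nonneg fun z hz => h0 z ?_
  rw [mem_sphere] at hz
  rw [mem_ball, hz]; exact abs_lt.2 hs

theorem discLintegral_ofReal (hw : ContinuousOn w (ball 0 R)) (h0 : ∀ z ∈ ball (0 : ℂ) R, 0 ≤ w z)
    (ht : 0 ≤ t) (htR : t < R) :
    discLintegral (fun z => ENNReal.ofReal (w z)) t =
      ENNReal.ofReal (2 * π * ∫ s in (0 : ℝ)..t, s * circleAverage w 0 s) := by
  rw [intervalIntegral.integral_of_le ht, integral_Ioc_eq_integral_Ioo, ← integral_const_mul,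
    ofReal_integral_eq_lintegral_ofReal]
  · refine setLIntegral_congr_fun measurableSet_Ioo fun s hs => ?_
    rw [circleLintegral_ofReal hw h0 ⟨by linarith [hs.1, hs.2], hs.2.trans htR⟩,
      ← ENNReal.ofReal_mul hs.1.le]
    congr 1
    ring
  · exact ((intervalIntegrable_mul_circleAverage hw ht htR).1.mono_set Ioo_subset_Ioc_self
      ).const_mul _
  · refine (ae_restrict_iff' measurableSet_Ioo).2 (Eventually.of_forall fun s hs => ?_)
    have := circleAverage_nonneg_of_ball (s := s) h0 ⟨by linarith [hs.1, hs.2], hs.2.trans htR⟩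
    have := hs.1.le
    simp only [Pi.zero_apply]
    positivity

theorem flux_nonneg (h0 : ∀ z ∈ ball (0 : ℂ) R, 0 ≤ w z) (ht : 0 ≤ t) (htR : t < R) :
    0 ≤ ∫ s in (0 : ℝ)..t, s * circleAverage w 0 s :=
  intervalIntegral.integral_nonneg ht fun s hs => mul_nonneg hs.1
    (circleAverage_nonneg_of_ball h0 ⟨by linarith [hs.1, hs.2], hs.2.trans_lt htR⟩)

theorem radialLintegral_ofReal (hw : ContinuousOn w (ball 0 R))
    (h0 : ∀ z ∈ ball (0 : ℂ) R, 0 ≤ w z) (hr₀ : 0 < r₀) (hr : r₀ ≤ r) (hrR : r < R) :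
    radialLintegral r₀ (fun z => ENNReal.ofReal (w z)) r =
      ENNReal.ofReal (2 * π * radialIntegral r₀ w r) := by
  rw [radialIntegral, intervalIntegral.integral_of_le hr, integral_Ioc_eq_integral_Ioo,
    ← integral_const_mul, ofReal_integral_eq_lintegral_ofReal]
  · refine setLIntegral_congr_fun measurableSet_Ioo fun t ht => ?_
    have ht0 : 0 < t := hr₀.trans ht.1
    rw [discLintegral_ofReal hw h0 ht0.le (ht.2.trans hrR),
      ← ENNReal.ofReal_mul (inv_nonneg.2 ht0.le)]
    congr 1
    field_simp
  · exact ((intervalIntegrable_flux_div hw hr₀ hr hrR).1.mono_set Ioo_subset_Ioc_self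
      ).const_mul _
  · refine (ae_restrict_iff' measurableSet_Ioo).2 (Eventually.of_forall fun t ht => ?_)
    have ht0 : 0 < t := hr₀.trans ht.1
    have := flux_nonneg h0 ht0.le (ht.2.trans hrR)
    simp only [Pi.zero_apply]
    positivity

end Real

/-! ### Borel's growth lemma on the unit interval -/

/-- A is exhausted by its parts below points of A that increase to sup A; what is left is at most
one point. Measurability of A plays no role. -/
theorem setLIntegral_le_of_forall_Iio {g : ℝ → ℝ≥0∞} {A : Set ℝ} (hA : BddAbove A) {M : ℝ≥0∞}
    (h : ∀ r ∈ A, ∫⁻ s in A ∩ Iio r, g s ≤ M) : ∫⁻ s in A, g s ≤ M := by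
  rcases A.eq_empty_or_nonempty with rfl | hne
  · simp
  obtain ⟨u, hu, hlim, huA⟩ := exists_seq_tendsto_sSup hne hA
  have hsub : A ⊆ (⋃ n, A ∩ Iio (u n)) ∪ {sSup A} := fun a ha => by
    rcases (le_csSup hA ha).eq_or_lt with h1 | h1
    · exact Or.inr h1
    · obtain ⟨n, hn⟩ := (hlim.eventually (lt_mem_nhds h1)).exists
      exact Or.inl (mem_iUnion.2 ⟨n, ha, hn⟩)
  have hdir : Directed (· ⊆ ·) fun n => A ∩ Iio (u n) :=
    (show Monotone fun n => A ∩ Iio (u n) from fun m n hmn =>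
      inter_subset_inter_right _ (Iio_subset_Iio (hu hmn))).directed_le
  calc ∫⁻ s in A, g s ≤ ∫⁻ s in (⋃ n, A ∩ Iio (u n)) ∪ {sSup A}, g s := lintegral_mono_set hsub
    _ ≤ (∫⁻ s in ⋃ n, A ∩ Iio (u n), g s) + ∫⁻ s in {sSup A}, g s := lintegral_union_le _ _ _
    _ = ∫⁻ s in ⋃ n, A ∩ Iio (u n), g s := by simp
    _ = ⨆ n, ∫⁻ s in A ∩ Iio (u n), g s := setLIntegral_iUnion_of_directed g hdir
    _ ≤ M := iSup_le fun n => h _ (huA n)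

/-- Discrete version of ∫ F'/F² < ∞ for F = 1 + ∫g: where 2ⁿ ≤ F < 2ⁿ⁺¹ the integral of g is at most
2ⁿ⁺¹, so this piece contributes at most 2·2⁻ⁿ. No regularity of g is needed. -/
theorem lintegral_div_sq_primitive_lt_top {g : ℝ → ℝ≥0∞}
    (hfin : ∀ r ∈ Ioo (0 : ℝ) 1, ∫⁻ s in Ioo 0 r, g s < ⊤) :
    ∫⁻ r in Ioo (0 : ℝ) 1, g r / (1 + ∫⁻ s in Ioo 0 r, g s) ^ 2 < ⊤ := by
  set F : ℝ → ℝ≥0∞ := fun r => 1 + ∫⁻ s in Ioo 0 r, g s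
  have hF : Monotone F := fun a b hab =>
    add_le_add_right (lintegral_mono_set (Ioo_subset_Ioo_right hab)) 1
  set A : ℕ → Set ℝ := fun n => {r ∈ Ioo (0 : ℝ) 1 | (2 : ℝ≥0∞) ^ n ≤ F r ∧ F r < 2 ^ (n + 1)}
  have hcover : Ioo (0 : ℝ) 1 ⊆ ⋃ n, A n := fun r hr => by
    have h1 : F r ≠ ⊤ := ENNReal.add_ne_top.2 ⟨ENNReal.one_ne_top, (hfin r hr).ne⟩
    have h2 : (1 : ℝ) ≤ (F r).toReal := by
      rw [← ENNReal.toReal_one]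
      exact ENNReal.toReal_mono h1 le_self_add
    obtain ⟨n, hn1, hn2⟩ := exists_nat_pow_near h2 (one_lt_two)
    refine mem_iUnion.2 ⟨n, hr, ?_, ?_⟩
    · rw [← ENNReal.ofReal_toReal h1, ← ENNReal.ofReal_ofNat, ← ENNReal.ofReal_pow (by norm_num)]
      exact ENNReal.ofReal_le_ofReal hn1
    · rw [← ENNReal.ofReal_toReal h1, ← ENNReal.ofReal_ofNat, ← ENNReal.ofReal_pow (by norm_num)]
      exact (ENNReal.ofReal_lt_ofReal_iff (by positivity)).2 hn2
  have hAm : ∀ n, MeasurableSet (A n) := fun n =>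
    measurableSet_Ioo.inter ((measurableSet_le measurable_const hF.measurable).inter
      (measurableSet_lt hF.measurable measurable_const))
  have hA : ∀ n, ∫⁻ r in A n, g r / F r ^ 2 ≤ 2 * (2⁻¹ : ℝ≥0∞) ^ n := fun n => by
    have h1 : ∫⁻ r in A n, g r ≤ 2 ^ (n + 1) := by
      refine setLIntegral_le_of_forall_Iio ⟨1, fun r hr => hr.1.2.le⟩ fun r hr => ?_
      refine (lintegral_mono_set fun s hs => ?_).trans
        ((le_add_self (a := ∫⁻ s in Ioo 0 r, g s) (b := 1)).trans hr.2.2.le)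
      exact ⟨hs.1.1.1, hs.2⟩
    calc ∫⁻ r in A n, g r / F r ^ 2 ≤ ∫⁻ r in A n, g r * ((2 ^ n) ^ 2)⁻¹ := by
          refine setLIntegral_mono' (hAm n) fun r hr => ?_
          rw [div_eq_mul_inv]
          gcongr
          exact hr.2.1
      _ = (∫⁻ r in A n, g r) * ((2 ^ n) ^ 2)⁻¹ := lintegral_mul_const' _ _ (by simp)
      _ ≤ 2 ^ (n + 1) * ((2 ^ n) ^ 2)⁻¹ := by gcongr
      _ = 2 * (2⁻¹ : ℝ≥0∞) ^ n := by
          rw [pow_succ, ← ENNReal.inv_pow, sq,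
            ENNReal.mul_inv (Or.inl (by simp)) (Or.inl (by simp))]
          rw [mul_comm ((2 : ℝ≥0∞) ^ n) 2, mul_assoc, ← mul_assoc ((2 : ℝ≥0∞) ^ n),
            ENNReal.mul_inv_cancel (by simp) (by simp), one_mul]
  calc ∫⁻ r in Ioo (0 : ℝ) 1, g r / F r ^ 2 ≤ ∫⁻ r in ⋃ n, A n, g r / F r ^ 2 :=
        lintegral_mono_set hcover
    _ ≤ ∑' n, ∫⁻ r in A n, g r / F r ^ 2 := lintegral_iUnion_le _ _
    _ ≤ ∑' n, 2 * (2⁻¹ : ℝ≥0∞) ^ n := ENNReal.tsum_le_tsum hA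
    _ = 2 * 2 := by
      rw [ENNReal.tsum_mul_left, ENNReal.tsum_geometric, ENNReal.one_sub_inv_two, inv_inv]
    _ < ⊤ := by norm_num

/-- Where the inequality fails, 1/(1 - r) is below g/F², which is integrable. -/
theorem exists_exceptional_set {g : ℝ → ℝ≥0∞} (hg : AEMeasurable g (volume.restrict (Ioo 0 1)))
    (hfin : ∀ r ∈ Ioo (0 : ℝ) 1, ∫⁻ s in Ioo 0 r, g s < ⊤) :
    ∃ E ⊆ Ioo (0 : ℝ) 1, MeasurableSet E ∧ ∫⁻ r in E, ENNReal.ofReal (1 - r)⁻¹ < ⊤ ∧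
      ∀ r ∈ Ioo (0 : ℝ) 1 \ E,
        g r ≤ (1 + ∫⁻ s in Ioo 0 r, g s) ^ 2 * ENNReal.ofReal (1 - r)⁻¹ := by
  set F : ℝ → ℝ≥0∞ := fun r => 1 + ∫⁻ s in Ioo 0 r, g s
  have hF : Monotone F := fun a b hab =>
    add_le_add_right (lintegral_mono_set (Ioo_subset_Ioo_right hab)) 1
  obtain ⟨g', hg', hgg'⟩ := hg
  have hnull : volume {r | ¬ (r ∈ Ioo (0 : ℝ) 1 → g r = g' r)} = 0 :=
    (ae_restrict_iff' measurableSet_Ioo).1 hgg'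
  -- E is built from a measurable version g'; a measurable null set containing the points where g
  -- and g' differ is added to it.
  set N := toMeasurable volume {r | ¬ (r ∈ Ioo (0 : ℝ) 1 → g r = g' r)}
  have hN : volume N = 0 := by rw [measure_toMeasurable]; exact hnull
  set E₁ := {r ∈ Ioo (0 : ℝ) 1 | F r ^ 2 * ENNReal.ofReal (1 - r)⁻¹ < g' r}
  have hE₁ : MeasurableSet E₁ := measurableSet_Ioo.inter (measurableSet_lt
    ((hF.measurable.pow_const 2).mul (by fun_prop)) hg')
  refine ⟨E₁ ∪ (N ∩ Ioo 0 1), union_subset (fun r hr => hr.1) inter_subset_right,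
    hE₁.union ((measurableSet_toMeasurable _ _).inter measurableSet_Ioo), ?_, ?_⟩
  · have h0 : ∫⁻ r in N ∩ Ioo 0 1, ENNReal.ofReal (1 - r)⁻¹ = 0 :=
      setLIntegral_measure_zero _ _ (measure_mono_null inter_subset_left hN)
    refine (lintegral_union_le _ _ _).trans_lt ?_
    rw [h0, add_zero]
    refine lt_of_le_of_lt ?_ (lintegral_div_sq_primitive_lt_top hfin)
    calc ∫⁻ r in E₁, ENNReal.ofReal (1 - r)⁻¹ ≤ ∫⁻ r in E₁, g' r / F r ^ 2 := by
          refine setLIntegral_mono' hE₁ fun r hr => ?_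
          have h1 : F r ≠ ⊤ := ENNReal.add_ne_top.2 ⟨ENNReal.one_ne_top, (hfin r hr.1).ne⟩
          have h2 : F r ≠ 0 := by simp [F]
          rw [ENNReal.le_div_iff_mul_le (Or.inl (pow_ne_zero 2 h2)) (Or.inl (ENNReal.pow_ne_top h1)),
            mul_comm]
          exact hr.2.le
      _ ≤ ∫⁻ r in Ioo (0 : ℝ) 1, g' r / F r ^ 2 := lintegral_mono_set fun r hr => hr.1
      _ = ∫⁻ r in Ioo (0 : ℝ) 1, g r / F r ^ 2 := by
          refine lintegral_congr_ae ?_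
          filter_upwards [hgg'] with r hr
          rw [hr]
  · intro r hr
    have h1 : r ∉ N := fun h => hr.2 (Or.inr ⟨h, hr.1⟩)
    have h2 : g r = g' r := by
      by_contra h3
      exact h1 (subset_toMeasurable _ _ (show ¬ (_ → _) from fun h => h3 (h hr.1)))
    rw [h2]
    by_contra h3
    exact hr.2 (Or.inl ⟨hr.1, not_le.1 h3⟩)

/-! ### Circle averages and codiscrete sets -/

section Codiscrete

variable {R s : ℝ}

theorem codiscreteWithin_sphere_le_ball (hs : 0 < s) (hsR : s < R) :
    codiscreteWithin (sphere (0 : ℂ) |s|) ≤ codiscreteWithin (ball (0 : ℂ) R) :=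
  codiscreteWithin_mono fun z hz => by
    rw [mem_sphere, abs_of_pos hs] at hz
    rw [mem_ball, hz]; exact hsR

theorem circleAverage_congr_ball {u v : ℂ → ℝ} (h : u =ᶠ[codiscreteWithin (ball (0 : ℂ) R)] v)
    (hs : 0 < s) (hsR : s < R) : circleAverage u 0 s = circleAverage v 0 s :=
  circleAverage_congr_codiscreteWithin (codiscreteWithin_sphere_le_ball hs hsR h) hs.ne'

theorem circleIntegrable_congr_ball {u v : ℂ → ℝ} (h : u =ᶠ[codiscreteWithin (ball (0 : ℂ) R)] v)
    (hs : 0 < s) (hsR : s < R) (hu : CircleIntegrable u 0 s) : CircleIntegrable v 0 s :=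
  hu.congr_codiscreteWithin (codiscreteWithin_sphere_le_ball hs hsR h)

/-- Replacing u by min(u, v) changes it only off a codiscrete set, which the average does not see,
and makes the inequality hold everywhere. -/
theorem circleAverage_mono_ball {u v : ℂ → ℝ} (hs : 0 < s) (hsR : s < R)
    (hu : CircleIntegrable u 0 s) (hv : CircleIntegrable v 0 s)
    (h : ∀ᶠ z in codiscreteWithin (ball (0 : ℂ) R), u z ≤ v z) :
    circleAverage u 0 s ≤ circleAverage v 0 s := by
  have hmin : u =ᶠ[codiscreteWithin (ball (0 : ℂ) R)] fun z => min (u z) (v z) := by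
    filter_upwards [h] with z hz using (min_eq_left hz).symm
  rw [circleAverage_congr_ball hmin hs hsR]
  exact circleAverage_mono (circleIntegrable_congr_ball hmin hs hsR hu) hv
    fun z _ => min_le_right _ _

theorem ae_circleMap_of_ball {p : ℂ → Prop} (h : ∀ᶠ z in codiscreteWithin (ball (0 : ℂ) R), p z)
    (hs : 0 < s) (hsR : s < R) : ∀ᵐ θ : ℝ, p (circleMap 0 s θ) := by
  have h1 := circleMap_preimage_codiscrete (c := 0) hs.ne'
    (codiscreteWithin_sphere_le_ball hs hsR h)
  have h2 := ae_restrict_le_codiscreteWithin (μ := (volume : Measure ℝ)) (U := univ)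
    MeasurableSet.univ h1
  rwa [Measure.restrict_univ] at h2

theorem circleLintegral_congr_ball {g h : ℂ → ℝ≥0∞}
    (hgh : g =ᶠ[codiscreteWithin (ball (0 : ℂ) R)] h) (hs : 0 < s) (hsR : s < R) :
    circleLintegral g s = circleLintegral h s :=
  lintegral_congr_ae (ae_restrict_of_ae (ae_circleMap_of_ball hgh hs hsR))

theorem discLintegral_congr_ball {g h : ℂ → ℝ≥0∞}
    (hgh : g =ᶠ[codiscreteWithin (ball (0 : ℂ) R)] h) {t : ℝ} (ht : t ≤ R) :
    discLintegral g t = discLintegral h t :=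
  setLIntegral_congr_fun measurableSet_Ioo fun s hs => by
    simp only [circleLintegral_congr_ball hgh hs.1 (hs.2.trans_le ht)]

theorem radialLintegral_congr_ball {g h : ℂ → ℝ≥0∞}
    (hgh : g =ᶠ[codiscreteWithin (ball (0 : ℂ) R)] h) {r₀ r : ℝ} (hr : r ≤ R) :
    radialLintegral r₀ g r = radialLintegral r₀ h r :=
  setLIntegral_congr_fun measurableSet_Ioo fun t ht => by
    simp only [discLintegral_congr_ball hgh (ht.2.le.trans hr)]

theorem circleIntegrable_log_norm_of_ball {g : ℂ → ℂ}
    (hg : AnalyticOnNhd ℂ g (ball 0 R)) (hs : 0 < s)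
    (hsR : s < R) : CircleIntegrable (fun z => log ‖g z‖) 0 s := by
  refine MeromorphicOn.circleIntegrable_log_norm fun z hz => (hg z ?_).meromorphicAt
  rw [mem_sphere, abs_of_pos hs] at hz
  rw [mem_ball, hz]; exact hsR

end Codiscrete

/-! ### First main theorem -/

/-- The squared chordal distance of `f z` to `a`. -/
noncomputable def chordal (f : ℂ → ℂ) (a : OnePoint ℂ) (z : ℂ) : ℝ :=
  ‖formFst a * f z + formSnd a‖ ^ 2 / (1 + ‖f z‖ ^ 2)

namespace IsReducedQuotient

variable {f G H : ℂ → ℂ} {R r₀ r s : ℝ} (h : IsReducedQuotient f G H R)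
include h

theorem eventually_form_ne (a : OnePoint ℂ) :
    ∀ᶠ z in codiscreteWithin (ball (0 : ℂ) R), form a G H z ≠ 0 :=
  eventually_ne_of_order_ne_top (h.toIsReducedPair.form a).analytic_left
    fun _ => h.form_order_ne_top a

theorem eventually_pairWronskian_ne :
    ∀ᶠ z in codiscreteWithin (ball (0 : ℂ) R), pairWronskian G H z ≠ 0 :=
  eventually_ne_of_order_ne_top h.analyticOnNhd_pairWronskian h.wronskian_order

theorem eventually_log_chordal_eq (a : OnePoint ℂ) :
    (fun z => 2 * log ‖form a G H z‖ - log (pairNormSq G H z))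
      =ᶠ[codiscreteWithin (ball (0 : ℂ) R)] fun z => log (chordal f a z) := by
  filter_upwards [h.eventually_chordal_eq a, h.eventually_form_ne a, self_mem_codiscreteWithin (ball (0 : ℂ) R)]
    with z h1 h2 h3
  rw [chordal, h1, pairChordal, pairNormSq_form, log_div (by simpa using h2)
    (h.toIsReducedPair.pairNormSq_pos h3).ne', log_pow]
  simp

theorem eventually_log_density_eq :
    (fun z => 2 * log ‖pairWronskian G H z‖ - 2 * log (pairNormSq G H z) + log (1 / π))
      =ᶠ[codiscreteWithin (ball (0 : ℂ) R)] fun z => log (fubiniStudyDensity f z) := by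
  filter_upwards [h.eventually_fubiniStudyDensity_eq, h.eventually_pairWronskian_ne,
    self_mem_codiscreteWithin (ball (0 : ℂ) R)] with z h1 h2 h3
  have hP := (h.toIsReducedPair.pairNormSq_pos h3).ne'
  have hW : ‖pairWronskian G H z‖ ≠ 0 := norm_ne_zero_iff.2 h2
  rw [h1, pairDensity, log_mul (by positivity) (div_ne_zero (pow_ne_zero 2 hW) (pow_ne_zero 2 hP)),
    log_div (pow_ne_zero 2 hW) (pow_ne_zero 2 hP), log_pow, log_pow]
  push_cast
  ring

theorem continuousOn_log_pairNormSq :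
    ContinuousOn (fun z => log (pairNormSq G H z)) (ball 0 R) :=
  h.continuousOn_pairNormSq.log fun _ hz => (h.toIsReducedPair.pairNormSq_pos hz).ne'

theorem circleIntegrable_log_pairNormSq (hs : 0 < s) (hsR : s < R) :
    CircleIntegrable (fun z => log (pairNormSq G H z)) 0 s :=
  circleIntegrable_of_continuousOn_ball h.continuousOn_log_pairNormSq hs.le hsR

theorem circleIntegrable_log_chordal (a : OnePoint ℂ) (hs : 0 < s) (hsR : s < R) :
    CircleIntegrable (fun z => log (chordal f a z)) 0 s :=
  circleIntegrable_congr_ball (h.eventually_log_chordal_eq a) hs hsR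
    (((circleIntegrable_log_norm_of_ball (h.toIsReducedPair.form a).analytic_left hs hsR).const_smul
      (a := (2 : ℝ))).sub (h.circleIntegrable_log_pairNormSq hs hsR))

theorem circleIntegrable_log_density (hs : 0 < s) (hsR : s < R) :
    CircleIntegrable (fun z => log (fubiniStudyDensity f z)) 0 s :=
  circleIntegrable_congr_ball h.eventually_log_density_eq hs hsR
    ((((circleIntegrable_log_norm_of_ball h.analyticOnNhd_pairWronskian hs hsR).const_smul
      (a := (2 : ℝ))).sub ((h.circleIntegrable_log_pairNormSq hs hsR).const_smul
      (a := (2 : ℝ)))).add (circleIntegrable_const _ _ _))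

theorem circleAverage_log_chordal (a : OnePoint ℂ) (hs : 0 < s) (hsR : s < R) :
    circleAverage (fun z => log (chordal f a z)) 0 s =
      2 * circleAverage (fun z => log ‖form a G H z‖) 0 s -
        circleAverage (fun z => log (pairNormSq G H z)) 0 s := by
  have i1 := circleIntegrable_log_norm_of_ball (h.toIsReducedPair.form a).analytic_left hs hsR
  rw [← circleAverage_congr_ball (h.eventually_log_chordal_eq a) hs hsR]
  have := circleAverage_fun_sub (i1.const_smul (a := (2 : ℝ)))
    (h.circleIntegrable_log_pairNormSq hs hsR)
  rw [circleAverage_smul] at this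
  exact this

theorem circleAverage_log_density (hs : 0 < s) (hsR : s < R) :
    circleAverage (fun z => log (fubiniStudyDensity f z)) 0 s =
      2 * circleAverage (fun z => log ‖pairWronskian G H z‖) 0 s -
        2 * circleAverage (fun z => log (pairNormSq G H z)) 0 s + log (1 / π) := by
  have i1 := circleIntegrable_log_norm_of_ball h.analyticOnNhd_pairWronskian hs hsR
  have i2 := h.circleIntegrable_log_pairNormSq hs hsR
  rw [← circleAverage_congr_ball h.eventually_log_density_eq hs hsR]
  have e1 := circleAverage_sub (i1.const_smul (a := (2 : ℝ))) (i2.const_smul (a := (2 : ℝ)))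
  rw [circleAverage_smul, circleAverage_smul] at e1
  have e2 := circleAverage_fun_add ((i1.const_smul (a := (2 : ℝ))).sub (i2.const_smul (a := (2 : ℝ))))
    (circleIntegrable_const (log (1 / π)) 0 s)
  rw [e1, circleAverage_const] at e2
  exact e2

/-- First main theorem: Jensen's formula for the form, minus Green's formula for log(|G|² + |H|²),
whose average grows by 2T. -/
theorem circleAverage_log_chordal_sub (a : OnePoint ℂ) (hr₀ : 0 < r₀) (hr : r₀ ≤ r) (hrR : r < R)
    {S : Finset ℂ} (hS : ∀ u ∈ closedBall (0 : ℂ) r, form a G H u = 0 → u ∈ S) :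
    circleAverage (fun z => log (chordal f a z)) 0 r -
      circleAverage (fun z => log (chordal f a z)) 0 r₀ =
      2 * ∑ u ∈ S, (analyticOrderNatAt (form a G H) u : ℝ) * countKernel r₀ r u -
        2 * T r₀ f r := by
  have e1 := circleAverage_log_norm_sub hr₀ hr
    ((h.toIsReducedPair.form a).analytic_left.mono (closedBall_subset_ball hrR)) hS
  have e2 := h.circleAverage_log_pairNormSq_sub hr₀ hr hrR
  rw [h.circleAverage_log_chordal a (hr₀.trans_le hr) hrR,
    h.circleAverage_log_chordal a hr₀ (hr.trans_lt hrR), h.T_eq hr₀ hr hrR, ← e1]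
  linarith

/-- The zeros of W count the ramification of f. The squared norm enters the density to the power -2,
hence 4T instead of 2T. -/
theorem circleAverage_log_density_sub (hr₀ : 0 < r₀) (hr : r₀ ≤ r) (hrR : r < R)
    {S : Finset ℂ} (hS : ∀ u ∈ closedBall (0 : ℂ) r, pairWronskian G H u = 0 → u ∈ S) :
    circleAverage (fun z => log (fubiniStudyDensity f z)) 0 r -
      circleAverage (fun z => log (fubiniStudyDensity f z)) 0 r₀ =
      2 * ∑ u ∈ S, (analyticOrderNatAt (pairWronskian G H) u : ℝ) * countKernel r₀ r u -
        4 * T r₀ f r := by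
  have e1 := circleAverage_log_norm_sub hr₀ hr
    (h.analyticOnNhd_pairWronskian.mono (closedBall_subset_ball hrR)) hS
  have e2 := h.circleAverage_log_pairNormSq_sub hr₀ hr hrR
  rw [h.circleAverage_log_density (hr₀.trans_le hr) hrR,
    h.circleAverage_log_density hr₀ (hr.trans_lt hrR), h.T_eq hr₀ hr hrR, ← e1]
  linarith

theorem T_nonneg (hr₀ : 0 < r₀) (hr : r₀ ≤ r) (hrR : r < R) : 0 ≤ T r₀ f r := by
  rw [h.T_eq hr₀ hr hrR]
  refine mul_nonneg zero_le_two (intervalIntegral.integral_nonneg hr fun t ht => ?_)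
  exact div_nonneg (flux_nonneg (fun z _ => by unfold pairDensity; positivity)
    (hr₀.le.trans ht.1) (ht.2.trans_lt hrR)) (hr₀.le.trans ht.1)

theorem T_mono {r' : ℝ} (hr₀ : 0 < r₀) (hr : r₀ ≤ r) (hrr' : r ≤ r') (hrR : r' < R) :
    T r₀ f r ≤ T r₀ f r' := by
  rw [h.T_eq hr₀ hr (hrr'.trans_lt hrR), h.T_eq hr₀ (hr.trans hrr') hrR]
  refine mul_le_mul_of_nonneg_left ?_ zero_le_two
  refine intervalIntegral.integral_mono_interval le_rfl hr hrr' ?_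
    (intervalIntegrable_flux_div h.continuousOn_pairDensity hr₀ (hr.trans hrr') hrR)
  refine (ae_restrict_iff' measurableSet_Ioc).2 (Eventually.of_forall fun t ht => ?_)
  exact div_nonneg (flux_nonneg (fun z _ => by unfold pairDensity; positivity)
    (hr₀.trans ht.1).le (ht.2.trans_lt hrR)) (hr₀.trans ht.1).le

/-- The density vanishes only at the zeros of W, a null set, so its integral over every disc is
positive. -/
theorem T_pos (hr₀ : 0 < r₀) (hr : r₀ < r) (hrR : r < R) : 0 < T r₀ f r := by
  rw [h.T_eq hr₀ hr.le hrR]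
  refine mul_pos two_pos (intervalIntegral.intervalIntegral_pos_of_pos_on
    (intervalIntegrable_flux_div h.continuousOn_pairDensity hr₀ hr.le hrR) (fun t ht => ?_) hr)
  have ht0 : 0 < t := hr₀.trans ht.1
  have htR : t < R := ht.2.trans hrR
  refine div_pos ?_ ht0
  have hD := h.continuousOn_pairDensity
  have e := setIntegral_ball_eq hD ht0.le htR
  have hpos : 0 < ∫ z in ball (0 : ℂ) t, pairDensity G H z := by
    have hint : IntegrableOn (pairDensity G H) (ball 0 t) :=
      ((hD.mono (closedBall_subset_ball htR)).integrableOn_compact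
        (isCompact_closedBall _ _)).mono_set ball_subset_closedBall
    rw [setIntegral_pos_iff_support_of_nonneg_ae
      (Eventually.of_forall fun z => by simp only [Pi.zero_apply, pairDensity]; positivity) hint]
    have hae : ∀ᵐ z ∂volume.restrict (ball (0 : ℂ) t),
        z ∈ Function.support (pairDensity G H) := by
      refine ae_restrict_le_codiscreteWithin measurableSet_ball
        (codiscreteWithin_mono (ball_subset_ball htR.le) ?_)
      filter_upwards [h.eventually_pairWronskian_ne, self_mem_codiscreteWithin (ball (0 : ℂ) R)] with z h1 h2
      have := (h.toIsReducedPair.pairNormSq_pos h2).ne'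
      exact div_ne_zero (pow_ne_zero 2 (norm_ne_zero_iff.2 h1)) (pow_ne_zero 2 this)
    have hle : volume (ball (0 : ℂ) t) ≤
        volume (Function.support (pairDensity G H) ∩ ball (0 : ℂ) t) := by
      refine measure_mono_ae ?_
      filter_upwards [(ae_restrict_iff' measurableSet_ball).1 hae] with z hz hz'
      exact ⟨hz hz', hz'⟩
    exact (measure_ball_pos volume 0 ht0).trans_le hle
  rw [e] at hpos
  exact (mul_pos_iff_of_pos_left (by positivity)).1 hpos

end IsReducedQuotient

/-! ### The integral bound for the singular density -/

/-- The density `|f'|² / (1 + |f|²)²` with a logarithmically damped singularity at the points where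
`f` takes the value `a`. -/
noncomputable def gaugeDensity (f : ℂ → ℂ) (a : OnePoint ℂ) (z : ℂ) : ℝ :=
  π * fubiniStudyDensity f z * (logGauge 0 (chordal f a z) ^ 2 * chordal f a z)⁻¹

theorem measurable_indicator_ball {w : ℂ → ℝ} {R : ℝ} (hw : ContinuousOn w (ball 0 R)) :
    Measurable ((ball (0 : ℂ) R).indicator w) := by
  classical
  have := hw.measurable_piecewise (g := 0) continuousOn_const measurableSet_ball
  rwa [piecewise_eq_indicator] at this

theorem tendsto_gauge {D x : ℝ} (hx : x ∈ Icc (0 : ℝ) 1) (hx0 : 0 < x) {η : ℕ → ℝ}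
    (hη : Tendsto η atTop (𝓝 0)) :
    Tendsto (fun n => D * (logGauge (η n) x ^ 2 * (x + η n))⁻¹) atTop
      (𝓝 (D * (logGauge 0 x ^ 2 * x)⁻¹)) := by
  have h1 : Tendsto (fun n => x + η n) atTop (𝓝 x) := by simpa using hη.const_add x
  have h2 : Tendsto (fun n => logGauge (η n) x) atTop (𝓝 (logGauge 0 x)) := by
    have := (h1.log hx0.ne').const_sub 3
    simpa [logGauge] using this
  have h3 := two_le_logGauge le_rfl zero_le_one hx
  exact ((h2.pow 2).mul h1).inv₀ (by positivity) |>.const_mul D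

namespace IsReducedPair

variable {G H : ℂ → ℂ} {R r₀ r : ℝ} (h : IsReducedPair G H R)
include h

/-- Limit of the regularised bounds along η = 1/(n + 1), by Fatou; M has to be uniform in η. The
indicator makes the approximants measurable on the whole plane. -/
theorem radialLintegral_gauge_le (hr₀ : 0 < r₀) (hr : r₀ ≤ r) (hrR : r < R) {M : ℝ}
    (hM : ∀ η ∈ Ioc (0 : ℝ) 1,
      circleAverage (fun z => log (logGauge η (pairChordal G H z))) 0 r₀ ≤ M) :
    radialLintegral r₀ (fun z => ENNReal.ofReal ((ball (0 : ℂ) R).indicator (fun z =>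
      pairDensity G H z * (logGauge 0 (pairChordal G H z) ^ 2 * pairChordal G H z)⁻¹) z)) r ≤
      ENNReal.ofReal (2 * π * (2 * radialIntegral r₀ (pairDensity G H) r + M / 4)) := by
  set η : ℕ → ℝ := fun n => 1 / ((n : ℝ) + 1)
  have hη : ∀ n, 0 < η n := fun n => Nat.one_div_pos_of_nat
  have hη1 : ∀ n, η n ≤ 1 := fun n => by
    rw [div_le_one (by positivity)]; linarith [Nat.cast_nonneg (α := ℝ) n]
  set w : ℕ → ℂ → ℝ := fun n z => pairDensity G H z *
    (logGauge (η n) (pairChordal G H z) ^ 2 * (pairChordal G H z + η n))⁻¹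
  have hw : ∀ n, ContinuousOn (w n) (ball 0 R) := fun n => h.continuousOn_gauge_density (hη n) (hη1 n)
  have hw0 : ∀ n z, 0 ≤ w n z := fun n z => by
    have := pairChordal_nonneg (G := G) (H := H) (z := z)
    have := hη n
    have : 0 ≤ pairDensity G H z := by unfold pairDensity; positivity
    positivity
  refine (radialLintegral_le_liminf
    (hn := fun n z => ENNReal.ofReal ((ball (0 : ℂ) R).indicator (w n) z))
    (fun n => ENNReal.measurable_ofReal.comp (measurable_indicator_ball (hw n))) (fun z => ?_) r₀ r).trans ?_
  · by_cases hz : z ∈ ball (0 : ℂ) R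
    · simp only [indicator_of_mem hz]
      rcases (pairChordal_nonneg (G := G) (H := H) (z := z)).eq_or_lt with h0 | h0
      -- Where x = 0 the limiting density is 0, since `0⁻¹ = 0`, and the inequality is trivial.
      · simp [← h0]
      · have := tendsto_gauge (D := pairDensity G H z) ⟨h0.le, pairChordal_le_one⟩ h0
          (tendsto_one_div_add_atTop_nhds_zero_nat (𝕜 := ℝ))
        exact (ENNReal.tendsto_ofReal this).liminf_eq.ge
    · simp [indicator_of_notMem hz]
  · refine liminf_le_of_frequently_le' (Frequently.of_forall fun n => ?_)
    have e : radialLintegral r₀ (fun z => ENNReal.ofReal ((ball (0 : ℂ) R).indicator (w n) z)) r =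
        radialLintegral r₀ (fun z => ENNReal.ofReal (w n z)) r := by
      refine radialLintegral_congr_ball ?_ hrR.le
      filter_upwards [self_mem_codiscreteWithin (ball (0 : ℂ) R)] with z hz
      rw [indicator_of_mem hz]
    rw [e, radialLintegral_ofReal (hw n) (fun z _ => hw0 n z) hr₀ hr hrR]
    refine ENNReal.ofReal_le_ofReal (mul_le_mul_of_nonneg_left ?_ (by positivity))
    have h1 := h.radialIntegral_gauge_density_le (hη n) (hη1 n) hr₀ hr hrR
    have h2 := hM (η n) ⟨hη n, hη1 n⟩
    linarith

end IsReducedPair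

namespace IsReducedQuotient

variable {f G H : ℂ → ℂ} {R r₀ r s : ℝ} (h : IsReducedQuotient f G H R)
include h

/-- From log s ≤ s - 1 and s ≤ 3 - log x; the bound is uniform in η. -/
theorem circleAverage_log_logGauge_le (a : OnePoint ℂ) {η : ℝ} (hη : η ∈ Ioc (0 : ℝ) 1)
    (hs : 0 < s) (hsR : s < R) :
    circleAverage (fun z => log (logGauge η (pairChordal (form a G H) (coform a G H) z))) 0 s ≤
      3 - circleAverage (fun z => log (chordal f a z)) 0 s := by
  have hp := h.toIsReducedPair.form a
  have h2 := fun z => two_le_logGauge hη.1.le hη.2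
    ⟨pairChordal_nonneg (G := form a G H) (H := coform a G H) (z := z), pairChordal_le_one⟩
  have i1 : CircleIntegrable
      (fun z => log (logGauge η (pairChordal (form a G H) (coform a G H) z))) 0 s :=
    circleIntegrable_of_continuousOn_ball ((hp.continuousOn_logGauge hη.1).log
      fun z _ => by linarith [h2 z]) hs.le hsR
  have i2 := h.circleIntegrable_log_chordal a hs hsR
  have e := circleAverage_fun_sub (circleIntegrable_const (3 : ℝ) 0 s) i2
  rw [circleAverage_const] at e
  rw [← e]
  refine circleAverage_mono_ball hs hsR i1 ((circleIntegrable_const _ _ _).sub i2) ?_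
  filter_upwards [h.eventually_chordal_eq a, h.eventually_form_ne a,
    self_mem_codiscreteWithin (ball (0 : ℂ) R)] with z h3 h4 h5
  have h6 : 0 < pairChordal (form a G H) (coform a G H) z :=
    div_pos (by have := norm_pos_iff.2 h4; positivity) (hp.pairNormSq_pos h5)
  rw [chordal, h3]
  have h7 := log_le_sub_one_of_pos (show 0 < logGauge η _ by linarith [h2 z])
  have h8 := log_le_log h6 (le_add_of_nonneg_right hη.1.le)
  have h9 : logGauge η (pairChordal (form a G H) (coform a G H) z) =
    3 - log (pairChordal (form a G H) (coform a G H) z + η) := rfl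
  linarith

theorem eventually_gaugeDensity_eq (a : OnePoint ℂ) :
    gaugeDensity f a =ᶠ[codiscreteWithin (ball (0 : ℂ) R)] (ball (0 : ℂ) R).indicator fun z =>
      pairDensity (form a G H) (coform a G H) z *
        (logGauge 0 (pairChordal (form a G H) (coform a G H) z) ^ 2 *
          pairChordal (form a G H) (coform a G H) z)⁻¹ := by
  filter_upwards [h.eventually_chordal_eq a, h.eventually_fubiniStudyDensity_eq,
    self_mem_codiscreteWithin (ball (0 : ℂ) R)] with z h1 h2 h3
  rw [indicator_of_mem h3, pairDensity_form a (h.analytic_left z h3) (h.analytic_right z h3),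
    gaugeDensity, chordal, h1, h2]
  field_simp

theorem radialLintegral_gaugeDensity_le (a : OnePoint ℂ) (hr₀ : 0 < r₀) (hr : r₀ ≤ r)
    (hrR : r < R) :
    radialLintegral r₀ (fun z => ENNReal.ofReal (gaugeDensity f a z)) r ≤ ENNReal.ofReal
      (2 * π * (T r₀ f r + (3 - circleAverage (fun z => log (chordal f a z)) 0 r₀) / 4)) := by
  refine (radialLintegral_congr_ball ((h.eventually_gaugeDensity_eq a).fun_comp ENNReal.ofReal)
    hrR.le).trans_le ?_
  refine ((h.toIsReducedPair.form a).radialLintegral_gauge_le hr₀ hr hrR fun η hη =>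
    h.circleAverage_log_logGauge_le a hη hr₀ (hr.trans_lt hrR)).trans_eq ?_
  congr 2
  rw [h.T_eq hr₀ hr hrR]
  congr 2
  refine intervalIntegral.integral_congr fun t ht => ?_
  rw [uIcc_of_le hr] at ht
  congr 1
  refine intervalIntegral.integral_congr fun s hs => ?_
  rw [uIcc_of_le (hr₀.le.trans ht.1)] at hs
  congr 1
  refine circleAverage_congr_sphere fun z hz => ?_
  have hzR : z ∈ ball (0 : ℂ) R := by
    rw [mem_sphere, abs_of_nonneg hs.1] at hz
    rw [mem_ball, hz]; exact (hs.2.trans ht.2).trans_lt hrR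
  exact pairDensity_form a (h.analytic_left z hzR) (h.analytic_right z hzR)

end IsReducedQuotient

/-! ### The exceptional set -/

/-- The values of f on a discrete set are arbitrary; measurability is obtained from G and H instead.
-/
theorem IsReducedQuotient.exists_measurable_gauge {f G H : ℂ → ℂ} {R : ℝ}
    (h : IsReducedQuotient f G H R) (a : OnePoint ℂ) :
    ∃ Y : ℂ → ℝ, Measurable Y ∧ gaugeDensity f a =ᶠ[codiscreteWithin (ball (0 : ℂ) R)] Y := by
  have hp := h.toIsReducedPair.form a
  have h1 := measurable_indicator_ball hp.continuousOn_pairDensity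
  have h2 := measurable_indicator_ball hp.continuousOn_pairChordal
  have h3 := h2.add_const 0 |>.log.const_sub 3
  refine ⟨_, h1.mul ((h3.pow_const 2).mul h2).inv, ?_⟩
  filter_upwards [h.eventually_gaugeDensity_eq a, self_mem_codiscreteWithin (ball (0 : ℂ) R)]
    with z hz hzR
  simp only [hz, indicator_of_mem hzR, logGauge, Pi.inv_apply, Pi.mul_apply]

section

variable {f : ℂ → ℂ} (hf : MeromorphicOn f (ball (0 : ℂ) 1)) (hfc : Nonconstant f)
  (a : OnePoint ℂ)
include hf hfc

theorem aemeasurable_circleLintegral_gauge :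
    AEMeasurable (circleLintegral fun z => ENNReal.ofReal (gaugeDensity f a z))
      (volume.restrict (Ioo 0 1)) := by
  have hU : Ioo (0 : ℝ) 1 = ⋃ n : ℕ, Ioo (0 : ℝ) (1 - 1 / ((n : ℝ) + 1)) := by
    ext r
    simp only [mem_iUnion, mem_Ioo]
    constructor
    · rintro ⟨h0, h1⟩
      obtain ⟨n, hn⟩ := exists_nat_one_div_lt (sub_pos.2 h1)
      exact ⟨n, h0, by linarith⟩
    · rintro ⟨n, h0, h1⟩
      have : 0 < 1 / ((n : ℝ) + 1) := Nat.one_div_pos_of_nat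
      exact ⟨h0, by linarith⟩
  rw [hU, aemeasurable_iUnion_iff]
  intro n
  have hn : 1 - 1 / ((n : ℝ) + 1) < 1 := sub_lt_self _ Nat.one_div_pos_of_nat
  obtain ⟨G, H, h⟩ := exists_isReducedQuotient hn hf hfc
  obtain ⟨Y, hY, hYe⟩ := h.exists_measurable_gauge a
  refine (measurable_circleLintegral hY.ennreal_ofReal).aemeasurable.congr ?_
  refine (ae_restrict_iff' measurableSet_Ioo).2 (Eventually.of_forall fun s hs => ?_)
  exact (circleLintegral_congr_ball (hYe.fun_comp ENNReal.ofReal) hs.1 hs.2).symm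

/-- The additive constant in the integral bound for `gaugeDensity`. -/
noncomputable def gaugeConst (r₀ : ℝ) (f : ℂ → ℂ) (a : OnePoint ℂ) : ℝ :=
  |3 - circleAverage (fun z => log (chordal f a z)) 0 r₀| / 4

/-- A reduced quotient on a disc of radius R between r and 1 is used, but the bound involves only f,
so it holds for all r < 1 with one constant. -/
theorem radialLintegral_gauge_le_gaugeConst {r₀ r : ℝ} (hr₀ : 0 < r₀) (hr : r₀ ≤ r) (hr1 : r < 1) :
    radialLintegral r₀ (fun z => ENNReal.ofReal (gaugeDensity f a z)) r ≤
      ENNReal.ofReal (2 * π * (T r₀ f r + gaugeConst r₀ f a)) := by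
  obtain ⟨R, hrR, hR⟩ := exists_between hr1
  obtain ⟨G, H, h⟩ := exists_isReducedQuotient hR hf hfc
  refine (h.radialLintegral_gaugeDensity_le a hr₀ hr hrR).trans (ENNReal.ofReal_le_ofReal ?_)
  unfold gaugeConst
  gcongr
  exact le_abs_self _

/-- The disc integral is monotone in the radius, so an infinite value at r would make the finite
iterated integral over (t, t') infinite. -/
theorem discLintegral_gauge_lt_top {r : ℝ} (hr1 : r < 1) :
    discLintegral (fun z => ENNReal.ofReal (gaugeDensity f a z)) r < ⊤ := by
  set Y := fun z => ENNReal.ofReal (gaugeDensity f a z)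
  obtain ⟨t, ht, ht1⟩ := exists_between (max_lt hr1 (one_half_lt_one (α := ℝ)))
  obtain ⟨t', htt', ht'⟩ := exists_between ht1
  have ht0 : 0 < t := by linarith [le_max_right r (1 / 2)]
  have h1 : radialLintegral t Y t' < ⊤ :=
    (radialLintegral_gauge_le_gaugeConst hf hfc a ht0 htt'.le ht').trans_lt ENNReal.ofReal_lt_top
  have h2 : discLintegral Y r * ENNReal.ofReal (t' - t) ≤ radialLintegral t Y t' := by
    rw [← Real.volume_Ioo, ← setLIntegral_const]
    refine setLIntegral_mono' measurableSet_Ioo fun s hs => ?_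
    have h3 : (1 : ℝ≥0∞) ≤ ENNReal.ofReal s⁻¹ :=
      ENNReal.one_le_ofReal.2 ((one_le_inv₀ (ht0.trans hs.1)).2 (hs.2.trans ht').le)
    have h4 := monotone_discLintegral Y ((le_max_left r (1 / 2)).trans (ht.trans hs.1).le)
    calc discLintegral Y r = 1 * discLintegral Y r := (one_mul _).symm
      _ ≤ _ := mul_le_mul' h3 h4
  by_contra htop
  rw [not_lt, top_le_iff] at htop
  rw [htop, ENNReal.top_mul (by simpa using htt')] at h2
  exact (h1.trans_le h2).false

/-- Borel's lemma once for the integral in t and once for the integral in s. Each application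
squares the previous bound and adds a factor 1/(1 - r), whence the exponents 4 = 2·2 and 3 = 2·1 +
1. -/
theorem exists_exceptional_set_gauge {r₀ : ℝ} (hr₀ : 0 < r₀) :
    ∃ E ⊆ Ioo (0 : ℝ) 1, MeasurableSet E ∧ ∫⁻ r in E, ENNReal.ofReal (1 - r)⁻¹ < ⊤ ∧
      ∀ r ∈ Ioo (0 : ℝ) 1 \ E, r₀ < r →
        circleLintegral (fun z => ENNReal.ofReal (gaugeDensity f a z)) r ≤ ENNReal.ofReal
          (r₀⁻¹ * (4 * (1 + 2 * π * (T r₀ f r + gaugeConst r₀ f a)) ^ 4 * (1 - r)⁻¹ ^ 3)) := by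
  set Y := fun z => ENNReal.ofReal (gaugeDensity f a z)
  have hY := aemeasurable_circleLintegral_gauge hf hfc a
  have hdisc : ∀ r ∈ Ioo (0 : ℝ) 1, discLintegral Y r < ⊤ := fun r hr =>
    discLintegral_gauge_lt_top hf hfc a hr.2
  obtain ⟨E₂, hE₂, hE₂m, hE₂i, h₂⟩ := exists_exceptional_set
    (g := fun s => ENNReal.ofReal s * circleLintegral Y s)
    (ENNReal.measurable_ofReal.aemeasurable.mul hY) hdisc
  -- Borel's lemma uses primitives starting at 0, so the integrand is cut off below r₀.
  have hrad : ∀ r, ∫⁻ t in Ioo 0 r, (Ioi r₀).indicator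
      (fun t => ENNReal.ofReal t⁻¹ * discLintegral Y t) t = radialLintegral r₀ Y r := fun r => by
    rw [lintegral_indicator measurableSet_Ioi, Measure.restrict_restrict measurableSet_Ioi]
    congr 2
    ext t
    simp only [mem_inter_iff, mem_Ioi, mem_Ioo]
    exact ⟨fun h => ⟨h.1, h.2.2⟩, fun h => ⟨h.1, hr₀.trans h.1, h.2⟩⟩
  obtain ⟨E₁, hE₁, hE₁m, hE₁i, h₁⟩ := exists_exceptional_set
    (g := (Ioi r₀).indicator fun t => ENNReal.ofReal t⁻¹ * discLintegral Y t)
    ((((ENNReal.measurable_ofReal.comp measurable_inv).mul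
      (monotone_discLintegral Y).measurable).indicator measurableSet_Ioi).aemeasurable) (fun r hr => by
        rw [hrad]
        rcases le_or_gt r₀ r with h | h
        · exact (radialLintegral_gauge_le_gaugeConst hf hfc a hr₀ h hr.2).trans_lt
            ENNReal.ofReal_lt_top
        · simp [radialLintegral, Ioo_eq_empty h.le.not_gt])
  refine ⟨E₁ ∪ E₂, union_subset hE₁ hE₂, hE₁m.union hE₂m,
    (lintegral_union_le _ _ _).trans_lt (ENNReal.add_lt_top.2 ⟨hE₁i, hE₂i⟩), fun r hr hr₀r => ?_⟩
  have hr0 : 0 < r := hr₀.trans hr₀r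
  have hx : 1 ≤ (1 - r)⁻¹ := (one_le_inv₀ (sub_pos.2 hr.1.2)).2 (by linarith)
  have hT : 0 ≤ T r₀ f r := by
    obtain ⟨R, hrR, hR⟩ := exists_between hr.1.2
    obtain ⟨G, H, h⟩ := exists_isReducedQuotient hR hf hfc
    exact h.T_nonneg hr₀ hr₀r.le hrR
  set K := 2 * π * (T r₀ f r + gaugeConst r₀ f a)
  have hK : 0 ≤ K := by have : 0 ≤ gaugeConst r₀ f a := by unfold gaugeConst; positivity
                        positivity
  set x := (1 - r)⁻¹
  have b1 : discLintegral Y r ≤ ENNReal.ofReal ((1 + K) ^ 2 * x) := by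
    have h3 := h₁ r ⟨hr.1, fun h => hr.2 (Or.inl h)⟩
    rw [hrad, indicator_of_mem (mem_Ioi.2 hr₀r)] at h3
    calc discLintegral Y r = ENNReal.ofReal r * (ENNReal.ofReal r⁻¹ * discLintegral Y r) := by
          rw [← mul_assoc, ← ENNReal.ofReal_mul hr0.le, mul_inv_cancel₀ hr0.ne', ENNReal.ofReal_one,
            one_mul]
      _ ≤ 1 * ((1 + ENNReal.ofReal K) ^ 2 * ENNReal.ofReal x) := by
          refine mul_le_mul' (ENNReal.ofReal_le_one.2 hr.1.2.le) (h3.trans ?_)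
          gcongr
          exact radialLintegral_gauge_le_gaugeConst hf hfc a hr₀ hr₀r.le hr.1.2
      _ = _ := by
          rw [one_mul, ← ENNReal.ofReal_one, ← ENNReal.ofReal_add zero_le_one hK,
            ← ENNReal.ofReal_pow (by positivity), ← ENNReal.ofReal_mul (by positivity)]
  have h4 := h₂ r ⟨hr.1, fun h => hr.2 (Or.inr h)⟩
  have h5 : (1 : ℝ) ≤ (1 + K) ^ 2 * x := one_le_mul_of_one_le_of_one_le
    (one_le_pow₀ (by linarith)) hx
  calc circleLintegral Y r = ENNReal.ofReal r⁻¹ * (ENNReal.ofReal r * circleLintegral Y r) := by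
        rw [← mul_assoc, ← ENNReal.ofReal_mul (by positivity), inv_mul_cancel₀ hr0.ne',
          ENNReal.ofReal_one, one_mul]
    _ ≤ ENNReal.ofReal r₀⁻¹ * ((1 + ENNReal.ofReal ((1 + K) ^ 2 * x)) ^ 2 * ENNReal.ofReal x) := by
        refine mul_le_mul' (ENNReal.ofReal_le_ofReal (by gcongr)) (h4.trans ?_)
        gcongr
        exact b1
    _ = ENNReal.ofReal (r₀⁻¹ * ((1 + (1 + K) ^ 2 * x) ^ 2 * x)) := by
        rw [← ENNReal.ofReal_one, ← ENNReal.ofReal_add zero_le_one (by positivity),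
          ← ENNReal.ofReal_pow (by positivity), ← ENNReal.ofReal_mul (by positivity),
          ← ENNReal.ofReal_mul (by positivity)]
    _ ≤ _ := by
        refine ENNReal.ofReal_le_ofReal (mul_le_mul_of_nonneg_left ?_ (by positivity))
        calc (1 + (1 + K) ^ 2 * x) ^ 2 * x ≤ (2 * ((1 + K) ^ 2 * x)) ^ 2 * x := by
              gcongr; linarith
          _ = _ := by ring

end

/-! ### The pointwise inequality -/

/-- Tangent line of log at l. Averaged over a circle, with l dominating the average of u, it
replaces Jensen's inequality for the concave function log. -/
theorem log_le_div_add_log {u l : ℝ} (hu : 0 < u) (hl : 0 < l) : log u ≤ u / l + log l := by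
  have := log_le_sub_one_of_pos (div_pos hu hl)
  rw [log_div hu.ne' hl.ne'] at this
  linarith

/-- By separation every x_j except the smallest, x_k, is at least c, so only log(D/x_k) is singular;
it splits as log(D/(s²x_k)) + 2 log s. Since k varies with the point, its terms are replaced by sums
over all j, which can be averaged. -/
theorem log_sub_sum_log_le {ι : Type*} [Fintype ι] [Nonempty ι] {x : ι → ℝ} {D c l₁ l₂ : ℝ}
    (hD : 0 < D) (hx : ∀ j, x j ∈ Ioc (0 : ℝ) 1) (hc : 0 < c) (hc' : c ≤ 1)
    (hsep : ∀ i j, i ≠ j → 2 * c ≤ x i + x j) (hl₁ : 0 < l₁) (hl₂ : 0 < l₂) :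
    log D - ∑ j, log (x j) ≤ (∑ j, D * (logGauge 0 (x j) ^ 2 * x j)⁻¹) / l₂ + log l₂ +
      2 * ((∑ j, (3 - log (x j))) / l₁ + log l₁) - Fintype.card ι * log c := by
  classical
  obtain ⟨k, hk⟩ := Finite.exists_min x
  have hL : ∀ j, 0 < 3 - log (x j) := fun j => by
    linarith [log_nonpos (hx j).1.le (hx j).2]
  have hG : ∀ j, 0 < D * (logGauge 0 (x j) ^ 2 * x j)⁻¹ := fun j => by
    have := hL j
    have := (hx j).1
    rw [logGauge, add_zero]
    positivity
  have hlogc : log c ≤ 0 := log_nonpos hc.le hc'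
  have h1 : -∑ j, log (x j) ≤ -log (x k) - Fintype.card ι * log c := by
    rw [← Finset.add_sum_erase _ _ (Finset.mem_univ k), neg_add]
    have : -∑ j ∈ Finset.univ.erase k, log (x j) ≤ ∑ j ∈ Finset.univ.erase k, -log c := by
      rw [← Finset.sum_neg_distrib]
      refine Finset.sum_le_sum fun j hj => neg_le_neg (log_le_log hc ?_)
      have := hsep j k (Finset.ne_of_mem_erase hj)
      linarith [hk j]
    have h2 : ∑ j ∈ Finset.univ.erase k, -log c ≤ ∑ j : ι, -log c :=
      Finset.sum_le_sum_of_subset_of_nonneg (Finset.erase_subset _ _) fun _ _ _ => by linarith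
    rw [Finset.sum_const (s := Finset.univ), Finset.card_univ, nsmul_eq_mul] at h2
    linarith
  have h2 : log D - log (x k) =
      log (D * (logGauge 0 (x k) ^ 2 * x k)⁻¹) + 2 * log (3 - log (x k)) := by
    have := (hL k).ne'
    have := (hx k).1.ne'
    rw [logGauge, add_zero, log_mul hD.ne' (by positivity), log_inv, log_mul (by positivity) this,
      log_pow]
    push_cast
    ring
  have h3 := log_le_div_add_log (hG k) hl₂
  have h4 := log_le_div_add_log (hL k) hl₁
  have h5 : D * (logGauge 0 (x k) ^ 2 * x k)⁻¹ / l₂ ≤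
      (∑ j, D * (logGauge 0 (x j) ^ 2 * x j)⁻¹) / l₂ := by
    gcongr
    exact Finset.single_le_sum (f := fun j => D * (logGauge 0 (x j) ^ 2 * x j)⁻¹)
      (fun j _ => (hG j).le) (Finset.mem_univ k)
  have h6 : (3 - log (x k)) / l₁ ≤ (∑ j, (3 - log (x j))) / l₁ := by
    gcongr
    exact Finset.single_le_sum (f := fun j => 3 - log (x j))
      (fun j _ => (hL j).le) (Finset.mem_univ k)
  linarith

theorem exists_separation {ι : Type*} [Finite ι] {a : ι → OnePoint ℂ} (ha : Function.Injective a) :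
    ∃ c : ℝ, 0 < c ∧ c ≤ 1 ∧ ∀ i j, i ≠ j →
      2 * c ≤ ‖formFst (a i) * formSnd (a j) - formSnd (a i) * formFst (a j)‖ ^ 2 / 4 := by
  have hpos : ∀ p : {p : ι × ι // p.1 ≠ p.2}, (0 : ℝ) <
      ‖formFst (a p.1.1) * formSnd (a p.1.2) - formSnd (a p.1.1) * formFst (a p.1.2)‖ ^ 2 / 8 :=
    fun p => by
      have := norm_pos_iff.2 (form_det_ne_zero (ha.ne p.2))
      positivity
  -- Taking the lower bound inside `Ioi 0` makes it positive, even when there are no pairs.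
  obtain ⟨⟨c, hc⟩, h⟩ := Finite.exists_ge
    (fun p : {p : ι × ι // p.1 ≠ p.2} => (⟨_, hpos p⟩ : Ioi (0 : ℝ)))
  refine ⟨min c 1, lt_min hc one_pos, min_le_right _ _, fun i j hij => ?_⟩
  have h1 : c ≤ _ := h ⟨(i, j), hij⟩
  have h2 := min_le_left c 1
  simp only at h1
  linarith

theorem gaugeDensity_nonneg (f : ℂ → ℂ) (a : OnePoint ℂ) (z : ℂ) : 0 ≤ gaugeDensity f a z := by
  unfold gaugeDensity fubiniStudyDensity chordal; positivity

theorem finite_zeros {g : ℂ → ℂ} {R r : ℝ}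
    (hg : ∀ᶠ z in codiscreteWithin (ball (0 : ℂ) R), g z ≠ 0)
    (hrR : r < R) : {u | u ∈ closedBall (0 : ℂ) r ∧ g u = 0}.Finite := by
  by_contra hinf
  obtain ⟨z, hz, hacc⟩ := Set.Infinite.exists_accPt_of_subset_isCompact hinf
    (isCompact_closedBall (0 : ℂ) r) fun u hu => hu.1
  have h1 := mem_codiscreteWithin_ball_iff.1 hg z (closedBall_subset_ball hrR hz)
  obtain ⟨w, hw, hw'⟩ := ((accPt_iff_frequently_nhdsNE.1 hacc).and_eventually h1).exists
  exact hw' hw.2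

namespace IsReducedQuotient

variable {f G H : ℂ → ℂ} {R r₀ r s : ℝ} (h : IsReducedQuotient f G H R)
include h

/-! ### Averages over a circle -/

theorem circleIntegrable_gaugeDensity (a : OnePoint ℂ) (hs : 0 < s) (hsR : s < R) {K : ℝ}
    (hK : 0 ≤ K)
    (hle : circleLintegral (fun z => ENNReal.ofReal (gaugeDensity f a z)) s ≤ ENNReal.ofReal K) :
    CircleIntegrable (gaugeDensity f a) 0 s ∧ circleAverage (gaugeDensity f a) 0 s ≤ K := by
  obtain ⟨Y, hY, hYe⟩ := h.exists_measurable_gauge a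
  have hm : AEStronglyMeasurable (fun θ => gaugeDensity f a (circleMap 0 s θ))
      (volume.restrict (Ioc 0 (2 * π))) := by
    refine (hY.comp (continuous_circleMap 0 s).measurable).aestronglyMeasurable.congr ?_
    exact (ae_restrict_of_ae (ae_circleMap_of_ball hYe hs hsR)).mono fun θ hθ => hθ.symm
  have h0 : 0 ≤ᵐ[volume.restrict (Ioc 0 (2 * π))] fun θ => gaugeDensity f a (circleMap 0 s θ) :=
    Eventually.of_forall fun θ => gaugeDensity_nonneg f a _
  constructor
  · rw [CircleIntegrable, intervalIntegrable_iff_integrableOn_Ioc_of_le (by positivity)]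
    exact ⟨hm, (hasFiniteIntegral_iff_ofReal h0).2 (hle.trans_lt ENNReal.ofReal_lt_top)⟩
  · rw [circleAverage_def, intervalIntegral.integral_of_le (by positivity),
      integral_eq_lintegral_of_nonneg_ae h0 hm, smul_eq_mul]
    have h1 : (∫⁻ θ in Ioc 0 (2 * π), ENNReal.ofReal (gaugeDensity f a (circleMap 0 s θ))).toReal ≤
        K := ENNReal.toReal_le_of_le_ofReal hK hle
    have h2 : (2 * π)⁻¹ ≤ 1 := inv_le_one_of_one_le₀ (by linarith [pi_gt_three])
    calc _ ≤ 1 * K := mul_le_mul h2 h1 ENNReal.toReal_nonneg zero_le_one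
      _ = K := one_mul K

/-! ### Counting zeros -/

theorem form_eq_zero_unique {a b : OnePoint ℂ} {z : ℂ} (hz : z ∈ ball (0 : ℂ) R)
    (ha : form a G H z = 0) (hb : form b G H z = 0) : a = b := by
  by_contra hab
  have h1 := norm_pos_iff.2 (form_det_ne_zero hab)
  have h2 := det_sq_le_pairChordal_add (a := a) (b := b) (h.ne_zero z hz)
  simp only [pairChordal, ha, hb, norm_zero] at h2
  have : 0 < ‖formFst a * formSnd b - formSnd a * formFst b‖ ^ 2 / 4 := by positivity
  norm_num at h2
  linarith

-- At most one form vanishes at u, and its order exceeds that of the Wronskian by at most 1.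
open Classical in
theorem sum_order_form_le {ι : Type*} [Fintype ι] {a : ι → OnePoint ℂ} (ha : Function.Injective a)
    {u : ℂ} (hu : u ∈ ball (0 : ℂ) R) :
    ∑ j, analyticOrderNatAt (form (a j) G H) u ≤
      analyticOrderNatAt (pairWronskian G H) u + ∑ j, if form (a j) G H u = 0 then 1 else 0 := by
  have h0 : ∀ j, form (a j) G H u ≠ 0 → analyticOrderNatAt (form (a j) G H) u = 0 := fun j hj => by
    by_contra hne
    exact hj ((analyticOrderNatAt_pos_iff ((h.toIsReducedPair.form (a j)).analytic_left u hu)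
      (h.form_order_ne_top (a j) hu)).1 (Nat.pos_of_ne_zero hne))
  by_cases hex : ∃ k, form (a k) G H u = 0
  · obtain ⟨k, hk⟩ := hex
    have hk' : ∀ j ≠ k, form (a j) G H u ≠ 0 := fun j hjk hj =>
      hjk (ha (h.form_eq_zero_unique hu hj hk))
    rw [Finset.sum_eq_single k (fun j _ hjk => h0 j (hk' j hjk)) (by simp),
      Finset.sum_eq_single k (fun j _ hjk => if_neg (hk' j hjk)) (by simp), if_pos hk]
    exact h.order_form_le (a k) hu
  · push Not at hex
    rw [Finset.sum_eq_zero fun j _ => h0 j (hex j)]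
    exact Nat.zero_le _

open Classical in
theorem Nbar_eq_sum (a : OnePoint ℂ) (hr₀ : 0 < r₀) (hr : r₀ ≤ r) (hrR : r < R) {S : Finset ℂ}
    (hS : ∀ u ∈ closedBall (0 : ℂ) r, form a G H u = 0 → u ∈ S) :
    Nbar r₀ f a r = ∑ u ∈ S, (if form a G H u = 0 then 1 else 0) * countKernel r₀ r u := by
  unfold Nbar nbar
  rw [integral_ncard_div_eq_sum hr₀ hr (Z := S.filter fun u => form a G H u = 0) fun z hz => ?_,
    Finset.sum_filter]
  · simp only [ite_mul, one_mul, zero_mul]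
  · rw [h.takesValue_iff a (ball_subset_ball hrR.le hz), Finset.mem_filter]
    exact ⟨fun hz' => ⟨hS z (ball_subset_closedBall hz) hz', hz'⟩, fun hz' => hz'.2⟩

theorem sum_order_mul_countKernel_le {ι : Type*} [Fintype ι] {a : ι → OnePoint ℂ}
    (ha : Function.Injective a) (hr₀ : 0 < r₀) (hr : r₀ ≤ r) (hrR : r < R) {S : Finset ℂ}
    (hSR : ∀ u ∈ S, u ∈ closedBall (0 : ℂ) r)
    (hS : ∀ j, ∀ u ∈ closedBall (0 : ℂ) r, form (a j) G H u = 0 → u ∈ S) :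
    ∑ j, ∑ u ∈ S, (analyticOrderNatAt (form (a j) G H) u : ℝ) * countKernel r₀ r u ≤
      ∑ u ∈ S, (analyticOrderNatAt (pairWronskian G H) u : ℝ) * countKernel r₀ r u +
        ∑ j, Nbar r₀ f (a j) r := by
  classical
  simp_rw [fun j => h.Nbar_eq_sum (a j) hr₀ hr hrR (hS j)]
  rw [Finset.sum_comm, Finset.sum_comm (s := Finset.univ), ← Finset.sum_add_distrib]
  refine Finset.sum_le_sum fun u hu => ?_
  rw [← Finset.sum_mul, ← Finset.sum_mul, ← add_mul]
  refine mul_le_mul_of_nonneg_right ?_ (countKernel_nonneg hr u)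
  have := h.sum_order_form_le ha (closedBall_subset_ball hrR (hSR u hu))
  exact_mod_cast this

/-- Subtracting the Jensen formulas for the forms from the one for the density leaves T with
coefficient 2q - 4, where q is the cardinality of ι; the result is then halved. -/
theorem sub_two_mul_T_le {ι : Type*} [Fintype ι] {a : ι → OnePoint ℂ}
    (ha : Function.Injective a) (hr₀ : 0 < r₀) (hr : r₀ ≤ r) (hrR : r < R) {M : ℝ}
    (hM : circleAverage (fun z => log (fubiniStudyDensity f z)) 0 r -
      ∑ j, circleAverage (fun z => log (chordal f (a j) z)) 0 r ≤ M) :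
    ((Fintype.card ι : ℝ) - 2) * T r₀ f r ≤ ∑ j, Nbar r₀ f (a j) r +
      (M - (circleAverage (fun z => log (fubiniStudyDensity f z)) 0 r₀ -
        ∑ j, circleAverage (fun z => log (chordal f (a j) z)) 0 r₀)) / 2 := by
  classical
  -- One finite set containing all the zeros involved, so that all counting sums have the same index
  -- set.
  set S := (finite_zeros h.eventually_pairWronskian_ne hrR).toFinset ∪
    Finset.univ.biUnion fun j => (finite_zeros (h.eventually_form_ne (a j)) hrR).toFinset with hSdef
  have hSR : ∀ u ∈ S, u ∈ closedBall (0 : ℂ) r := fun u hu => by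
    simp only [hSdef, Finset.mem_union, Finset.mem_biUnion, Finite.mem_toFinset, mem_ofPred_eq] at hu
    rcases hu with hu | ⟨j, -, hu⟩ <;> exact hu.1
  have hSW : ∀ u ∈ closedBall (0 : ℂ) r, pairWronskian G H u = 0 → u ∈ S := fun u hu h0 =>
    Finset.mem_union_left _ ((Finite.mem_toFinset _).2 ⟨hu, h0⟩)
  have hS : ∀ j, ∀ u ∈ closedBall (0 : ℂ) r, form (a j) G H u = 0 → u ∈ S := fun j u hu h0 =>
    Finset.mem_union_right _ (Finset.mem_biUnion.2
      ⟨j, Finset.mem_univ j, (Finite.mem_toFinset _).2 ⟨hu, h0⟩⟩)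
  have h1 := h.circleAverage_log_density_sub hr₀ hr hrR hSW
  have h2 := Finset.sum_congr rfl fun j (_ : j ∈ Finset.univ) =>
    h.circleAverage_log_chordal_sub (a j) hr₀ hr hrR (hS j)
  rw [Finset.sum_sub_distrib, Finset.sum_sub_distrib, ← Finset.mul_sum, Finset.sum_const,
    Finset.card_univ, nsmul_eq_mul] at h2
  have h3 := h.sum_order_mul_countKernel_le ha hr₀ hr hrR hSR hS
  linarith

/-! ### The average of log density minus the logs of the chordal distances -/

theorem circleAverage_log_chordal_ge (a : OnePoint ℂ) (hr₀ : 0 < r₀) (hr : r₀ ≤ r) (hrR : r < R) :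
    3 - circleAverage (fun z => log (chordal f a z)) 0 r ≤ 4 * gaugeConst r₀ f a + 2 * T r₀ f r := by
  have h1 := h.circleAverage_log_chordal_sub a hr₀ hr hrR
    (S := (finite_zeros (h.eventually_form_ne a) hrR).toFinset)
    fun u hu h0 => (Finite.mem_toFinset _).2 ⟨hu, h0⟩
  -- Discarding the nonnegative counting term of the first main theorem leaves the proximity bounded
  -- by T plus a constant.
  have h2 : 0 ≤ ∑ u ∈ (finite_zeros (h.eventually_form_ne a) hrR).toFinset,
      (analyticOrderNatAt (form a G H) u : ℝ) * countKernel r₀ r u :=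
    Finset.sum_nonneg fun u _ => mul_nonneg (Nat.cast_nonneg _) (countKernel_nonneg hr u)
  have h3 := le_abs_self (3 - circleAverage (fun z => log (chordal f a z)) 0 r₀)
  unfold gaugeConst
  linarith

/-- The pointwise inequality is averaged with l₂ = K and l₁ = B. The averaged sums are at most card
ι · K and B, so the two quotients cost only card ι and 2. -/
theorem circleAverage_log_density_sub_sum_le {ι : Type*} [Fintype ι] [Nonempty ι]
    {a : ι → OnePoint ℂ} {c K B : ℝ} (hr₀ : 0 < r₀) (hr : r₀ ≤ r) (hrR : r < R)
    (hc : 0 < c) (hc' : c ≤ 1) (hsep : ∀ i j, i ≠ j →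
      2 * c ≤ ‖formFst (a i) * formSnd (a j) - formSnd (a i) * formFst (a j)‖ ^ 2 / 4)
    (hK : 0 < K) (hle : ∀ j, circleLintegral (fun z => ENNReal.ofReal (gaugeDensity f (a j) z)) r ≤
      ENNReal.ofReal K) (hB : 1 + ∑ j, (4 * gaugeConst r₀ f (a j) + 2 * T r₀ f r) ≤ B)
    (hB0 : 0 < B) :
    circleAverage (fun z => log (fubiniStudyDensity f z)) 0 r -
      ∑ j, circleAverage (fun z => log (chordal f (a j) z)) 0 r ≤
        Fintype.card ι + log K + 2 * (1 + log B) - Fintype.card ι * log c := by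
  have hr0 : 0 < r := hr₀.trans_le hr
  have iD := h.circleIntegrable_log_density hr0 hrR
  have iC := fun j => h.circleIntegrable_log_chordal (a j) hr0 hrR
  have iG := fun j => h.circleIntegrable_gaugeDensity (a j) hr0 hrR hK.le (hle j)
  have iL := fun j => (circleIntegrable_const (3 : ℝ) 0 r).sub (iC j)
  have iSG := CircleIntegrable.fun_sum Finset.univ fun j _ => (iG j).1
  have iSL := CircleIntegrable.fun_sum Finset.univ fun j _ => iL j
  have iSC := CircleIntegrable.fun_sum Finset.univ fun j _ => iC j
  set k : ℝ := log K + 2 * log B - Fintype.card ι * log c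
  have i1 := iSG.const_smul (a := K⁻¹)
  have i2 := iSL.const_smul (a := 2 * B⁻¹)
  have i3 := circleIntegrable_const k 0 r
  have hmono := circleAverage_mono_ball hr0 hrR (iD.sub iSC) ((i1.add i2).add i3) (by
    filter_upwards [h.eventually_pairWronskian_ne, h.eventually_fubiniStudyDensity_eq,
      eventually_all.2 fun j => h.eventually_chordal_eq (a j),
      eventually_all.2 fun j => h.eventually_form_ne (a j),
      self_mem_codiscreteWithin (ball (0 : ℂ) R)] with z hW hD hx hne hz
    have hP := h.toIsReducedPair.pairNormSq_pos hz
    have hD0 : 0 < fubiniStudyDensity f z := by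
      rw [hD, pairDensity]
      have := norm_pos_iff.2 hW
      have := pi_pos
      positivity
    have hx' : ∀ j, chordal f (a j) z = pairChordal (form (a j) G H) (coform (a j) G H) z := hx
    have hmain := log_sub_sum_log_le (x := fun j => chordal f (a j) z) (c := c)
      (D := π * fubiniStudyDensity f z) (by positivity) (fun j => by
        rw [hx']
        refine ⟨div_pos ?_ ((h.toIsReducedPair.form (a j)).pairNormSq_pos hz), pairChordal_le_one⟩
        have := norm_pos_iff.2 (hne j)
        positivity) hc hc' (fun i j hij => by
        simp only [hx']
        exact (hsep i j hij).trans (det_sq_le_pairChordal_add (h.ne_zero z hz))) hB0 hK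
    have hlog : log (fubiniStudyDensity f z) ≤ log (π * fubiniStudyDensity f z) :=
      log_le_log hD0 (le_mul_of_one_le_left hD0.le (by linarith [pi_gt_three]))
    have e1 : K⁻¹ * ∑ j, gaugeDensity f (a j) z = (∑ j, π * fubiniStudyDensity f z *
        (logGauge 0 (chordal f (a j) z) ^ 2 * chordal f (a j) z)⁻¹) / K := by
      rw [div_eq_inv_mul]; rfl
    have e2 : 2 * B⁻¹ * ∑ j, (3 - log (chordal f (a j) z)) =
        2 * ((∑ j, (3 - log (chordal f (a j) z))) / B) := by
      rw [div_eq_inv_mul]; ring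
    simp only [Pi.sub_apply, Pi.add_apply, Pi.smul_apply, smul_eq_mul]
    rw [e1, e2]
    linarith)
  rw [circleAverage_sub iD iSC, circleAverage_add (i1.add i2) i3, circleAverage_add i1 i2,
    circleAverage_smul, circleAverage_smul, circleAverage_const,
    circleAverage_fun_sum fun j _ => (iG j).1, circleAverage_fun_sum fun j _ => iC j,
    circleAverage_fun_sum fun j _ => iL j, smul_eq_mul, smul_eq_mul] at hmono
  have b1 : K⁻¹ * ∑ j, circleAverage (gaugeDensity f (a j)) 0 r ≤ Fintype.card ι := by
    rw [inv_mul_le_iff₀ hK]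
    refine (Finset.sum_le_sum fun j _ => (iG j).2).trans_eq ?_
    rw [Finset.sum_const, Finset.card_univ, nsmul_eq_mul, mul_comm]
  have b2 : 2 * B⁻¹ * ∑ j, circleAverage ((fun _ => (3 : ℝ)) - fun z => log (chordal f (a j) z)) 0 r ≤
      2 := by
    have : ∑ j, circleAverage ((fun _ => (3 : ℝ)) - fun z => log (chordal f (a j) z)) 0 r ≤ B := by
      refine (Finset.sum_le_sum fun j _ => ?_).trans ((le_add_of_nonneg_left zero_le_one).trans hB)
      rw [circleAverage_sub (circleIntegrable_const _ _ _) (iC j), circleAverage_const]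
      exact h.circleAverage_log_chordal_ge (a j) hr₀ hr hrR
    rw [mul_assoc]
    have h1 := (inv_mul_le_iff₀ hB0).2 (this.trans_eq (mul_one B).symm)
    linarith
  linarith

end IsReducedQuotient

/-! ### The second main theorem -/

theorem lintegral_iUnion_lt_top {ι : Type*} [Fintype ι] {E : ι → Set ℝ} {g : ℝ → ℝ≥0∞}
    (h : ∀ j, ∫⁻ r in E j, g r < ⊤) : ∫⁻ r in ⋃ j, E j, g r < ⊤ := by
  refine (lintegral_iUnion_le _ _).trans_lt ?_
  rw [tsum_fintype]
  exact ENNReal.sum_lt_top.2 fun j _ => h j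

theorem lintegral_Ioc_inv_one_sub_lt_top {b : ℝ} (hb : b < 1) :
    ∫⁻ r in Ioc 0 b, ENNReal.ofReal (1 - r)⁻¹ < ⊤ := by
  refine (setLIntegral_mono' (g := fun _ => ENNReal.ofReal (1 - b)⁻¹) measurableSet_Ioc
    fun r hr => ENNReal.ofReal_le_ofReal ?_).trans_lt ?_
  · have : 0 < 1 - b := sub_pos.2 hb
    gcongr
    exact hr.2
  · rw [setLIntegral_const]
    exact ENNReal.mul_lt_top ENNReal.ofReal_lt_top measure_Ioc_lt_top

section

variable {f : ℂ → ℂ} (hf : MeromorphicOn f (ball (0 : ℂ) 1)) (hfc : Nonconstant f) {r₀ : ℝ}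
  (hr₀ : 0 < r₀)
include hf hfc hr₀

theorem T_nonneg {r : ℝ} (hr : r₀ ≤ r) (hr1 : r < 1) : 0 ≤ T r₀ f r := by
  obtain ⟨R, hrR, hR⟩ := exists_between hr1
  obtain ⟨G, H, h⟩ := exists_isReducedQuotient hR hf hfc
  exact h.T_nonneg hr₀ hr hrR

theorem T_pos {r : ℝ} (hr : r₀ < r) (hr1 : r < 1) : 0 < T r₀ f r := by
  obtain ⟨R, hrR, hR⟩ := exists_between hr1
  obtain ⟨G, H, h⟩ := exists_isReducedQuotient hR hf hfc
  exact h.T_pos hr₀ hr hrR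

theorem T_mono {r r' : ℝ} (hr : r₀ ≤ r) (hrr' : r ≤ r') (hr1 : r' < 1) :
    T r₀ f r ≤ T r₀ f r' := by
  obtain ⟨R, hrR, hR⟩ := exists_between hr1
  obtain ⟨G, H, h⟩ := exists_isReducedQuotient hR hf hfc
  exact h.T_mono hr₀ hr hrr' hrR

/-- The circle bound contributes 4 log(1 + T) + 3 log 1/(1 - r), the proximity bound 2 log(1 + T);
halving gives the coefficients 3 and 3/2. -/
theorem exists_sub_two_mul_T_le {ι : Type*} [Fintype ι] {a : ι → OnePoint ℂ}
    (ha : Function.Injective a) :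
    ∃ (c₁ : ℝ) (E : Set ℝ), E ⊆ Ioo (0 : ℝ) 1 ∧ MeasurableSet E ∧
      ∫⁻ r in E, ENNReal.ofReal (1 - r)⁻¹ < ⊤ ∧ ∀ r ∈ Ioo (0 : ℝ) 1 \ E, r₀ < r →
        ((Fintype.card ι : ℝ) - 2) * T r₀ f r ≤ ∑ j, Nbar r₀ f (a j) r +
          (c₁ + 3 * log (1 + T r₀ f r) + 3 / 2 * log (1 / (1 - r))) := by
  -- The pointwise inequality needs a nearest target point; with no targets the left side is -2T ≤
  -- 0.
  rcases isEmpty_or_nonempty ι with hι | hι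
  · refine ⟨0, ∅, empty_subset _, MeasurableSet.empty, by simp, fun r hr hr₀r => ?_⟩
    have h1 := T_nonneg hf hfc hr₀ hr₀r.le hr.1.2
    have h2 : 0 ≤ log (1 + T r₀ f r) := log_nonneg (by linarith)
    have h3 : 0 ≤ log (1 / (1 - r)) :=
      log_nonneg ((one_le_div (sub_pos.2 hr.1.2)).2 (by linarith [hr.1.1]))
    simp only [Fintype.card_eq_zero, Finset.univ_eq_empty, Finset.sum_empty]
    push_cast
    linarith
  choose E hE hEm hEi hEle using fun j => exists_exceptional_set_gauge hf hfc (a j) hr₀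
  obtain ⟨c, hc, hc', hsep⟩ := exists_separation ha
  have hb : ∀ j, 0 ≤ gaugeConst r₀ f (a j) := fun j => by unfold gaugeConst; positivity
  set b := ∑ j, gaugeConst r₀ f (a j) with hb_def
  have hb0 : 0 ≤ b := Finset.sum_nonneg fun j _ => hb j
  set n := (Fintype.card ι : ℝ) with hn
  have hn0 : 0 ≤ n := Nat.cast_nonneg _
  -- Large enough that k(1 + t) dominates both 1 + 2π(t + `gaugeConst`) for each j and the sum of
  -- the proximity bounds.
  set k : ℝ := 1 + 2 * π + 2 * π * b + 4 * b + 2 * n with hk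
  have hπ := pi_pos
  have hk0 : 0 < k := by positivity
  refine ⟨(n + (log (r₀⁻¹ * 4) + 4 * log k) + 2 * (1 + log k) - n * log c -
    (circleAverage (fun z => log (fubiniStudyDensity f z)) 0 r₀ -
      ∑ j, circleAverage (fun z => log (chordal f (a j) z)) 0 r₀)) / 2, ⋃ j, E j,
    iUnion_subset hE, MeasurableSet.iUnion hEm, lintegral_iUnion_lt_top hEi, fun r hr hr₀r => ?_⟩
  obtain ⟨R, hrR, hR⟩ := exists_between hr.1.2
  obtain ⟨G, H, h⟩ := exists_isReducedQuotient hR hf hfc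
  have hT := h.T_nonneg hr₀ hr₀r.le hrR
  have hx : 0 < (1 - r)⁻¹ := inv_pos.2 (sub_pos.2 hr.1.2)
  set t := T r₀ f r
  have hle : ∀ j, circleLintegral (fun z => ENNReal.ofReal (gaugeDensity f (a j) z)) r ≤
      ENNReal.ofReal (r₀⁻¹ * (4 * (k * (1 + t)) ^ 4 * (1 - r)⁻¹ ^ 3)) := fun j => by
    refine (hEle j r ⟨hr.1, fun hj => hr.2 (mem_iUnion.2 ⟨j, hj⟩)⟩ hr₀r).trans
      (ENNReal.ofReal_le_ofReal ?_)
    have h1 : gaugeConst r₀ f (a j) ≤ b :=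
      Finset.single_le_sum (f := fun j => gaugeConst r₀ f (a j)) (fun j _ => hb j)
        (Finset.mem_univ j)
    have h2 : 1 + 2 * π * (t + gaugeConst r₀ f (a j)) ≤ k * (1 + t) := by
      calc 1 + 2 * π * (t + gaugeConst r₀ f (a j)) ≤ 1 + 2 * π * (t + b) := by gcongr
        _ ≤ k * (1 + t) := by
          rw [hk, ← sub_nonneg]
          ring_nf
          positivity
    have := hb j
    gcongr
  have hB : 1 + ∑ j, (4 * gaugeConst r₀ f (a j) + 2 * t) ≤ k * (1 + t) := by
    rw [Finset.sum_add_distrib, ← Finset.mul_sum, Finset.sum_const, Finset.card_univ, nsmul_eq_mul,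
      ← hb_def, ← hn, hk, ← sub_nonneg]
    ring_nf
    positivity
  have h1 := h.circleAverage_log_density_sub_sum_le hr₀ hr₀r.le hrR hc hc' hsep
    (by positivity) hle hB (by positivity)
  have h2 := h.sub_two_mul_T_le ha hr₀ hr₀r.le hrR h1
  have e1 : log (k * (1 + t)) = log k + log (1 + t) := log_mul hk0.ne' (by positivity)
  have e2 : log (r₀⁻¹ * (4 * (k * (1 + t)) ^ 4 * (1 - r)⁻¹ ^ 3)) =
      log (r₀⁻¹ * 4) + 4 * (log k + log (1 + t)) + 3 * log (1 / (1 - r)) := by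
    rw [← mul_assoc, ← mul_assoc, log_mul (by positivity) (by positivity),
      log_mul (by positivity) (by positivity), log_pow, log_pow, e1, one_div]
    push_cast
    ring
  rw [e1, e2] at h2
  linarith

end

/-! ### Absorbing the constants and choosing the final exceptional set -/

theorem error_le {c₁ τ t x : ℝ} (hτ : 0 < τ) (ht : τ ≤ t) (hx₀ : 0 ≤ log x) (hx : 1 ≤ log t + log x) :
    c₁ + 3 * log (1 + t) + 3 / 2 * log x ≤
      (|c₁| + 3 * log (1 + τ⁻¹) + 3 + 3 / 2 * (1 + |log τ|)) * (log t + log x) := by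
  have ht0 : 0 < t := hτ.trans_le ht
  have h1 : log (1 + t) ≤ log (1 + τ⁻¹) + log t := by
    rw [← log_mul (by positivity) ht0.ne']
    refine log_le_log (by positivity) ?_
    have : 1 ≤ τ⁻¹ * t := by rw [inv_mul_eq_div]; exact (one_le_div hτ).2 ht
    linarith
  have h2 := log_le_log hτ ht
  have h3 : 0 ≤ log (1 + τ⁻¹) := log_nonneg (by linarith [inv_pos.2 hτ])
  -- Every constant is multiplied by log t + log x ≥ 1. As log t may be negative, log x is bounded
  -- by log t + log x + |log τ|.
  have h4 := le_abs_self c₁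
  have h5 := neg_le_abs (log τ)
  have h6 := le_mul_of_one_le_right (abs_nonneg c₁) hx
  have h7 := le_mul_of_one_le_right h3 hx
  have h8 := le_mul_of_one_le_right (abs_nonneg (log τ)) hx
  calc c₁ + 3 * log (1 + t) + 3 / 2 * log x ≤ |c₁| * (log t + log x) +
        3 * (log (1 + τ⁻¹) * (log t + log x)) + 3 * (log t + log x) +
        3 / 2 * ((log t + log x) + |log τ| * (log t + log x)) := by linarith
    _ = _ := by ring

end DiscNevanlinna

theorem mainTheorem5
    (f : ℂ → ℂ) (hf : MeromorphicOn f (Metric.ball (0 : ℂ) 1))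
    (hfc : DiscNevanlinna.Nonconstant f)
    (q : ℕ) (a : Fin q → OnePoint ℂ) (ha : Function.Injective a)
    (r₀ : ℝ) (hr₀ : 0 < r₀) (hr₀' : r₀ < 1)
    (δ : ℝ) (hδ : 0 < δ) :
    ∃ (C : ℝ) (E : Set ℝ), 0 < C ∧ E ⊆ Set.Ioo (0 : ℝ) 1 ∧ MeasurableSet E ∧
      (∫⁻ r in E, ENNReal.ofReal ((1 - r)⁻¹)) < ⊤ ∧
      ∀ r ∈ Set.Ioo (0 : ℝ) 1 \ E,
        r₀ < r ∧ 0 < DiscNevanlinna.T r₀ f r ∧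
        ((q : ℝ) - 2) * DiscNevanlinna.T r₀ f r ≤
          (∑ j : Fin q, DiscNevanlinna.Nbar r₀ f (a j) r) +
            C * (Real.log (DiscNevanlinna.T r₀ f r) + Real.log (1 / (1 - r))) := by
  obtain ⟨c₁, E, hE, hEm, hEi, hle⟩ := DiscNevanlinna.exists_sub_two_mul_T_le hf hfc hr₀ ha
  obtain ⟨ρ, hρ, hρ1⟩ := exists_between hr₀'
  set τ := DiscNevanlinna.T r₀ f ρ
  have hτ : 0 < τ := DiscNevanlinna.T_pos hf hfc hr₀ hρ hρ1
  -- Beyond b one has r > ρ > r₀, hence T ≥ τ, and 1 - r < τ/e, hence log T + log 1/(1 - r) ≥ 1.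
  -- Since b < 1, adding (0, b] to the exceptional set costs only a finite amount.
  set b := max ρ (1 - τ * exp (-1))
  have hb1 : b < 1 := max_lt hρ1 (sub_lt_self _ (by positivity))
  refine ⟨|c₁| + 3 * log (1 + τ⁻¹) + 3 + 3 / 2 * (1 + |log τ|), E ∪ Ioc 0 b, ?_,
    union_subset hE fun r hr => ⟨hr.1, hr.2.trans_lt hb1⟩, hEm.union measurableSet_Ioc,
    (lintegral_union_le _ _ _).trans_lt (ENNReal.add_lt_top.2
      ⟨hEi, DiscNevanlinna.lintegral_Ioc_inv_one_sub_lt_top hb1⟩), fun r hr => ?_⟩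
  · have : 0 ≤ log (1 + τ⁻¹) := log_nonneg (by linarith [inv_pos.2 hτ])
    positivity
  have hbr : b < r := by
    by_contra hcon
    exact hr.2 (Or.inr ⟨hr.1.1, not_lt.1 hcon⟩)
  have hρr : ρ < r := (le_max_left _ _).trans_lt hbr
  have hr₀r : r₀ < r := hρ.trans hρr
  have hT := DiscNevanlinna.T_mono hf hfc hr₀ hρ.le hρr.le hr.1.2
  have hT0 := DiscNevanlinna.T_pos hf hfc hr₀ hr₀r hr.1.2
  have h1r : 0 < 1 - r := sub_pos.2 hr.1.2
  refine ⟨hr₀r, hT0, ?_⟩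
  have h1 := hle r ⟨hr.1, fun h => hr.2 (Or.inl h)⟩ hr₀r
  rw [Fintype.card_fin] at h1
  refine h1.trans (add_le_add_right (DiscNevanlinna.error_le hτ hT
    (log_nonneg ((one_le_div h1r).2 (by linarith [hr.1.1]))) ?_) _)
  have h2 : log (1 - r) ≤ log (τ * exp (-1)) :=
    log_le_log h1r (by linarith [(le_max_right ρ (1 - τ * exp (-1))).trans_lt hbr])
  rw [log_mul hτ.ne' (exp_pos _).ne', log_exp] at h2
  have h3 := log_le_log hτ hT
  rw [one_div, log_inv]
  linarith
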